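/- Let $n\ge 1$, let $\Theta$ be a real skew-symmetric $n\times n$ matrix and let $A_\Theta$ be the smooth noncommutative $n$-torus: the $*$-algebra of series $a=\sum_{r\in\mathbb Z^n}a_rU^r$, $U^r=U_1^{r_1}\cdots U_n^{r_n}$, with rapidly decreasing complex coefficients, where $U_1,\dots,U_n$ are unitaries with $U_kU_m=e^{2\pi i\Theta_{km}}U_mU_k$. Put $\tau(a)=a_0$ and $\delta_j(U^r)=r_jU^r$. Let $N=2^{\lfloor n/2\rfloor}$, let $\gamma_1,\dots,\gamma_n\in M_N(\mathbb C)$ be Hermitian with $\gamma_j\gamma_k+\gamma_k\gamma_j=2\delta_{jk}$, and let $D$ be the self-adjoint operator $\sum_j\delta_j\otimes\gamma_j$ on $L^2(A_\Theta,\tau)\otimes\mathbb C^N$, on which $A_\Theta$ acts by left multiplication on the first factor; $|D|^{-n}$ is taken to be $0$ on $\ker D$. Let $\mathrm{Tr}_\omega$ be the Dixmier trace of a generalized limit $\omega$ on bounded sequences that is invariant under $(\alpha_1,\alpha_2,\dots)\mapsto(\alpha_1,\alpha_1,\alpha_2,\alpha_2,\dots)$. Let $\Omega^\bullet$ be the universal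 differential graded algebra of $A_\Theta$, $\pi(a_0\,da_1\cdots da_k)=a_0[D,a_1]\cdots[D,a_k]$, $J_0^1=\ker(\pi|_{\Omega^1})$, $\Omega^1_D=\pi(\Omega^1)$ and $\Omega^2_D=\pi(\Omega^2)/\pi(dJ_0^1)$, with the induced products and differentials. Let $\mathcal H_2$ be the Hilbert space completion of $\pi(\Omega^2)$ for $\langle T_1,T_2\rangle=\mathrm{Tr}_\omega(T_1^*T_2|D|^{-n})$, let $P$ be the orthogonal projection of $\mathcal H_2$ onto the orthogonal complement of $\pi(dJ_0^1)$, and give $\Omega^2_D$ the inner product $\langle [T_1],[T_2]\rangle=\langle PT_1,PT_2\rangle$. Let $q\ge 0$, let $p=p^*=p^2\in M_q(A_\Theta)$ and let $E=pA_\Theta^q$ be the right module with Hermitian structure $\langle\xi,\eta\rangle=\sum_k\xi_k^*\eta_k$. Let $\nabla:E\to E\otimes_{A_\Theta}\Omega^1_D$ be a compatible connection: $\nabla$ is $\mathbb C$-linear, $\nabla(\xi a)=(\nabla\xi)a+\xi\otimes da$ and $\langle\xi,\nabla\eta\rangle-\langle\nabla\xi,\eta\rangle=d\langle\xi,\eta\rangle$.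 Its curvature is $R_\nabla=\widetilde\nabla\circ\nabla:E\to E\otimes_{A_\Theta}\Omega^2_D$, where $\widetilde\nabla(\xi\otimes\omega)=(\nabla\xi)\omega+\xi\otimes d\omega$, and $YM(\nabla)=\langle\langle R_\nabla,R_\nabla\rangle\rangle$, where $\langle\langle\varphi,\psi\rangle\rangle=\sum_{k=1}^q\langle\varphi(pe_k),\psi(pe_k)\rangle$ with $E\otimes_{A_\Theta}\Omega^2_D$ viewed inside $(\Omega^2_D)^q$. Put $\sigma_j=U_j^*dU_j\in\Omega^1_D$. Then there are unique linear maps $\nabla_1,\dots,\nabla_n:E\to E$ with $\nabla\xi=\sum_j\nabla_j\xi\otimes\sigma_j$ for all $\xi$; each commutator $[\nabla_m,\nabla_j]$ is an endomorphism of the right $A_\Theta$-module $E$, that is, an element of $pM_q(A_\Theta)p$; the form $\langle T_1,T_2\rangle$ on $\pi(\Omega^2)$ does admit such a Hilbert space completion; $\mathrm{Tr}_\omega(|D|^{-n})>0$; and $$YM(\nabla)=\mathrm{Tr}_\omega(|D|^{-n})\sum_{m<j}\tau_q\big([\nabla_m,\nabla_j]^*[\nabla_m,\nabla_j]\big),$$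 where $\tau_q=\tau\otimes\mathrm{Trace}$ on $M_q(A_\Theta)$. -/

import Mathlib

open scoped TensorProduct InnerProductSpace ENNReal Topology
open Filter

noncomputable section

/-- A spectral triple over a unital complex `*`-algebra `A`, faithfully and unitally represented
on the Hilbert space `H`. -/
structure SpectralTriple (A H : Type) [Ring A] [StarRing A] [Algebra ℂ A]
    [NormedAddCommGroup H] [InnerProductSpace ℂ H] [CompleteSpace H] where
  /-- the representation of the algebra -/
  rep : A →⋆ₐ[ℂ] (H →L[ℂ] H)
  faithful : Function.Injective rep
  /-- the Dirac operator -/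
  D : H →ₗ.[ℂ] H
  selfAdjoint : IsSelfAdjoint D
  compact_resolvent : ∃ R : H →L[ℂ] H, IsCompactOperator R ∧
    ∀ x : H, ∃ h : R x ∈ D.domain, D ⟨R x, h⟩ + Complex.I • R x = x
  bounded_comm : ∀ a : A, ∃ T : H →L[ℂ] H, ∀ x : D.domain,
    ∃ h : rep a x ∈ D.domain, D ⟨rep a x, h⟩ - rep a (D x) = T x

/-- `A / ℂ1`. -/
abbrev ReducedAlg (A : Type) [Ring A] [Algebra ℂ A] : Type :=
  A ⧸ Submodule.span ℂ ({1} : Set A)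

/-- The universal one-forms `Ω¹(A) = A ⊗ (A / ℂ1)`; the tensor `a₀ ⊗ a₁` stands for `a₀ da₁`. -/
abbrev UnivForm1 (A : Type) [Ring A] [Algebra ℂ A] : Type := A ⊗[ℂ] ReducedAlg A

/-- The universal two-forms; the tensor `a₀ ⊗ (a₁ ⊗ a₂)` stands for `a₀ da₁ da₂`. -/
abbrev UnivForm2 (A : Type) [Ring A] [Algebra ℂ A] : Type :=
  A ⊗[ℂ] (ReducedAlg A ⊗[ℂ] ReducedAlg A)

/-- The universal differential `a₀ da₁ ↦ da₀ da₁`. -/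
def univD1 (A : Type) [Ring A] [Algebra ℂ A] : UnivForm1 A →ₗ[ℂ] UnivForm2 A :=
  (TensorProduct.mk ℂ A (ReducedAlg A ⊗[ℂ] ReducedAlg A) 1).comp
    (TensorProduct.map (Submodule.mkQ _) LinearMap.id)

/-- Left multiplication of universal one-forms. -/
def univLmul1 (A : Type) [Ring A] [Algebra ℂ A] (a : A) : UnivForm1 A →ₗ[ℂ] UnivForm1 A :=
  TensorProduct.map (LinearMap.mulLeft ℂ a) LinearMap.id

/-- The relations `x a ⊗ m = x ⊗ a m`. -/
def balancedRel (A E M : Type) [Ring A] [Algebra ℂ A] [AddCommGroup E] [Module ℂ E]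
    [Module Aᵐᵒᵖ E] [AddCommGroup M] [Module ℂ M] [Module A M] : Submodule ℂ (E ⊗[ℂ] M) :=
  Submodule.span ℂ
    {t | ∃ (x : E) (a : A) (m : M), t = (MulOpposite.op a • x) ⊗ₜ[ℂ] m - x ⊗ₜ[ℂ] (a • m)}

/-- The tensor product `E ⊗_A M` of a right `A`-module `E` and a left `A`-module `M`. -/
abbrev BalTensor (A E M : Type) [Ring A] [Algebra ℂ A] [AddCommGroup E] [Module ℂ E]
    [Module Aᵐᵒᵖ E] [AddCommGroup M] [Module ℂ M] [Module A M] : Type :=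
  (E ⊗[ℂ] M) ⧸ balancedRel A E M

section BalTensor

variable {A E M : Type} [Ring A] [Algebra ℂ A] [AddCommGroup E] [Module ℂ E]
    [Module Aᵐᵒᵖ E] [AddCommGroup M] [Module ℂ M] [Module A M]

/-- The elementary tensor `x ⊗ m` in `E ⊗_A M`. -/
def btmul (A : Type) {E M : Type} [Ring A] [Algebra ℂ A] [AddCommGroup E] [Module ℂ E]
    [Module Aᵐᵒᵖ E] [AddCommGroup M] [Module ℂ M] [Module A M] (x : E) (m : M) :
    BalTensor A E M :=
  (balancedRel A E M).mkQ (x ⊗ₜ[ℂ] m)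

/-- The linear map on `E ⊗_A M` induced by a balanced bilinear map. -/
def BalTensor.lift {X : Type} [AddCommGroup X] [Module ℂ X] (f : E →ₗ[ℂ] M →ₗ[ℂ] X)
    (hf : ∀ (x : E) (a : A) (m : M), f (MulOpposite.op a • x) m = f x (a • m)) :
    BalTensor A E M →ₗ[ℂ] X :=
  (balancedRel A E M).liftQ (TensorProduct.lift f) (by
    rw [balancedRel, Submodule.span_le]
    rintro _ ⟨x, a, m, rfl⟩
    simp [hf])

theorem BalTensor.lift_btmul {X : Type} [AddCommGroup X] [Module ℂ X] (f : E →ₗ[ℂ] M →ₗ[ℂ] X)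
    (hf : ∀ (x : E) (a : A) (m : M), f (MulOpposite.op a • x) m = f x (a • m)) (x : E) (m : M) :
    BalTensor.lift f hf (btmul A x m) = f x m := by
  simp [BalTensor.lift, btmul]

/-- The elementary tensor as a bilinear map. -/
def btmulₗ (A E M : Type) [Ring A] [Algebra ℂ A] [AddCommGroup E] [Module ℂ E]
    [Module Aᵐᵒᵖ E] [AddCommGroup M] [Module ℂ M] [Module A M] :
    E →ₗ[ℂ] M →ₗ[ℂ] BalTensor A E M :=
  (TensorProduct.mk ℂ E M).compr₂ (balancedRel A E M).mkQ

theorem btmulₗ_apply (x : E) (m : M) : btmulₗ A E M x m = btmul A x m := rfl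

theorem btmul_balanced (x : E) (a : A) (m : M) :
    btmul A (MulOpposite.op a • x) m = btmul A x (a • m) := by
  rw [← sub_eq_zero, btmul, btmul, ← map_sub, Submodule.mkQ_apply, Submodule.Quotient.mk_eq_zero]
  exact Submodule.subset_span ⟨x, a, m, rfl⟩

theorem BalTensor.hom_ext {X : Type} [AddCommGroup X] [Module ℂ X]
    {f g : BalTensor A E M →ₗ[ℂ] X} (h : ∀ x m, f (btmul A x m) = g (btmul A x m)) : f = g := by
  apply Submodule.linearMap_qext
  apply TensorProduct.ext'
  exact h

end BalTensor

namespace SpectralTriple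

variable {A H : Type} [Ring A] [StarRing A] [Algebra ℂ A]
    [NormedAddCommGroup H] [InnerProductSpace ℂ H] [CompleteSpace H] (S : SpectralTriple A H)

/-- `T` is the bounded extension of the commutator `[D, a]`. -/
def IsComm (a : A) (T : H →L[ℂ] H) : Prop :=
  ∀ x : S.D.domain, ∃ h : S.rep a x ∈ S.D.domain, S.D ⟨S.rep a x, h⟩ - S.rep a (S.D x) = T x

theorem IsComm.unique {a : A} {T T' : H →L[ℂ] H} (h : S.IsComm a T) (h' : S.IsComm a T') :
    T = T' := by
  have hd := S.selfAdjoint.dense_domain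
  apply ContinuousLinearMap.coeFn_injective
  refine Continuous.ext_on hd T.continuous T'.continuous ?_
  intro x hx
  obtain ⟨h1, e1⟩ := h ⟨x, hx⟩
  obtain ⟨h2, e2⟩ := h' ⟨x, hx⟩
  exact e1.symm.trans e2

theorem IsComm.add {a b : A} {T T' : H →L[ℂ] H} (h : S.IsComm a T) (h' : S.IsComm b T') :
    S.IsComm (a + b) (T + T') := by
  intro x
  obtain ⟨h1, e1⟩ := h x
  obtain ⟨h2, e2⟩ := h' x
  have e : S.rep (a + b) x = S.rep a x + S.rep b x := by simp
  refine ⟨e ▸ S.D.domain.add_mem h1 h2, ?_⟩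
  have : (⟨S.rep (a + b) x, e ▸ S.D.domain.add_mem h1 h2⟩ : S.D.domain) =
    ⟨_, h1⟩ + ⟨_, h2⟩ := Subtype.ext e
  rw [this, S.D.map_add]
  simp only [map_add, _root_.add_apply, ← e1, ← e2]
  abel

theorem IsComm.smul {a : A} {T : H →L[ℂ] H} (h : S.IsComm a T) (c : ℂ) :
    S.IsComm (c • a) (c • T) := by
  intro x
  obtain ⟨h1, e1⟩ := h x
  have e : S.rep (c • a) x = c • S.rep a x := by simp
  refine ⟨e ▸ S.D.domain.smul_mem c h1, ?_⟩
  have : (⟨S.rep (c • a) x, e ▸ S.D.domain.smul_mem c h1⟩ : S.D.domain) =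
    c • ⟨_, h1⟩ := Subtype.ext e
  rw [this, S.D.map_smul]
  simp only [map_smul, _root_.smul_apply, ← e1, smul_sub]

theorem IsComm.mul {a b : A} {T T' : H →L[ℂ] H} (h : S.IsComm a T) (h' : S.IsComm b T') :
    S.IsComm (a * b) (T * S.rep b + S.rep a * T') := by
  intro x
  obtain ⟨h2, e2⟩ := h' x
  obtain ⟨h1, e1⟩ := h ⟨_, h2⟩
  have e : S.rep (a * b) x = S.rep a (S.rep b x) := by simp
  refine ⟨e ▸ h1, ?_⟩
  have : (⟨S.rep (a * b) x, e ▸ h1⟩ : S.D.domain) = ⟨_, h1⟩ := Subtype.ext e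
  rw [this]
  have e1' : S.D ⟨_, h1⟩ - S.rep a (S.D ⟨S.rep b x, h2⟩) = T (S.rep b x) := e1
  have e2' := congrArg (S.rep a) e2
  rw [map_sub] at e2'
  rw [map_mul]
  change S.D ⟨_, h1⟩ - S.rep a (S.rep b (S.D x)) = T (S.rep b x) + S.rep a (T' x)
  rw [← e1', ← e2']
  abel

theorem IsComm.one : S.IsComm 1 0 := by
  intro x
  have e : S.rep 1 x = (x : H) := by simp
  have hm : S.rep 1 x ∈ S.D.domain := by rw [e]; exact x.2
  refine ⟨hm, ?_⟩
  have : (⟨S.rep 1 x, hm⟩ : S.D.domain) = x := Subtype.ext e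
  rw [this]
  simp

/-- The linear map `a ↦ [D, a]`, with values in the bounded operators. -/
def comm : A →ₗ[ℂ] (H →L[ℂ] H) where
  toFun a := (S.bounded_comm a).choose
  map_add' a b := IsComm.unique S (S.bounded_comm (a + b)).choose_spec
    (IsComm.add S (S.bounded_comm a).choose_spec (S.bounded_comm b).choose_spec)
  map_smul' c a := IsComm.unique S (S.bounded_comm (c • a)).choose_spec
    (IsComm.smul S (S.bounded_comm a).choose_spec c)

theorem isComm_comm (a : A) : S.IsComm a (S.comm a) := (S.bounded_comm a).choose_spec

theorem comm_one : S.comm 1 = 0 := IsComm.unique S (S.isComm_comm 1) (IsComm.one S)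

theorem comm_mul (a b : A) : S.comm (a * b) = S.comm a * S.rep b + S.rep a * S.comm b :=
  IsComm.unique S (S.isComm_comm _) (IsComm.mul S (S.isComm_comm a) (S.isComm_comm b))

/-- `[D, ·]` on `A / ℂ1`. -/
def commBar : ReducedAlg A →ₗ[ℂ] (H →L[ℂ] H) :=
  (Submodule.span ℂ ({1} : Set A)).liftQ S.comm (by
    rw [Submodule.span_le]
    rintro _ rfl
    exact S.comm_one)

/-- `π(a₀ da₁) = a₀ [D, a₁]`. -/
def pi1 : UnivForm1 A →ₗ[ℂ] (H →L[ℂ] H) :=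
  TensorProduct.lift
    ((LinearMap.mul ℂ (H →L[ℂ] H)).compl₁₂ S.rep.toAlgHom.toLinearMap S.commBar)

/-- `π(a₀ da₁ da₂) = a₀ [D, a₁] [D, a₂]`. -/
def pi2 : UnivForm2 A →ₗ[ℂ] (H →L[ℂ] H) :=
  TensorProduct.lift
    ((LinearMap.mul ℂ (H →L[ℂ] H)).compl₁₂ S.rep.toAlgHom.toLinearMap
      (TensorProduct.lift ((LinearMap.mul ℂ (H →L[ℂ] H)).compl₁₂ S.commBar S.commBar)))

theorem pi1_tmul (a b : A) :
    S.pi1 (a ⊗ₜ[ℂ] (Submodule.Quotient.mk b)) = S.rep a * S.comm b := rfl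

theorem pi2_tmul (a b c : A) :
    S.pi2 (a ⊗ₜ[ℂ] (Submodule.Quotient.mk b ⊗ₜ[ℂ] Submodule.Quotient.mk c)) =
      S.rep a * (S.comm b * S.comm c) := rfl

theorem pi2_d_tmul (a b : A) :
    S.pi2 (univD1 A (a ⊗ₜ[ℂ] (Submodule.Quotient.mk b))) = S.comm a * S.comm b := by
  have : univD1 A (a ⊗ₜ[ℂ] (Submodule.Quotient.mk b)) =
    1 ⊗ₜ[ℂ] (Submodule.Quotient.mk a ⊗ₜ[ℂ] Submodule.Quotient.mk b) := rfl
  rw [this, pi2_tmul]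
  simp

/-- `Ω¹_D = π(Ω¹)`. Since `π` is injective on `A`, nothing has to be divided out in degree one. -/
def Omega1 : Submodule ℂ (H →L[ℂ] H) := LinearMap.range S.pi1

/-- `π(Ω²)`. -/
def piOmega2 : Submodule ℂ (H →L[ℂ] H) := LinearMap.range S.pi2

/-- `π(d J₀¹)`, where `J₀¹` is the kernel of `π` on universal one-forms; a subspace of `π(Ω²)`. -/
def piDJ : Submodule ℂ S.piOmega2 :=
  ((LinearMap.ker S.pi1).map (S.pi2.rangeRestrict ∘ₗ univD1 A) : Submodule ℂ (LinearMap.range S.pi2))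

/-- `Ω²_D = π(Ω²) / π(d J₀¹)`. -/
abbrev Omega2 : Type := S.piOmega2 ⧸ S.piDJ

theorem univForm1_induction {A : Type} [Ring A] [Algebra ℂ A] {P : UnivForm1 A → Prop}
    (h0 : P 0) (h1 : ∀ a b : A, P (a ⊗ₜ[ℂ] (Submodule.Quotient.mk b)))
    (h2 : ∀ x y, P x → P y → P (x + y)) (x : UnivForm1 A) : P x := by
  induction x using TensorProduct.induction_on with
  | zero => exact h0
  | tmul a b => obtain ⟨b, rfl⟩ := Submodule.Quotient.mk_surjective _ b; exact h1 a b
  | add x y hx hy => exact h2 x y hx hy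

theorem univForm2_induction {A : Type} [Ring A] [Algebra ℂ A] {P : UnivForm2 A → Prop}
    (h0 : P 0) (h1 : ∀ a b c : A,
      P (a ⊗ₜ[ℂ] (Submodule.Quotient.mk b ⊗ₜ[ℂ] Submodule.Quotient.mk c)))
    (h2 : ∀ x y, P x → P y → P (x + y)) (x : UnivForm2 A) : P x := by
  induction x using TensorProduct.induction_on with
  | zero => exact h0
  | add x y hx hy => exact h2 x y hx hy
  | tmul a t =>
    induction t using TensorProduct.induction_on with
    | zero => simpa using h0
    | add x y hx hy => rw [TensorProduct.tmul_add]; exact h2 _ _ hx hy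
    | tmul b c =>
      obtain ⟨b, rfl⟩ := Submodule.Quotient.mk_surjective _ b
      obtain ⟨c, rfl⟩ := Submodule.Quotient.mk_surjective _ c
      exact h1 a b c

theorem pi1_lmul (a : A) (w : UnivForm1 A) : S.pi1 (univLmul1 A a w) = S.rep a * S.pi1 w := by
  induction w using univForm1_induction with
  | h0 => simp
  | h1 b c =>
    have : univLmul1 A a (b ⊗ₜ[ℂ] (Submodule.Quotient.mk c)) =
      (a * b) ⊗ₜ[ℂ] (Submodule.Quotient.mk c) := rfl
    rw [this, pi1_tmul, pi1_tmul, map_mul, mul_assoc]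
  | h2 x y hx hy => simp only [map_add, hx, hy, mul_add]

theorem pi2_d_lmul (a : A) (w : UnivForm1 A) :
    S.pi2 (univD1 A (univLmul1 A a w)) = S.comm a * S.pi1 w + S.rep a * S.pi2 (univD1 A w) := by
  induction w using univForm1_induction with
  | h0 => simp
  | h1 b c =>
    have : univLmul1 A a (b ⊗ₜ[ℂ] (Submodule.Quotient.mk c)) =
      (a * b) ⊗ₜ[ℂ] (Submodule.Quotient.mk c) := rfl
    rw [this, pi1_tmul, pi2_d_tmul, pi2_d_tmul, comm_mul]
    noncomm_ring
  | h2 x y hx hy => simp only [map_add, hx, hy, mul_add]; abel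

theorem lmul_mem_Omega1 (a : A) {w : H →L[ℂ] H} (hw : w ∈ S.Omega1) : S.rep a * w ∈ S.Omega1 := by
  obtain ⟨w, rfl⟩ := hw
  exact ⟨_, S.pi1_lmul a w⟩

theorem rmul_mem_Omega1 (a : A) {w : H →L[ℂ] H} (hw : w ∈ S.Omega1) : w * S.rep a ∈ S.Omega1 := by
  obtain ⟨w, rfl⟩ := hw
  induction w using univForm1_induction with
  | h0 => simp
  | h1 b c =>
    refine ⟨b ⊗ₜ[ℂ] (Submodule.Quotient.mk (c * a)) -
      (b * c) ⊗ₜ[ℂ] (Submodule.Quotient.mk a), ?_⟩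
    rw [map_sub, pi1_tmul, pi1_tmul, pi1_tmul, comm_mul, map_mul]
    noncomm_ring
  | h2 x y hx hy => rw [map_add, add_mul]; exact S.Omega1.add_mem hx hy

theorem comm_mem_Omega1 (a : A) : S.comm a ∈ S.Omega1 :=
  ⟨1 ⊗ₜ[ℂ] (Submodule.Quotient.mk a), by rw [pi1_tmul]; simp⟩

theorem lmul_mem_piOmega2 (a : A) {w : H →L[ℂ] H} (hw : w ∈ S.piOmega2) :
    S.rep a * w ∈ S.piOmega2 := by
  obtain ⟨w, rfl⟩ := hw
  induction w using univForm2_induction with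
  | h0 => simp
  | h1 b c e =>
    refine ⟨(a * b) ⊗ₜ[ℂ] (Submodule.Quotient.mk c ⊗ₜ[ℂ] Submodule.Quotient.mk e), ?_⟩
    rw [pi2_tmul, pi2_tmul, map_mul, mul_assoc]
  | h2 x y hx hy => rw [map_add, mul_add]; exact S.piOmega2.add_mem hx hy

theorem mul_mem_piOmega2 {w w' : H →L[ℂ] H} (hw : w ∈ S.Omega1) (hw' : w' ∈ S.Omega1) :
    w * w' ∈ S.piOmega2 := by
  obtain ⟨w, rfl⟩ := hw
  induction w using univForm1_induction with
  | h0 => simp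
  | h2 x y hx hy => rw [map_add, add_mul]; exact S.piOmega2.add_mem hx hy
  | h1 a b =>
    obtain ⟨w', rfl⟩ := hw'
    induction w' using univForm1_induction with
    | h0 => simp
    | h2 x y hx hy => rw [map_add, mul_add]; exact S.piOmega2.add_mem hx hy
    | h1 c e =>
      refine ⟨a ⊗ₜ[ℂ] (Submodule.Quotient.mk (b * c) ⊗ₜ[ℂ] Submodule.Quotient.mk e) -
        (a * b) ⊗ₜ[ℂ] (Submodule.Quotient.mk c ⊗ₜ[ℂ] Submodule.Quotient.mk e), ?_⟩
      rw [map_sub, pi2_tmul, pi2_tmul, pi1_tmul, pi1_tmul, comm_mul, map_mul]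
      noncomm_ring

/-- The left module structure of `Ω¹_D`. -/
instance Omega1.instModule : Module A S.Omega1 where
  smul a w := ⟨S.rep a * w, S.lmul_mem_Omega1 a w.2⟩
  one_smul w := Subtype.ext (by change S.rep 1 * (w : H →L[ℂ] H) = w; simp)
  mul_smul a b w := Subtype.ext (by
    change S.rep (a * b) * (w : H →L[ℂ] H) = S.rep a * (S.rep b * w); rw [map_mul, mul_assoc])
  smul_zero a := Subtype.ext (by change S.rep a * (0 : H →L[ℂ] H) = 0; simp)
  smul_add a w w' := Subtype.ext (by
    change S.rep a * ((w : H →L[ℂ] H) + w') = S.rep a * w + S.rep a * w'; rw [mul_add])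
  add_smul a b w := Subtype.ext (by
    change S.rep (a + b) * (w : H →L[ℂ] H) = S.rep a * w + S.rep b * w; rw [map_add, add_mul])
  zero_smul w := Subtype.ext (by change S.rep 0 * (w : H →L[ℂ] H) = 0; simp)

theorem Omega1.coe_smul (a : A) (w : S.Omega1) :
    ((a • w : S.Omega1) : H →L[ℂ] H) = S.rep a * w := rfl

/-- Left multiplication on `π(Ω²)`. -/
def lmulPi2 (a : A) : S.piOmega2 →ₗ[ℂ] S.piOmega2 :=
  (LinearMap.mulLeft ℂ (S.rep a)).restrict (fun _ hw => S.lmul_mem_piOmega2 a hw)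

theorem lmulPi2_mem (a : A) : S.piDJ ≤ S.piDJ.comap (S.lmulPi2 a) := by
  rintro _ ⟨w, hw, rfl⟩
  refine ⟨univLmul1 A a w, ?_, Subtype.ext ?_⟩
  · have : S.pi1 w = 0 := hw
    change S.pi1 _ = 0
    rw [pi1_lmul, this, mul_zero]
  · have : S.pi1 w = 0 := hw
    change S.pi2 (univD1 A (univLmul1 A a w)) = S.rep a * S.pi2 (univD1 A w)
    rw [pi2_d_lmul, this, mul_zero, zero_add]

/-- The left module structure of `Ω²_D`. -/
instance Omega2.instModule : Module A S.Omega2 where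
  smul a := S.piDJ.mapQ S.piDJ (S.lmulPi2 a) (S.lmulPi2_mem a)
  one_smul w := by
    induction w using Submodule.Quotient.induction_on with | _ w => ?_
    exact congrArg S.piDJ.mkQ (Subtype.ext (by change S.rep 1 * (w : H →L[ℂ] H) = w; simp))
  mul_smul a b w := by
    induction w using Submodule.Quotient.induction_on with | _ w => ?_
    exact congrArg S.piDJ.mkQ (Subtype.ext (by
      change S.rep (a * b) * (w : H →L[ℂ] H) = S.rep a * (S.rep b * w); rw [map_mul, mul_assoc]))
  smul_zero a := map_zero (S.piDJ.mapQ S.piDJ (S.lmulPi2 a) (S.lmulPi2_mem a))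
  smul_add a := map_add (S.piDJ.mapQ S.piDJ (S.lmulPi2 a) (S.lmulPi2_mem a))
  add_smul a b w := by
    induction w using Submodule.Quotient.induction_on with | _ w => ?_
    exact congrArg S.piDJ.mkQ (Subtype.ext (by
      change S.rep (a + b) * (w : H →L[ℂ] H) = S.rep a * w + S.rep b * w; rw [map_add, add_mul]))
  zero_smul w := by
    induction w using Submodule.Quotient.induction_on with | _ w => ?_
    exact congrArg S.piDJ.mkQ (Subtype.ext (by change S.rep 0 * (w : H →L[ℂ] H) = 0; simp))

theorem Omega2.smul_mk (a : A) (w : S.piOmega2) :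
    a • (S.piDJ.mkQ w) = S.piDJ.mkQ (S.lmulPi2 a w) := rfl

/-- Right multiplication `ω ↦ ω a` on `Ω¹_D`. -/
def rmul1 (a : A) : S.Omega1 →ₗ[ℂ] S.Omega1 :=
  (LinearMap.mulRight ℂ (S.rep a)).restrict (fun _ hw => S.rmul_mem_Omega1 a hw)

/-- The differential `d : A → Ω¹_D`. -/
def d0 : A →ₗ[ℂ] S.Omega1 := S.comm.codRestrict _ S.comm_mem_Omega1

/-- The product `Ω¹_D × Ω¹_D → Ω²_D`. -/
def mul11 : S.Omega1 →ₗ[ℂ] S.Omega1 →ₗ[ℂ] S.Omega2 :=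
  LinearMap.mk₂ ℂ (fun w w' => S.piDJ.mkQ ⟨w * w', S.mul_mem_piOmega2 w.2 w'.2⟩)
    (fun w w' v => by rw [← map_add]; exact congrArg _ (Subtype.ext (add_mul _ _ _)))
    (fun c w v => by rw [← map_smul]; exact congrArg _ (Subtype.ext (smul_mul_assoc _ _ _)))
    (fun w v v' => by rw [← map_add]; exact congrArg _ (Subtype.ext (mul_add _ _ _)))
    (fun c w v => by rw [← map_smul]; exact congrArg _ (Subtype.ext (mul_smul_comm _ _ _)))

/-- The differential `d : Ω¹_D → Ω²_D`, `π(ω) ↦ [π(dω)]`. -/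
def d1 : S.Omega1 →ₗ[ℂ] S.Omega2 :=
  ((LinearMap.ker S.pi1).liftQ
      (S.piDJ.mkQ ∘ₗ (S.pi2.rangeRestrict ∘ₗ univD1 A :
        UnivForm1 A →ₗ[ℂ] S.piOmega2)) (by
        intro w hw
        change S.piDJ.mkQ _ = 0
        rw [Submodule.mkQ_apply, Submodule.Quotient.mk_eq_zero]
        exact ⟨w, hw, rfl⟩)) ∘ₗ
    (show S.Omega1 ≃ₗ[ℂ] _ from S.pi1.quotKerEquivRange.symm).toLinearMap

theorem d1_pi1 (w : UnivForm1 A) :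
    S.d1 ⟨S.pi1 w, w, rfl⟩ = S.piDJ.mkQ ⟨S.pi2 (univD1 A w), _, rfl⟩ := by
  have : S.pi1.quotKerEquivRange.symm ⟨S.pi1 w, w, rfl⟩ = (LinearMap.ker S.pi1).mkQ w := by
    rw [LinearEquiv.symm_apply_eq]; rfl
  unfold d1
  rw [LinearMap.comp_apply]
  erw [this]
  rfl

theorem d1_smul (a : A) (w : S.Omega1) : S.d1 (a • w) = S.mul11 (S.d0 a) w + a • S.d1 w := by
  obtain ⟨_, w, rfl⟩ := w
  have : (a • (⟨S.pi1 w, w, rfl⟩ : S.Omega1)) = ⟨S.pi1 (univLmul1 A a w), _, rfl⟩ :=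
    Subtype.ext (S.pi1_lmul a w).symm
  rw [this, d1_pi1, d1_pi1, Omega2.smul_mk]
  change _ = S.piDJ.mkQ _ + S.piDJ.mkQ _
  rw [← map_add]
  exact congrArg _ (Subtype.ext (S.pi2_d_lmul a w))

theorem mul11_smul (a : A) (w v : S.Omega1) : S.mul11 (a • w) v = a • S.mul11 w v := by
  change S.piDJ.mkQ _ = S.piDJ.mkQ _
  exact congrArg _ (Subtype.ext (mul_assoc _ _ _))

theorem mul11_rmul (a : A) (w v : S.Omega1) : S.mul11 (S.rmul1 a w) v = S.mul11 w (a • v) := by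
  change S.piDJ.mkQ _ = S.piDJ.mkQ _
  exact congrArg _ (Subtype.ext (mul_assoc _ _ _))

theorem rmul1_smul (a b : A) (w : S.Omega1) : S.rmul1 b (a • w) = a • S.rmul1 b w :=
  Subtype.ext (mul_assoc _ _ _)

end SpectralTriple

/-- The right module `E = p A^q`. -/
def projModule {A : Type} [Ring A] {q : ℕ} (p : Matrix (Fin q) (Fin q) A) :
    Submodule Aᵐᵒᵖ (Fin q → A) where
  carrier := Set.range fun v => p.mulVec v
  add_mem' := by
    rintro _ _ ⟨v, rfl⟩ ⟨w, rfl⟩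
    exact ⟨v + w, Matrix.mulVec_add _ _ _⟩
  zero_mem' := ⟨0, Matrix.mulVec_zero _⟩
  smul_mem' := by
    rintro a _ ⟨v, rfl⟩
    exact ⟨a • v, Matrix.mulVec_smul _ _ _⟩

section ProjModule

variable {A : Type} [Ring A] [StarRing A] [Algebra ℂ A] {q : ℕ} (p : Matrix (Fin q) (Fin q) A)


/-- The induced Hermitian structure `⟨ξ, η⟩ = ∑ ξ_k^* η_k` on `p A^q`, linear in `η`. -/
def herm {p : Matrix (Fin q) (Fin q) A} (ξ : projModule p) : projModule p →ₗ[ℂ] A where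
  toFun η := ∑ k, star (ξ.1 k) * η.1 k
  map_add' η η' := by simp [mul_add, Finset.sum_add_distrib]
  map_smul' c η := by simp [Finset.smul_sum]

theorem herm_smul {p : Matrix (Fin q) (Fin q) A} (ξ η : projModule p) (a : A) :
    herm ξ (MulOpposite.op a • η) = herm ξ η * a := by
  simp [herm, Finset.sum_mul, mul_assoc]

/-- The generator `p e_k` of `p A^q`. -/
def projBasis (k : Fin q) : projModule p := ⟨p.mulVec (Pi.single k 1), _, rfl⟩

/-- The matrix in `p M_q(A) p` of an endomorphism of the right module `p A^q`: its `k`-th column is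
the image of `p e_k`. -/
def endMatrix {p : Matrix (Fin q) (Fin q) A} (T : Module.End Aᵐᵒᵖ (projModule p)) :
    Matrix (Fin q) (Fin q) A :=
  Matrix.of fun s k => (T (projBasis p k)).1 s

end ProjModule

namespace SpectralTriple

variable {A H : Type} [Ring A] [StarRing A] [Algebra ℂ A]
    [NormedAddCommGroup H] [InnerProductSpace ℂ H] [CompleteSpace H] (S : SpectralTriple A H)
    {q : ℕ} (p : Matrix (Fin q) (Fin q) A)

instance Omega1.instIsScalarTower : IsScalarTower ℂ A S.Omega1 where
  smul_assoc c a w := Subtype.ext (by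
    change S.rep (c • a) * (w : H →L[ℂ] H) = c • (S.rep a * (w : H →L[ℂ] H))
    rw [map_smul, smul_mul_assoc])

instance Omega1.instSMulCommClass : SMulCommClass A ℂ S.Omega1 where
  smul_comm _ _ _ := Subtype.ext (mul_smul_comm _ _ _)

instance Omega2.instIsScalarTower : IsScalarTower ℂ A S.Omega2 where
  smul_assoc c a w := by
    induction w using Submodule.Quotient.induction_on with | _ w => ?_
    exact congrArg S.piDJ.mkQ (Subtype.ext (by
      change S.rep (c • a) * (w : H →L[ℂ] H) = c • (S.rep a * (w : H →L[ℂ] H))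
      rw [map_smul, smul_mul_assoc]))

instance Omega2.instSMulCommClass : SMulCommClass A ℂ S.Omega2 where
  smul_comm a c w := by
    induction w using Submodule.Quotient.induction_on with | _ w => ?_
    exact congrArg S.piDJ.mkQ (Subtype.ext (mul_smul_comm _ _ _))

/-- The right action `(ξ ⊗ ω) a = ξ ⊗ ω a` on `E ⊗_A Ω¹_D`. -/
def tensorRmul (a : A) :
    BalTensor A (projModule p) S.Omega1 →ₗ[ℂ] BalTensor A (projModule p) S.Omega1 :=
  BalTensor.lift ((btmulₗ A (projModule p) S.Omega1).compl₂ (S.rmul1 a)) (fun x b w => by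
    simp only [LinearMap.compl₂_apply, btmulₗ_apply, rmul1_smul, btmul_balanced])

/-- The right multiplication by one-forms,
`(ξ ⊗ ω) ω' = ξ ⊗ ω ω'`, from `E ⊗_A Ω¹_D` to `E ⊗_A Ω²_D`. -/
def tensorMulForm :
    BalTensor A (projModule p) S.Omega1 →ₗ[ℂ] S.Omega1 →ₗ[ℂ]
      BalTensor A (projModule p) S.Omega2 :=
  BalTensor.lift
    (LinearMap.mk₂ ℂ (fun x w => (btmulₗ A (projModule p) S.Omega2 x) ∘ₗ S.mul11 w)
      (fun x x' w => by ext v; simp) (fun c x w => by ext v; simp)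
      (fun x w w' => by ext v; simp) (fun c x w => by ext v; simp))
    (fun x b w => by
      ext v
      simp only [LinearMap.mk₂_apply, LinearMap.comp_apply, btmulₗ_apply, mul11_smul,
        btmul_balanced])

/-- The pairing `⟨ξ, η ⊗ ω⟩ = ⟨ξ, η⟩ ω` with values in `Ω¹_D`. -/
def pairing {p : Matrix (Fin q) (Fin q) A} (ξ : projModule p) :
    BalTensor A (projModule p) S.Omega1 →ₗ[ℂ] S.Omega1 :=
  BalTensor.lift
    (LinearMap.mk₂ ℂ (fun x w => herm ξ x • w)
      (fun x x' w => by rw [map_add, add_smul]) (fun c x w => by rw [map_smul, smul_assoc])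
      (fun x w w' => smul_add _ _ _) (fun c x w => smul_comm _ _ _))
    (fun x b w => by simp only [LinearMap.mk₂_apply, herm_smul, mul_smul])

/-- The `s`-th component of the inclusion `E ⊗_A Ω²_D → (Ω²_D)^q`, `ξ ⊗ ω ↦ (ξ_s ω)_s`. -/
def coord (s : Fin q) : BalTensor A (projModule p) S.Omega2 →ₗ[ℂ] S.Omega2 :=
  BalTensor.lift
    (LinearMap.mk₂ ℂ (fun x w => x.1 s • w)
      (fun x x' w => add_smul _ _ _) (fun c x w => smul_assoc _ _ _)
      (fun x w w' => smul_add _ _ _) (fun c x w => smul_comm _ _ _))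
    (fun x b w => by
      simp only [LinearMap.mk₂_apply, ← mul_smul]
      rfl)

/-- A compatible connection `∇ : E → E ⊗_A Ω¹_D` on `E = p A^q` with the induced Hermitian
structure. In the compatibility condition, an identity of operators in `Ω¹_D`, the term
`⟨∇ ξ, η⟩`, which is `∑ ω_j^* ⟨ξ_j, η⟩` for `∇ ξ = ∑ ξ_j ⊗ ω_j`, is written as the adjoint of
`⟨η, ∇ ξ⟩ = ∑ ⟨η, ξ_j⟩ ω_j`. -/
structure CompatibleConnection where
  toFun : projModule p →ₗ[ℂ] BalTensor A (projModule p) S.Omega1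
  leibniz : ∀ (ξ : projModule p) (a : A),
    toFun (MulOpposite.op a • ξ) = S.tensorRmul p a (toFun ξ) + btmul A ξ (S.d0 a)
  compatible : ∀ ξ η : projModule p,
    (S.pairing ξ (toFun η) : H →L[ℂ] H) - star (S.pairing η (toFun ξ) : H →L[ℂ] H) =
      (S.d0 (herm ξ η) : H →L[ℂ] H)

variable {S p}

/-- The linear extension `E ⊗_A Ω¹_D → E ⊗_A Ω²_D`, `ξ ⊗ ω ↦ (∇ ξ) ω + ξ ⊗ dω`, of a
connection. -/
def CompatibleConnection.extend (c : S.CompatibleConnection p) :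
    BalTensor A (projModule p) S.Omega1 →ₗ[ℂ] BalTensor A (projModule p) S.Omega2 :=
  BalTensor.lift
    (S.tensorMulForm p ∘ₗ c.toFun + (btmulₗ A (projModule p) S.Omega2).compl₂ S.d1)
    (fun x a w => by
      have h1 : S.tensorMulForm p (S.tensorRmul p a (c.toFun x)) w =
          S.tensorMulForm p (c.toFun x) (a • w) := by
        have : (S.tensorMulForm p).flip w ∘ₗ S.tensorRmul p a =
            (S.tensorMulForm p).flip (a • w) := by
          apply BalTensor.hom_ext
          intro y v
          simp only [LinearMap.comp_apply, LinearMap.flip_apply, tensorRmul, tensorMulForm,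
            BalTensor.lift_btmul, LinearMap.compl₂_apply, btmulₗ_apply, LinearMap.mk₂_apply,
            mul11_rmul]
        exact LinearMap.congr_fun this (c.toFun x)
      have h2 : S.tensorMulForm p (btmul A x (S.d0 a)) w = btmul A x (S.mul11 (S.d0 a) w) := by
        simp only [tensorMulForm, BalTensor.lift_btmul, LinearMap.mk₂_apply, LinearMap.comp_apply,
          btmulₗ_apply]
      simp only [LinearMap.add_apply, LinearMap.comp_apply, LinearMap.compl₂_apply, c.leibniz,
        map_add, h1, h2, btmulₗ_apply, btmul_balanced, d1_smul]
      rw [add_assoc])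

/-- The curvature of a connection, a map `E → E ⊗_A Ω²_D`. -/
def CompatibleConnection.curvature (c : S.CompatibleConnection p) :
    projModule p →ₗ[ℂ] BalTensor A (projModule p) S.Omega2 :=
  c.extend ∘ₗ c.toFun

end SpectralTriple

/-! ### The Dixmier trace -/

/-- A generalized limit on bounded real sequences `(α_1, α_2, …)` that is invariant under
`(α_1, α_2, …) ↦ (α_1, α_1, α_2, α_2, …)`; the term `α_N` is stored at the index `N - 1`. -/
structure DixmierLimit where
  toFun : lp (fun _ : ℕ => ℝ) ∞ →ₗ[ℝ] ℝ
  nonneg : ∀ f : lp (fun _ : ℕ => ℝ) ∞, (∀ i, 0 ≤ f i) → 0 ≤ toFun f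
  eq_lim : ∀ (f : lp (fun _ : ℕ => ℝ) ∞) (l : ℝ), Tendsto (fun i => f i) atTop (𝓝 l) → toFun f = l
  dilation : ∀ f g : lp (fun _ : ℕ => ℝ) ∞, (∀ i, g i = f (i / 2)) → toFun g = toFun f

section Dixmier

variable {H : Type} [NormedAddCommGroup H] [InnerProductSpace ℂ H] [CompleteSpace H]

/-- The `k`-th singular value of `T`, `k = 0, 1, …`: the distance of `T` to the operators of
rank at most `k`. -/
def singularNumber (T : H →L[ℂ] H) (k : ℕ) : ℝ :=
  sInf {r : ℝ | ∃ F : H →L[ℂ] H, LinearMap.rank (F : H →ₗ[ℂ] H) ≤ k ∧ r = ‖T - F‖}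

/-- The sequence `(1 / log N) ∑_{k < N} μ_k(T)`, `N = 1, 2, …`, stored at the index `N - 1`. -/
def dixmierSeq (T : H →L[ℂ] H) (i : ℕ) : ℝ :=
  (∑ k ∈ Finset.range (i + 1), singularNumber T k) / Real.log (i + 1 : ℝ)

open Classical in
/-- The Dixmier trace of a positive operator in `L^{(1,∞)}`, that is, with bounded sequence
`dixmierSeq`. -/
def dixmierPos (ω : DixmierLimit) (T : H →L[ℂ] H) : ℝ :=
  if h : Memℓp (E := fun _ : ℕ => ℝ) (dixmierSeq T) ∞ then ω.toFun ⟨dixmierSeq T, h⟩ else 0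

/-- The Dixmier trace on `L^{(1,∞)}`, the linear extension of the trace of positive operators. -/
def dixmierTrace (ω : DixmierLimit) (T : H →L[ℂ] H) : ℂ :=
  ((dixmierPos ω ((realPart T : H →L[ℂ] H)⁺) - dixmierPos ω ((realPart T : H →L[ℂ] H)⁻) : ℝ) : ℂ) +
    Complex.I *
      ((dixmierPos ω ((imaginaryPart T : H →L[ℂ] H)⁺) -
        dixmierPos ω ((imaginaryPart T : H →L[ℂ] H)⁻) : ℝ) : ℂ)

end Dixmier

/-! ### The spectral Yang–Mills functional -/

/-- The orthogonal projection of a Hilbert space onto the orthogonal complement of a subspace. -/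
def projCompl {K : Type} [NormedAddCommGroup K] [InnerProductSpace ℂ K] [CompleteSpace K]
    (W : Submodule ℂ K) : K →ₗ[ℂ] K := (Wᗮ.starProjection : K →L[ℂ] K)

theorem projCompl_of_mem {K : Type} [NormedAddCommGroup K] [InnerProductSpace ℂ K]
    [CompleteSpace K] (W : Submodule ℂ K) {x : K} (hx : x ∈ W) : projCompl W x = 0 := by
  change Wᗮ.starProjection x = 0
  rw [Submodule.starProjection_apply_eq_zero_iff]
  exact Submodule.le_orthogonal_orthogonal _ hx

namespace SpectralTriple

variable {A H : Type} [Ring A] [StarRing A] [Algebra ℂ A]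
    [NormedAddCommGroup H] [InnerProductSpace ℂ H] [CompleteSpace H]

/-- A Hilbert space completion of `π(Ω²)` for the inner product
`⟨T₁, T₂⟩ = Tr_ω(T₁^* T₂ R)`, where `R` stands for `|D|^{-d}`. -/
structure Completion2 (S : SpectralTriple A H) (ω : DixmierLimit) (R : H →L[ℂ] H) where
  space : Type
  [normed : NormedAddCommGroup space]
  [inner : InnerProductSpace ℂ space]
  [complete : CompleteSpace space]
  emb : S.piOmega2 →ₗ[ℂ] space
  inner_emb : ∀ T₁ T₂ : S.piOmega2, ⟪emb T₁, emb T₂⟫_ℂ =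
    dixmierTrace ω (star (T₁ : H →L[ℂ] H) * (T₂ : H →L[ℂ] H) * R)
  dense : DenseRange emb

attribute [instance] Completion2.normed Completion2.inner Completion2.complete

variable {S : SpectralTriple A H} {ω : DixmierLimit} {R : H →L[ℂ] H}

/-- The map `[T] ↦ P T` on `Ω²_D`, where `P` is the orthogonal projection of the completion onto
the orthogonal complement of `π(d J₀¹)`. -/
def Completion2.proj (𝒦 : S.Completion2 ω R) : S.Omega2 →ₗ[ℂ] 𝒦.space :=
  S.piDJ.liftQ (projCompl (S.piDJ.map 𝒦.emb) ∘ₗ 𝒦.emb) (fun _ hx =>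
    projCompl_of_mem _ (Submodule.mem_map_of_mem hx))

/-- The inner product of `Ω²_D`. -/
def Completion2.innerOmega2 (𝒦 : S.Completion2 ω R) (x y : S.Omega2) : ℂ :=
  ⟪𝒦.proj x, 𝒦.proj y⟫_ℂ

/-- The inner product `⟨⟨φ, ψ⟩⟩ = ∑_k ⟨φ(p e_k), ψ(p e_k)⟩`, with `E ⊗_A Ω²_D` viewed in
`(Ω²_D)^q`. -/
def Completion2.innerHom (𝒦 : S.Completion2 ω R) {q : ℕ} {p : Matrix (Fin q) (Fin q) A}
    (φ ψ : projModule p →ₗ[ℂ] BalTensor A (projModule p) S.Omega2) : ℂ :=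
  ∑ k, ∑ s, 𝒦.innerOmega2 (S.coord p s (φ (projBasis p k))) (S.coord p s (ψ (projBasis p k)))

/-- The spectral Yang–Mills functional `⟨⟨Θ, Θ⟩⟩`. -/
def Completion2.yangMills (𝒦 : S.Completion2 ω R) {q : ℕ} {p : Matrix (Fin q) (Fin q) A}
    (c : S.CompatibleConnection p) : ℂ :=
  𝒦.innerHom c.curvature c.curvature

end SpectralTriple


set_option linter.unusedSectionVars false

/-! ### The smooth noncommutative torus -/

/-- The vector space of multisequences on `ℤⁿ` that decay faster than the inverse of any
polynomial. -/
def rapidDecay (n : ℕ) : Submodule ℂ ((Fin n → ℤ) → ℂ) where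
  carrier := {a | ∀ k : ℕ, ∃ C : ℝ, ∀ r, (1 + ‖r‖) ^ k * ‖a r‖ ≤ C}
  add_mem' := by
    intro a b ha hb k
    obtain ⟨C, hC⟩ := ha k
    obtain ⟨C', hC'⟩ := hb k
    refine ⟨C + C', fun r => ?_⟩
    calc (1 + ‖r‖) ^ k * ‖(a + b) r‖ ≤ (1 + ‖r‖) ^ k * (‖a r‖ + ‖b r‖) := by
          gcongr; exact norm_add_le _ _
      _ ≤ C + C' := by rw [mul_add]; exact add_le_add (hC r) (hC' r)
  zero_mem' := fun k => ⟨0, fun r => by simp⟩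
  smul_mem' := by
    intro c a ha k
    obtain ⟨C, hC⟩ := ha k
    refine ⟨‖c‖ * C, fun r => ?_⟩
    calc (1 + ‖r‖) ^ k * ‖(c • a) r‖ = ‖c‖ * ((1 + ‖r‖) ^ k * ‖a r‖) := by
          rw [Pi.smul_apply, norm_smul]; ring
      _ ≤ ‖c‖ * C := by gcongr; exact hC r

theorem summable_lattice_prod (n : ℕ) :
    Summable fun r : Fin n → ℤ => ∏ j, ((1 + |(r j : ℝ)|) ^ 2)⁻¹ := by
  induction n with
  | zero => exact Summable.of_finite
  | succ n ih =>
    have h1 : Summable fun m : ℤ => ((1 + |(m : ℝ)|) ^ 2)⁻¹ := by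
      have h0 : Summable fun m : ℕ => ((1 + |((m : ℤ) : ℝ)|) ^ 2)⁻¹ := by
        have := (summable_nat_add_iff 1).2 (Real.summable_nat_pow_inv.2 one_lt_two)
        refine this.congr fun m => ?_
        push_cast
        rw [abs_of_nonneg (by positivity), add_comm]
      refine Summable.of_nat_of_neg h0 ?_
      simpa using h0
    have h2 := h1.mul_of_nonneg ih (fun m => by positivity) (fun r => by positivity)
    rw [← (Fin.consEquiv fun _ => ℤ).symm.summable_iff] at h2
    refine h2.congr fun r => ?_
    simp [Fin.prod_univ_succ, Fin.consEquiv, Fin.tail, mul_comm]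

theorem rapidDecay_summable {n : ℕ} {a : (Fin n → ℤ) → ℂ} (ha : a ∈ rapidDecay n) (k : ℕ) :
    Summable fun r => (1 + ‖r‖) ^ k * ‖a r‖ := by
  obtain ⟨C, hC⟩ := ha (k + 2 * n)
  refine Summable.of_nonneg_of_le (fun r => by positivity) (fun r => ?_)
    ((summable_lattice_prod n).mul_left C)
  have h1 : ∏ j, (1 + |(r j : ℝ)|) ^ 2 ≤ (1 + ‖r‖) ^ (2 * n) := by
    calc ∏ j, (1 + |(r j : ℝ)|) ^ 2 ≤ ∏ _j : Fin n, (1 + ‖r‖) ^ 2 := by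
          apply Finset.prod_le_prod (fun j _ => by positivity)
          intro j _
          gcongr
          have := norm_le_pi_norm r j
          rwa [Int.norm_eq_abs] at this
      _ = _ := by rw [Finset.prod_const, Finset.card_univ, Fintype.card_fin, ← pow_mul]
  have hp : 0 < ∏ j, (1 + |(r j : ℝ)|) ^ 2 := Finset.prod_pos fun j _ => by positivity
  rw [Finset.prod_inv_distrib, ← div_eq_mul_inv, le_div_iff₀ hp]
  calc (1 + ‖r‖) ^ k * ‖a r‖ * ∏ j, (1 + |(r j : ℝ)|) ^ 2
      ≤ (1 + ‖r‖) ^ k * ‖a r‖ * (1 + ‖r‖) ^ (2 * n) := by gcongr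
    _ = (1 + ‖r‖) ^ (k + 2 * n) * ‖a r‖ := by ring
    _ ≤ C := hC r

theorem rapidDecay_summable_norm {n : ℕ} {a : (Fin n → ℤ) → ℂ} (ha : a ∈ rapidDecay n) :
    Summable fun r => ‖a r‖ := by
  simpa using rapidDecay_summable ha 0

section Cocycle

variable {n : ℕ} (Θ : Matrix (Fin n) (Fin n) ℝ)

/-- The phase in `U^r U^s = torusCocycle Θ r s • U^{r+s}`, for unitaries with
`U_k U_m = e^{2πi Θ_{km}} U_m U_k` and `U^r = U_1^{r_1} ⋯ U_n^{r_n}`. -/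
def torusCocycle (r s : Fin n → ℤ) : ℂ :=
  Complex.exp ((2 * Real.pi * ∑ k, ∑ m, if m < k then Θ k m * r k * s m else 0 : ℝ) * Complex.I)

theorem torusCocycle_add_left (r r' s : Fin n → ℤ) :
    torusCocycle Θ (r + r') s = torusCocycle Θ r s * torusCocycle Θ r' s := by
  rw [torusCocycle, torusCocycle, torusCocycle, ← Complex.exp_add, ← add_mul, ← Complex.ofReal_add,
    ← mul_add, ← Finset.sum_add_distrib]
  simp_rw [← Finset.sum_add_distrib]
  congr 5
  ext k
  congr 1
  ext m
  split_ifs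
  · simp only [Pi.add_apply]; push_cast; ring
  · simp

theorem torusCocycle_add_right (r s s' : Fin n → ℤ) :
    torusCocycle Θ r (s + s') = torusCocycle Θ r s * torusCocycle Θ r s' := by
  rw [torusCocycle, torusCocycle, torusCocycle, ← Complex.exp_add, ← add_mul, ← Complex.ofReal_add,
    ← mul_add, ← Finset.sum_add_distrib]
  simp_rw [← Finset.sum_add_distrib]
  congr 5
  ext k
  congr 1
  ext m
  split_ifs
  · simp only [Pi.add_apply]; push_cast; ring
  · simp

theorem norm_torusCocycle (r s : Fin n → ℤ) : ‖torusCocycle Θ r s‖ = 1 :=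
  Complex.norm_exp_ofReal_mul_I _

theorem torusCocycle_ne_zero (r s : Fin n → ℤ) : torusCocycle Θ r s ≠ 0 := Complex.exp_ne_zero _

theorem torusCocycle_zero_left (s : Fin n → ℤ) : torusCocycle Θ 0 s = 1 := by simp [torusCocycle]

theorem torusCocycle_zero_right (s : Fin n → ℤ) : torusCocycle Θ s 0 = 1 := by simp [torusCocycle]

theorem torusCocycle_neg_mul_left (r s : Fin n → ℤ) :
    torusCocycle Θ (-r) s * torusCocycle Θ r s = 1 := by
  rw [← torusCocycle_add_left, neg_add_cancel, torusCocycle_zero_left]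

theorem torusCocycle_neg_mul_right (r s : Fin n → ℤ) :
    torusCocycle Θ r (-s) * torusCocycle Θ r s = 1 := by
  rw [← torusCocycle_add_right, neg_add_cancel, torusCocycle_zero_right]

theorem star_torusCocycle (r s : Fin n → ℤ) :
    star (torusCocycle Θ r s) = torusCocycle Θ (-r) s := by
  apply mul_right_cancel₀ (torusCocycle_ne_zero Θ r s)
  rw [torusCocycle_neg_mul_left, Complex.star_def, mul_comm, Complex.mul_conj,
    Complex.normSq_eq_norm_sq, norm_torusCocycle]
  simp

end Cocycle

/-- The Hilbert space `ℓ²(ℤⁿ) ⊗ V`, as the space of square summable `V`-valued families. -/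
def TorusL2 (n : ℕ) (V : Type) [NormedAddCommGroup V] : Type :=
  lp (fun _ : Fin n → ℤ => V) 2

section Operators

variable {n : ℕ} {V : Type} [NormedAddCommGroup V] [InnerProductSpace ℂ V]

instance TorusL2.instNormedAddCommGroup : NormedAddCommGroup (TorusL2 n V) :=
  inferInstanceAs (NormedAddCommGroup (lp (fun _ : Fin n → ℤ => V) 2))

instance TorusL2.instInnerProductSpace : InnerProductSpace ℂ (TorusL2 n V) :=
  inferInstanceAs (InnerProductSpace ℂ (lp (fun _ : Fin n → ℤ => V) 2))

instance TorusL2.instCompleteSpace [CompleteSpace V] : CompleteSpace (TorusL2 n V) :=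
  inferInstanceAs (CompleteSpace (lp (fun _ : Fin n → ℤ => V) 2))

instance TorusL2.instCoeFun : CoeFun (TorusL2 n V) fun _ => (Fin n → ℤ) → V := ⟨fun x => x.1⟩

theorem TorusL2.ext {x y : TorusL2 n V} (h : ∀ r, x r = y r) : x = y :=
  lp.ext (funext h)

theorem TorusL2.add_apply (x y : TorusL2 n V) (r : Fin n → ℤ) : (x + y) r = x r + y r := rfl

theorem TorusL2.sub_apply (x y : TorusL2 n V) (r : Fin n → ℤ) : (x - y) r = x r - y r := rfl

theorem TorusL2.smul_apply (c : ℂ) (x : TorusL2 n V) (r : Fin n → ℤ) : (c • x) r = c • x r := rfl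

theorem TorusL2.summable_sq (x : TorusL2 n V) : Summable fun r => ‖x r‖ ^ 2 := by
  have := (memℓp_gen_iff (p := 2) (by norm_num)).1 x.2
  simpa using this

/-- The element of `ℓ²(ℤⁿ) ⊗ V` with given components. -/
def TorusL2.mk (f : (Fin n → ℤ) → V) (hf : Summable fun r => ‖f r‖ ^ 2) : TorusL2 n V :=
  ⟨f, (memℓp_gen_iff (p := 2) (by norm_num)).2 (by simpa using hf)⟩

theorem TorusL2.mk_apply (f : (Fin n → ℤ) → V) (hf : Summable fun r => ‖f r‖ ^ 2)
    (r : Fin n → ℤ) : TorusL2.mk f hf r = f r := rfl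

theorem TorusL2.norm_sq (x : TorusL2 n V) : ‖x‖ ^ 2 = ∑' r, ‖x r‖ ^ 2 := by
  have := lp.norm_rpow_eq_tsum (p := 2) (by norm_num) x
  simp only [ENNReal.toReal_ofNat, Real.rpow_ofNat] at this
  exact this

theorem TorusL2.inner_eq (x y : TorusL2 n V) : ⟪x, y⟫_ℂ = ∑' r, ⟪x r, y r⟫_ℂ :=
  lp.inner_eq_tsum (𝕜 := ℂ) x y

/-- The component at `r`, as a continuous linear map. -/
def TorusL2.eval (r : Fin n → ℤ) : TorusL2 n V →L[ℂ] V :=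
  LinearMap.mkContinuous
    { toFun := fun x => x r
      map_add' := fun _ _ => rfl
      map_smul' := fun _ _ => rfl } 1
    (fun x => by rw [one_mul]; exact lp.norm_apply_le_norm (by norm_num) x r)

/-- The vector `e_r ⊗ v`. -/
def TorusL2.single (r : Fin n → ℤ) : V →L[ℂ] TorusL2 n V :=
  have key : ∀ (v : V) s, ‖(if s = r then v else 0)‖ ^ 2 = if s = r then ‖v‖ ^ 2 else 0 :=
    fun v s => by split_ifs <;> simp
  LinearMap.mkContinuous
    { toFun := fun v => TorusL2.mk (fun s => if s = r then v else 0) (by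
        simp_rw [key]
        exact (hasSum_ite_eq r (‖v‖ ^ 2)).summable)
      map_add' := fun v w => TorusL2.ext fun s => by
        simp only [TorusL2.add_apply, TorusL2.mk_apply]
        split_ifs <;> simp
      map_smul' := fun c v => TorusL2.ext fun s => by
        simp only [TorusL2.smul_apply, TorusL2.mk_apply, RingHom.id_apply]
        split_ifs <;> simp } 1
    (fun v => by
      refine le_of_sq_le_sq ?_ (by positivity)
      rw [one_mul, TorusL2.norm_sq]
      change ∑' s, ‖(if s = r then v else 0)‖ ^ 2 ≤ _
      simp_rw [key]
      rw [tsum_ite_eq])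

theorem TorusL2.single_apply (r s : Fin n → ℤ) (v : V) :
    TorusL2.single r v s = if s = r then v else 0 := rfl

theorem TorusL2.inner_single_left (r : Fin n → ℤ) (v : V) (x : TorusL2 n V) :
    ⟪TorusL2.single r v, x⟫_ℂ = ⟪v, x r⟫_ℂ := by
  rw [TorusL2.inner_eq, tsum_eq_single r]
  · rw [TorusL2.single_apply, if_pos rfl]
  · intro s hs
    rw [TorusL2.single_apply, if_neg hs, inner_zero_left]

theorem TorusL2.inner_single_right (r : Fin n → ℤ) (v : V) (x : TorusL2 n V) :
    ⟪x, TorusL2.single r v⟫_ℂ = ⟪x r, v⟫_ℂ := by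
  rw [TorusL2.inner_eq, tsum_eq_single r]
  · rw [TorusL2.single_apply, if_pos rfl]
  · intro s hs
    rw [TorusL2.single_apply, if_neg hs, inner_zero_right]

/-- The block diagonal operator with uniformly bounded blocks. -/
def TorusL2.diag (B : (Fin n → ℤ) → V →L[ℂ] V) (C : ℝ) (hB : ∀ r, ‖B r‖ ≤ C) :
    TorusL2 n V →L[ℂ] TorusL2 n V :=
  have key : ∀ (x : TorusL2 n V) r, ‖B r (x r)‖ ^ 2 ≤ C ^ 2 * ‖x r‖ ^ 2 := fun x r => by
    rw [← mul_pow]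
    gcongr
    exact (B r).le_of_opNorm_le (hB r) _
  LinearMap.mkContinuous
    { toFun := fun x => TorusL2.mk (fun r => B r (x r))
        (Summable.of_nonneg_of_le (fun r => by positivity) (key x)
          ((TorusL2.summable_sq x).mul_left _))
      map_add' := fun x y => TorusL2.ext fun r => map_add (B r) (x r) (y r)
      map_smul' := fun c x => TorusL2.ext fun r => map_smul (B r) c (x r) } C
    (fun x => by
      have hC : 0 ≤ C := (norm_nonneg _).trans (hB 0)
      refine le_of_sq_le_sq ?_ (by positivity)
      rw [mul_pow, TorusL2.norm_sq, TorusL2.norm_sq, ← tsum_mul_left]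
      exact Summable.tsum_le_tsum (key x) (Summable.of_nonneg_of_le (fun r => by positivity)
        (key x) ((TorusL2.summable_sq x).mul_left _)) ((TorusL2.summable_sq x).mul_left _))

theorem TorusL2.diag_apply (B : (Fin n → ℤ) → V →L[ℂ] V) (C : ℝ) (hB : ∀ r, ‖B r‖ ≤ C)
    (x : TorusL2 n V) (r : Fin n → ℤ) : TorusL2.diag B C hB x r = B r (x r) := rfl

variable (Θ : Matrix (Fin n) (Fin n) ℝ)

/-- The unitary `U^s` on `ℓ²(ℤⁿ) ⊗ V`: it maps `e_r ⊗ v`, where `e_r` is the vector of `U^r`, to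
`torusCocycle Θ s r • e_{r+s} ⊗ v`. -/
def TorusL2.shift (s : Fin n → ℤ) : TorusL2 n V →L[ℂ] TorusL2 n V :=
  have key : ∀ (x : TorusL2 n V) r,
      ‖torusCocycle Θ s (r - s) • x (r - s)‖ ^ 2 = ‖x (r - s)‖ ^ 2 := fun x r => by
    rw [norm_smul, norm_torusCocycle, one_mul]
  LinearMap.mkContinuous
    { toFun := fun x => TorusL2.mk (fun r => torusCocycle Θ s (r - s) • x (r - s)) (by
        simp_rw [key]
        exact (Equiv.subRight s).summable_iff.2 (TorusL2.summable_sq x))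
      map_add' := fun x y => TorusL2.ext fun r => smul_add _ (x (r - s)) (y (r - s))
      map_smul' := fun c x => TorusL2.ext fun r => smul_comm _ c (x (r - s)) } 1
    (fun x => by
      refine le_of_sq_le_sq ?_ (by positivity)
      rw [one_mul, TorusL2.norm_sq, TorusL2.norm_sq]
      refine le_of_eq ?_
      change ∑' r, ‖torusCocycle Θ s (r - s) • x (r - s)‖ ^ 2 = _
      simp_rw [key]
      exact (Equiv.subRight s).tsum_eq (fun r => ‖x r‖ ^ 2))

theorem TorusL2.shift_apply (s : Fin n → ℤ) (x : TorusL2 n V) (r : Fin n → ℤ) :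
    TorusL2.shift Θ s x r = torusCocycle Θ s (r - s) • x (r - s) := rfl

theorem TorusL2.norm_shift_le (s : Fin n → ℤ) :
    ‖(TorusL2.shift Θ s : TorusL2 n V →L[ℂ] TorusL2 n V)‖ ≤ 1 := by
  refine ContinuousLinearMap.opNorm_le_bound _ zero_le_one fun x => ?_
  refine le_of_sq_le_sq ?_ (by positivity)
  rw [one_mul, TorusL2.norm_sq, TorusL2.norm_sq]
  refine le_of_eq ?_
  simp_rw [TorusL2.shift_apply, norm_smul, norm_torusCocycle, one_mul]
  exact (Equiv.subRight s).tsum_eq (fun r => ‖x r‖ ^ 2)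

theorem TorusL2.shift_mul (s t : Fin n → ℤ) :
    (TorusL2.shift Θ s * TorusL2.shift Θ t : TorusL2 n V →L[ℂ] TorusL2 n V) =
      torusCocycle Θ s t • TorusL2.shift Θ (s + t) := by
  ext x
  refine TorusL2.ext fun r => ?_
  change torusCocycle Θ s (r - s) • torusCocycle Θ t (r - s - t) • x (r - s - t) =
    torusCocycle Θ s t • torusCocycle Θ (s + t) (r - (s + t)) • x (r - (s + t))
  rw [sub_sub, smul_smul, smul_smul]
  congr 1
  rw [torusCocycle_add_left, ← mul_assoc, ← torusCocycle_add_right]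
  congr 2
  abel

theorem TorusL2.shift_zero :
    (TorusL2.shift Θ 0 : TorusL2 n V →L[ℂ] TorusL2 n V) = 1 := by
  ext x
  refine TorusL2.ext fun r => ?_
  change torusCocycle Θ 0 (r - 0) • x (r - 0) = x r
  rw [sub_zero, torusCocycle_zero_left, one_smul]

section Complete

variable [CompleteSpace V]

theorem TorusL2.star_shift (s : Fin n → ℤ) :
    star (TorusL2.shift Θ s : TorusL2 n V →L[ℂ] TorusL2 n V) =
      torusCocycle Θ s s • TorusL2.shift Θ (-s) := by
  symm
  rw [ContinuousLinearMap.star_eq_adjoint, ContinuousLinearMap.eq_adjoint_iff]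
  intro x y
  rw [TorusL2.inner_eq, TorusL2.inner_eq, ← (Equiv.subRight s).tsum_eq
    (fun r => ⟪((torusCocycle Θ s s • TorusL2.shift Θ (-s)) x : TorusL2 n V) r, y r⟫_ℂ)]
  congr 1
  ext r
  change ⟪torusCocycle Θ s s • torusCocycle Θ (-s) (r - s - -s) • x (r - s - -s), y (r - s)⟫_ℂ =
    ⟪x r, torusCocycle Θ s (r - s) • y (r - s)⟫_ℂ
  rw [sub_neg_eq_add, sub_add_cancel, smul_smul, inner_smul_left, inner_smul_right]
  congr 1
  rw [map_mul, ← Complex.star_def, star_torusCocycle, star_torusCocycle,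
    neg_neg, sub_eq_add_neg, torusCocycle_add_right, mul_comm]
  congr 1
  apply mul_right_cancel₀ (torusCocycle_ne_zero Θ s s)
  rw [torusCocycle_neg_mul_left, torusCocycle_neg_mul_right]

/-- The operator `∑ a_s U^s`. -/
def TorusL2.series (V : Type) [NormedAddCommGroup V] [InnerProductSpace ℂ V]
    (a : (Fin n → ℤ) → ℂ) : TorusL2 n V →L[ℂ] TorusL2 n V :=
  ∑' s, a s • TorusL2.shift Θ s

variable {Θ}

theorem TorusL2.norm_smul_shift_le (a : (Fin n → ℤ) → ℂ) (s : Fin n → ℤ) :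
    ‖a s • (TorusL2.shift Θ s : TorusL2 n V →L[ℂ] TorusL2 n V)‖ ≤ ‖a s‖ := by
  rw [norm_smul]
  exact mul_le_of_le_one_right (norm_nonneg _) (TorusL2.norm_shift_le Θ s)

theorem TorusL2.summable_norm_series {a : (Fin n → ℤ) → ℂ} (ha : a ∈ rapidDecay n) :
    Summable fun s => ‖a s • (TorusL2.shift Θ s : TorusL2 n V →L[ℂ] TorusL2 n V)‖ :=
  Summable.of_nonneg_of_le (fun _ => norm_nonneg _) (TorusL2.norm_smul_shift_le a)
    (rapidDecay_summable_norm ha)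

theorem TorusL2.hasSum_series {a : (Fin n → ℤ) → ℂ} (ha : a ∈ rapidDecay n) :
    HasSum (fun s => a s • (TorusL2.shift Θ s : TorusL2 n V →L[ℂ] TorusL2 n V))
      (TorusL2.series Θ V a) :=
  (TorusL2.summable_norm_series ha).of_norm.hasSum

theorem TorusL2.hasSum_series_apply {a : (Fin n → ℤ) → ℂ} (ha : a ∈ rapidDecay n)
    (x : TorusL2 n V) (r : Fin n → ℤ) :
    HasSum (fun s => a s • torusCocycle Θ s (r - s) • x (r - s)) (TorusL2.series Θ V a x r) := by
  have h := (TorusL2.hasSum_series (Θ := Θ) (V := V) ha).mapL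
    ((TorusL2.eval r).comp
      (ContinuousLinearMap.apply ℂ (TorusL2 n V) x))
  exact h

end Complete

end Operators

section SmoothTorus

/-- The smooth noncommutative torus: the formal series `∑ a_r U^r` with rapidly decreasing
coefficients, where `U^r = U_1^{r_1} ⋯ U_n^{r_n}` and `U_k U_m = e^{2πi Θ_{km}} U_m U_k`. -/
def SmoothTorus {n : ℕ} (_Θ : Matrix (Fin n) (Fin n) ℝ) : Type := rapidDecay n

variable {n : ℕ} {Θ : Matrix (Fin n) (Fin n) ℝ}

namespace SmoothTorus

instance instAddCommGroup : AddCommGroup (SmoothTorus Θ) :=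
  inferInstanceAs (AddCommGroup (rapidDecay n))

instance instModule : Module ℂ (SmoothTorus Θ) := inferInstanceAs (Module ℂ (rapidDecay n))

/-- The coefficient `a_r` of `∑ a_r U^r`. -/
def coeff (a : SmoothTorus Θ) (r : Fin n → ℤ) : ℂ := a.1 r

theorem coeff_mem (a : SmoothTorus Θ) : a.coeff ∈ rapidDecay n := a.2

theorem ext {a b : SmoothTorus Θ} (h : ∀ r, a.coeff r = b.coeff r) : a = b :=
  Subtype.ext (funext h)

theorem coeff_add (a b : SmoothTorus Θ) (r : Fin n → ℤ) :
    (a + b).coeff r = a.coeff r + b.coeff r := rfl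

theorem coeff_smul (c : ℂ) (a : SmoothTorus Θ) (r : Fin n → ℤ) :
    (c • a).coeff r = c * a.coeff r := rfl

theorem coeff_zero (r : Fin n → ℤ) : (0 : SmoothTorus Θ).coeff r = 0 := rfl

/-- The element with given rapidly decreasing coefficients. -/
def ofCoeff (f : (Fin n → ℤ) → ℂ) (hf : f ∈ rapidDecay n) : SmoothTorus Θ := ⟨f, hf⟩

theorem coeff_ofCoeff (f : (Fin n → ℤ) → ℂ) (hf : f ∈ rapidDecay n) (r : Fin n → ℤ) :
    (ofCoeff f hf : SmoothTorus Θ).coeff r = f r := rfl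

theorem summable_norm_conv (a b : SmoothTorus Θ) (r : Fin n → ℤ) :
    Summable fun s => ‖a.coeff s * b.coeff (r - s) * torusCocycle Θ s (r - s)‖ := by
  obtain ⟨C, hC⟩ := b.coeff_mem 0
  refine Summable.of_nonneg_of_le (fun s => norm_nonneg _) (fun s => ?_)
    ((rapidDecay_summable_norm a.coeff_mem).mul_right C)
  rw [norm_mul, norm_torusCocycle, mul_one, norm_mul]
  gcongr
  simpa using hC (r - s)

/-- The twisted convolution. -/
instance instMul : Mul (SmoothTorus Θ) where
  mul a b := ofCoeff
    (fun r => ∑' s, a.coeff s * b.coeff (r - s) * torusCocycle Θ s (r - s)) (by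
      intro k
      obtain ⟨C, hC⟩ := b.coeff_mem k
      refine ⟨(∑' s, (1 + ‖s‖) ^ k * ‖a.coeff s‖) * C, fun r => ?_⟩
      have hs := rapidDecay_summable a.coeff_mem k
      calc (1 + ‖r‖) ^ k * ‖∑' s, a.coeff s * b.coeff (r - s) * torusCocycle Θ s (r - s)‖
          ≤ (1 + ‖r‖) ^ k * ∑' s, ‖a.coeff s * b.coeff (r - s) * torusCocycle Θ s (r - s)‖ := by
            gcongr
            exact norm_tsum_le_tsum_norm (summable_norm_conv a b r)
        _ = ∑' s, (1 + ‖r‖) ^ k * ‖a.coeff s * b.coeff (r - s) * torusCocycle Θ s (r - s)‖ := by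
            rw [tsum_mul_left]
        _ ≤ ∑' s, (1 + ‖s‖) ^ k * ‖a.coeff s‖ * C := by
            refine Summable.tsum_le_tsum (fun s => ?_) ((summable_norm_conv a b r).mul_left _)
              (hs.mul_right C)
            rw [norm_mul, norm_torusCocycle, mul_one, norm_mul]
            have h1 : (1 + ‖r‖) ^ k ≤ (1 + ‖s‖) ^ k * (1 + ‖r - s‖) ^ k := by
              rw [← mul_pow]
              gcongr
              have : ‖r‖ ≤ ‖s‖ + ‖r - s‖ := by simpa using norm_add_le s (r - s)
              nlinarith [norm_nonneg s, norm_nonneg (r - s)]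
            calc (1 + ‖r‖) ^ k * (‖a.coeff s‖ * ‖b.coeff (r - s)‖)
                ≤ (1 + ‖s‖) ^ k * (1 + ‖r - s‖) ^ k * (‖a.coeff s‖ * ‖b.coeff (r - s)‖) := by
                  gcongr
              _ = (1 + ‖s‖) ^ k * ‖a.coeff s‖ * ((1 + ‖r - s‖) ^ k * ‖b.coeff (r - s)‖) := by ring
              _ ≤ _ := by gcongr; exact hC (r - s)
        _ = _ := by rw [tsum_mul_right])

theorem coeff_mul (a b : SmoothTorus Θ) (r : Fin n → ℤ) :
    (a * b).coeff r = ∑' s, a.coeff s * b.coeff (r - s) * torusCocycle Θ s (r - s) := rfl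

/-- The monomial `U^r`. -/
def monomial (Θ : Matrix (Fin n) (Fin n) ℝ) (r : Fin n → ℤ) : SmoothTorus Θ :=
  ofCoeff (fun s => if s = r then 1 else 0) (by
    intro k
    refine ⟨(1 + ‖r‖) ^ k, fun s => ?_⟩
    change (1 + ‖s‖) ^ k * ‖(if s = r then 1 else 0 : ℂ)‖ ≤ _
    split_ifs with h
    · rw [h]; simp
    · simp only [norm_zero, mul_zero]; positivity)

theorem coeff_monomial (r s : Fin n → ℤ) :
    (monomial Θ r).coeff s = if s = r then 1 else 0 := rfl

instance instOne : One (SmoothTorus Θ) := ⟨monomial Θ 0⟩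

/-- The involution, determined by `(U^r)^* = (U^r)⁻¹`. -/
instance instStar : Star (SmoothTorus Θ) where
  star a := ofCoeff (fun r => star (a.coeff (-r)) * torusCocycle Θ r r) (by
    intro k
    obtain ⟨C, hC⟩ := a.coeff_mem k
    refine ⟨C, fun r => ?_⟩
    have := hC (-r)
    rwa [norm_mul, norm_torusCocycle, mul_one, norm_star, ← norm_neg r])

theorem coeff_star (a : SmoothTorus Θ) (r : Fin n → ℤ) :
    (star a).coeff r = star (a.coeff (-r)) * torusCocycle Θ r r := rfl

section Rep

variable {V : Type} [NormedAddCommGroup V] [InnerProductSpace ℂ V] [CompleteSpace V]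

/-- The left regular representation, `a ↦ a ⊗ 1` on `ℓ²(ℤⁿ) ⊗ V`. -/
def op (V : Type) [NormedAddCommGroup V] [InnerProductSpace ℂ V] (a : SmoothTorus Θ) :
    TorusL2 n V →L[ℂ] TorusL2 n V := TorusL2.series Θ V a.coeff

theorem hasSum_op (a : SmoothTorus Θ) :
    HasSum (fun s => a.coeff s • (TorusL2.shift Θ s : TorusL2 n V →L[ℂ] TorusL2 n V))
      (a.op V) := TorusL2.hasSum_series a.coeff_mem

theorem hasSum_op_apply (a : SmoothTorus Θ) (x : TorusL2 n V) (r : Fin n → ℤ) :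
    HasSum (fun s => a.coeff s • torusCocycle Θ s (r - s) • x (r - s)) (a.op V x r) :=
  TorusL2.hasSum_series_apply a.coeff_mem x r

theorem op_add (a b : SmoothTorus Θ) : (a + b).op V = a.op V + b.op V := by
  refine (hasSum_op (a + b)).unique ?_
  simpa only [coeff_add, add_smul] using (hasSum_op a).add (hasSum_op b)

theorem op_smul (c : ℂ) (a : SmoothTorus Θ) : (c • a).op V = c • a.op V := by
  refine (hasSum_op (c • a)).unique ?_
  simpa only [coeff_smul, mul_smul] using (hasSum_op a).const_smul c

theorem op_one : (1 : SmoothTorus Θ).op V = 1 := by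
  refine (hasSum_op 1).unique ?_
  rw [← TorusL2.shift_zero Θ]
  have h := hasSum_ite_eq (0 : Fin n → ℤ)
    (TorusL2.shift Θ (0 : Fin n → ℤ) : TorusL2 n V →L[ℂ] TorusL2 n V)
  convert h using 1
  ext1 s
  change (if s = 0 then (1 : ℂ) else 0) • TorusL2.shift Θ s = _
  split_ifs with hs
  · rw [hs, one_smul]
  · rw [zero_smul]

theorem op_mul (a b : SmoothTorus Θ) : (a * b).op V = a.op V * b.op V := by
  have ha := TorusL2.summable_norm_series (Θ := Θ) (V := V) a.coeff_mem
  have hb := TorusL2.summable_norm_series (Θ := Θ) (V := V) b.coeff_mem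
  have h := (summable_mul_of_summable_norm ha hb).hasSum
  rw [← tsum_mul_tsum_of_summable_norm ha hb] at h
  let e : (Fin n → ℤ) × (Fin n → ℤ) ≃ (Fin n → ℤ) × (Fin n → ℤ) :=
    { toFun := fun z => (z.2, z.1 - z.2)
      invFun := fun z => (z.1 + z.2, z.1)
      left_inv := fun z => by simp
      right_inv := fun z => by simp }
  rw [← e.hasSum_iff] at h
  refine (hasSum_op (a * b)).unique (h.prod_fiberwise fun r => ?_)
  have h2 := ((summable_norm_conv a b r).of_norm.hasSum).smul_const
    (TorusL2.shift Θ r : TorusL2 n V →L[ℂ] TorusL2 n V)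
  have key : (fun s => (a.coeff s • (TorusL2.shift Θ s : TorusL2 n V →L[ℂ] TorusL2 n V)) *
      (b.coeff (r - s) • TorusL2.shift Θ (r - s))) =
      fun s => (a.coeff s * b.coeff (r - s) * torusCocycle Θ s (r - s)) • TorusL2.shift Θ r := by
    funext s
    rw [smul_mul_smul_comm, TorusL2.shift_mul, smul_smul, add_sub_cancel]
  rw [← key] at h2
  exact h2

theorem op_star (a : SmoothTorus Θ) : (star a).op V = star (a.op V) := by
  have h := (hasSum_op (V := V) a).star
  rw [← (Equiv.neg (Fin n → ℤ)).hasSum_iff] at h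
  refine (hasSum_op (star a)).unique ?_
  convert h using 1
  ext1 s
  change (star (a.coeff (-s)) * torusCocycle Θ s s) • TorusL2.shift Θ s =
    star (a.coeff (-s) • TorusL2.shift Θ (-s))
  rw [star_smul, TorusL2.star_shift, neg_neg, smul_smul]
  congr 2
  rw [← star_torusCocycle]
  apply mul_right_cancel₀ (torusCocycle_ne_zero Θ s (-s))
  rw [mul_comm, torusCocycle_neg_mul_right, star_torusCocycle, torusCocycle_neg_mul_left]

theorem op_single_zero (a : SmoothTorus Θ) (v : V) (r : Fin n → ℤ) :
    a.op V (TorusL2.single 0 v) r = a.coeff r • v := by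
  refine (hasSum_op_apply a _ r).unique ?_
  convert hasSum_ite_eq r (a.coeff r • v) using 1
  ext1 s
  rw [TorusL2.single_apply]
  by_cases h : s = r
  · rw [if_pos h, h, sub_self, if_pos rfl, torusCocycle_zero_right, one_smul]
  · rw [if_neg h, if_neg (sub_ne_zero.2 (Ne.symm h)), smul_zero, smul_zero]

theorem op_injective [Nontrivial V] :
    Function.Injective (op V : SmoothTorus Θ → TorusL2 n V →L[ℂ] TorusL2 n V) := by
  intro a b h
  obtain ⟨v, hv⟩ := exists_ne (0 : V)
  refine ext fun r => ?_
  have h1 := op_single_zero a v r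
  rw [h, op_single_zero] at h1
  exact (smul_left_injective ℂ hv h1).symm

end Rep

theorem op_injective' :
    Function.Injective (op ℂ : SmoothTorus Θ → TorusL2 n ℂ →L[ℂ] TorusL2 n ℂ) := op_injective

theorem op_zero' : (0 : SmoothTorus Θ).op ℂ = 0 := by
  have := op_smul (V := ℂ) 0 (0 : SmoothTorus Θ)
  rwa [zero_smul, zero_smul] at this

instance instRing : Ring (SmoothTorus Θ) where
  __ := instAddCommGroup
  mul := (· * ·)
  one := 1
  left_distrib a b c := op_injective' (by simp only [op_mul, op_add, mul_add])
  right_distrib a b c := op_injective' (by simp only [op_mul, op_add, add_mul])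
  zero_mul a := op_injective' (by simp only [op_mul, op_zero', zero_mul])
  mul_zero a := op_injective' (by simp only [op_mul, op_zero', mul_zero])
  mul_assoc a b c := op_injective' (by simp only [op_mul, mul_assoc])
  one_mul a := op_injective' (by simp only [op_mul, op_one, one_mul])
  mul_one a := op_injective' (by simp only [op_mul, op_one, mul_one])

instance instAlgebra : Algebra ℂ (SmoothTorus Θ) :=
  Algebra.ofModule
    (fun c a b => op_injective' (by simp only [op_mul, op_smul, smul_mul_assoc]))
    (fun c a b => op_injective' (by simp only [op_mul, op_smul, mul_smul_comm]))

instance instStarRing : StarRing (SmoothTorus Θ) where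
  star_involutive a := op_injective' (by simp only [op_star, star_star])
  star_mul a b := op_injective' (by simp only [op_mul, op_star, star_mul])
  star_add a b := op_injective' (by simp only [op_add, op_star, star_add])

/-- The representation `a ↦ a ⊗ 1` on `ℓ²(ℤⁿ) ⊗ V`, the GNS space of the trace being `ℓ²(ℤⁿ)`. -/
def rep (V : Type) [NormedAddCommGroup V] [InnerProductSpace ℂ V] [CompleteSpace V] :
    SmoothTorus Θ →⋆ₐ[ℂ] (TorusL2 n V →L[ℂ] TorusL2 n V) where
  toFun := op V
  map_one' := op_one
  map_mul' := op_mul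
  map_zero' := by
    have := op_smul (V := V) 0 (0 : SmoothTorus Θ)
    rwa [zero_smul, zero_smul] at this
  map_add' := op_add
  commutes' c := by
    rw [Algebra.algebraMap_eq_smul_one, Algebra.algebraMap_eq_smul_one, op_smul, op_one]
  map_star' := op_star

/-- The generator `U_k`. -/
def gen (Θ : Matrix (Fin n) (Fin n) ℝ) (k : Fin n) : SmoothTorus Θ := monomial Θ (Pi.single k 1)

theorem op_monomial (r : Fin n → ℤ) : (monomial Θ r).op ℂ = TorusL2.shift Θ r := by
  refine (hasSum_op _).unique ?_
  convert hasSum_ite_eq r (TorusL2.shift Θ r : TorusL2 n ℂ →L[ℂ] TorusL2 n ℂ) using 1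
  ext1 s
  rw [coeff_monomial]
  split_ifs with hs
  · rw [hs, one_smul]
  · rw [zero_smul]

theorem monomial_mul (r s : Fin n → ℤ) :
    monomial Θ r * monomial Θ s = torusCocycle Θ r s • monomial Θ (r + s) :=
  op_injective' (by rw [op_mul, op_smul, op_monomial, op_monomial, op_monomial, TorusL2.shift_mul])

theorem star_monomial_mul (r : Fin n → ℤ) : star (monomial Θ r) * monomial Θ r = 1 := by
  apply op_injective'
  rw [op_mul, op_star, op_monomial, TorusL2.star_shift, smul_mul_assoc, TorusL2.shift_mul,
    smul_smul, mul_comm, torusCocycle_neg_mul_left, one_smul, neg_add_cancel, TorusL2.shift_zero,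
    op_one]

theorem monomial_mul_star (r : Fin n → ℤ) : monomial Θ r * star (monomial Θ r) = 1 := by
  apply op_injective'
  rw [op_mul, op_star, op_monomial, TorusL2.star_shift, mul_smul_comm, TorusL2.shift_mul,
    smul_smul, mul_comm, torusCocycle_neg_mul_right, one_smul, add_neg_cancel, TorusL2.shift_zero,
    op_one]

theorem gen_mem_unitary (k : Fin n) : gen Θ k ∈ unitary (SmoothTorus Θ) :=
  ⟨star_monomial_mul _, monomial_mul_star _⟩

theorem torusCocycle_single (k m : Fin n) :
    torusCocycle Θ (Pi.single k 1) (Pi.single m 1) =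
      if m < k then Complex.exp ((2 * Real.pi * Θ k m : ℝ) * Complex.I) else 1 := by
  have : (∑ k', ∑ m', if m' < k' then
      Θ k' m' * ((Pi.single k 1 : Fin n → ℤ) k' : ℝ) * ((Pi.single m 1 : Fin n → ℤ) m' : ℝ) else 0)
      = if m < k then Θ k m else 0 := by
    rw [Finset.sum_eq_single k, Finset.sum_eq_single m]
    · simp
    · intro b _ hb
      simp [Pi.single_apply, hb]
    · simp
    · intro b _ hb
      simp [Pi.single_apply, hb]
    · simp
  rw [torusCocycle, this]
  split_ifs <;> simp

/-- The defining relations of the noncommutative torus. -/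
theorem gen_mul_gen (hΘ : Θ.transpose = -Θ) (k m : Fin n) :
    gen Θ k * gen Θ m =
      Complex.exp ((2 * Real.pi * Θ k m : ℝ) * Complex.I) • (gen Θ m * gen Θ k) := by
  have h : Θ m k = -Θ k m := congrFun (congrFun hΘ k) m
  rw [gen, gen, monomial_mul, monomial_mul, smul_smul, add_comm, torusCocycle_single,
    torusCocycle_single]
  congr 1
  rcases lt_trichotomy m k with hmk | rfl | hmk
  · rw [if_pos hmk, if_neg hmk.not_gt, mul_one]
  · have h0 : Θ m m = 0 := by linarith
    simp [h0]
  · rw [if_pos hmk, if_neg hmk.not_gt, h, ← Complex.exp_add, ← add_mul, ← Complex.ofReal_add]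
    simp

/-- The canonical trace `τ(∑ a_r U^r) = a_0`. -/
def trace : SmoothTorus Θ →ₗ[ℂ] ℂ where
  toFun a := a.coeff 0
  map_add' _ _ := rfl
  map_smul' _ _ := rfl

/-- The derivation `δ_j(∑ a_r U^r) = ∑ r_j a_r U^r`. -/
def deriv (j : Fin n) (a : SmoothTorus Θ) : SmoothTorus Θ :=
  ofCoeff (fun r => (r j : ℂ) * a.coeff r) (by
    intro k
    obtain ⟨C, hC⟩ := a.coeff_mem (k + 1)
    refine ⟨C, fun r => le_trans ?_ (hC r)⟩
    have : ‖(r j : ℂ)‖ ≤ 1 + ‖r‖ := by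
      have := norm_le_pi_norm r j
      rw [Int.norm_eq_abs] at this
      rw [Complex.norm_intCast]
      linarith
    rw [norm_mul, pow_succ, mul_assoc]
    gcongr)

theorem coeff_deriv (j : Fin n) (a : SmoothTorus Θ) (r : Fin n → ℤ) :
    (deriv j a).coeff r = r j * a.coeff r := rfl

end SmoothTorus

end SmoothTorus

/-! ### The Dirac operator and the spectral triple of the noncommutative torus -/

/-- Clifford gamma matrices: `n` Hermitian matrices of size `2^[n/2]` with
`γ_r γ_s + γ_s γ_r = 2 δ_{rs}`. -/
structure GammaMatrices (n : ℕ) where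
  mat : Fin n → Matrix (Fin (2 ^ (n / 2))) (Fin (2 ^ (n / 2))) ℂ
  hermitian : ∀ j, (mat j).IsHermitian
  clifford : ∀ r s, mat r * mat s + mat s * mat r = if r = s then 2 else 0

/-- The space `ℂ^N`, `N = 2^[n/2]`, with its Euclidean inner product. -/
def Spinor (n : ℕ) : Type := EuclideanSpace ℂ (Fin (2 ^ (n / 2)))

instance Spinor.instNormedAddCommGroup (n : ℕ) : NormedAddCommGroup (Spinor n) :=
  inferInstanceAs (NormedAddCommGroup (EuclideanSpace ℂ (Fin (2 ^ (n / 2)))))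

instance Spinor.instInnerProductSpace (n : ℕ) : InnerProductSpace ℂ (Spinor n) :=
  inferInstanceAs (InnerProductSpace ℂ (EuclideanSpace ℂ (Fin (2 ^ (n / 2)))))

instance Spinor.instFiniteDimensional (n : ℕ) : FiniteDimensional ℂ (Spinor n) :=
  inferInstanceAs (FiniteDimensional ℂ (EuclideanSpace ℂ (Fin (2 ^ (n / 2)))))

instance Spinor.instCompleteSpace (n : ℕ) : CompleteSpace (Spinor n) :=
  FiniteDimensional.complete ℂ _

instance Spinor.instNontrivial (n : ℕ) : Nontrivial (Spinor n) :=
  have : Nonempty (Fin (2 ^ (n / 2))) := ⟨⟨0, by positivity⟩⟩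
  inferInstanceAs (Nontrivial (EuclideanSpace ℂ (Fin (2 ^ (n / 2)))))

/-- A matrix as an operator on `ℂ^N`. -/
def Spinor.ofMatrix {n : ℕ} (M : Matrix (Fin (2 ^ (n / 2))) (Fin (2 ^ (n / 2))) ℂ) :
    Spinor n →L[ℂ] Spinor n :=
  (Matrix.toEuclideanCLM (𝕜 := ℂ) M :
    EuclideanSpace ℂ (Fin (2 ^ (n / 2))) →L[ℂ] EuclideanSpace ℂ (Fin (2 ^ (n / 2))))

section OfMatrix

variable {n : ℕ} (M M' : Matrix (Fin (2 ^ (n / 2))) (Fin (2 ^ (n / 2))) ℂ)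

theorem Spinor.ofMatrix_add : ofMatrix (M + M') = ofMatrix M + ofMatrix M' :=
  map_add (Matrix.toEuclideanCLM (𝕜 := ℂ)) M M'

theorem Spinor.ofMatrix_mul : ofMatrix (M * M') = ofMatrix M * ofMatrix M' :=
  map_mul (Matrix.toEuclideanCLM (𝕜 := ℂ)) M M'

theorem Spinor.ofMatrix_one :
    ofMatrix (1 : Matrix (Fin (2 ^ (n / 2))) (Fin (2 ^ (n / 2))) ℂ) = 1 :=
  map_one (Matrix.toEuclideanCLM (𝕜 := ℂ))

theorem Spinor.ofMatrix_zero :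
    ofMatrix (0 : Matrix (Fin (2 ^ (n / 2))) (Fin (2 ^ (n / 2))) ℂ) = 0 :=
  map_zero (Matrix.toEuclideanCLM (𝕜 := ℂ))

theorem Spinor.ofMatrix_star : ofMatrix M.conjTranspose = star (ofMatrix M) :=
  map_star (Matrix.toEuclideanCLM (𝕜 := ℂ)) M

end OfMatrix

namespace GammaMatrices

variable {n : ℕ} (γ : GammaMatrices n)

/-- `γ_j` as an operator on `ℂ^N`. -/
def clm (j : Fin n) : Spinor n →L[ℂ] Spinor n := Spinor.ofMatrix (γ.mat j)

theorem star_clm (j : Fin n) : star (γ.clm j) = γ.clm j := by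
  rw [clm, ← Spinor.ofMatrix_star]
  exact congrArg _ (γ.hermitian j)

theorem clm_mul_add (r s : Fin n) :
    γ.clm r * γ.clm s + γ.clm s * γ.clm r = if r = s then 2 else 0 := by
  rw [clm, clm, ← Spinor.ofMatrix_mul, ← Spinor.ofMatrix_mul, ← Spinor.ofMatrix_add, γ.clifford]
  split_ifs
  · rw [← one_add_one_eq_two, Spinor.ofMatrix_add, Spinor.ofMatrix_one, one_add_one_eq_two]
  · exact Spinor.ofMatrix_zero

/-- The matrix `∑ r_j γ_j`, by which the Dirac operator acts on `e_r ⊗ ℂ^N`. -/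
def symbol (r : Fin n → ℤ) : Spinor n →L[ℂ] Spinor n := ∑ j, (r j : ℂ) • γ.clm j

theorem star_symbol (r : Fin n → ℤ) : star (γ.symbol r) = γ.symbol r := by
  simp [symbol, star_sum, star_clm]

theorem symbol_add (r s : Fin n → ℤ) : γ.symbol (r + s) = γ.symbol r + γ.symbol s := by
  simp [symbol, add_smul, Finset.sum_add_distrib]

theorem symbol_mul_self (r : Fin n → ℤ) :
    γ.symbol r * γ.symbol r = ((∑ j, (r j : ℝ) ^ 2 : ℝ) : ℂ) • 1 := by
  have h2 : (2 : ℂ) • (γ.symbol r * γ.symbol r) = (2 : ℂ) • (((∑ j, (r j : ℝ) ^ 2 : ℝ) : ℂ) • 1) := by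
    have e1 : γ.symbol r * γ.symbol r =
        ∑ j, ∑ k, ((r j : ℂ) * (r k : ℂ)) • (γ.clm j * γ.clm k) := by
      simp only [symbol, Finset.sum_mul, Finset.mul_sum, smul_mul_smul_comm]
      exact Finset.sum_comm
    have e2 : γ.symbol r * γ.symbol r =
        ∑ j, ∑ k, ((r j : ℂ) * (r k : ℂ)) • (γ.clm k * γ.clm j) := by
      rw [e1, Finset.sum_comm]
      simp only [mul_comm]
    rw [two_smul]
    nth_rewrite 1 [e1]
    rw [e2]
    simp only [← Finset.sum_add_distrib, ← smul_add, clm_mul_add]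
    simp only [smul_ite, smul_zero, Finset.sum_ite_eq, Finset.mem_univ, if_true]
    rw [← Finset.sum_smul, smul_smul, ← one_add_one_eq_two, smul_add, ← add_smul]
    push_cast
    congr 1
    rw [← one_add_one_eq_two, add_mul, one_mul]
    simp only [pow_two]
  exact smul_right_injective _ (two_ne_zero) h2

theorem inner_symbol (r : Fin n → ℤ) (v w : Spinor n) :
    ⟪γ.symbol r v, w⟫_ℂ = ⟪v, γ.symbol r w⟫_ℂ := by
  rw [← ContinuousLinearMap.adjoint_inner_right, ← ContinuousLinearMap.star_eq_adjoint,
    star_symbol]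

theorem norm_symbol_sq (r : Fin n → ℤ) (v : Spinor n) :
    ‖γ.symbol r v‖ ^ 2 = (∑ j, (r j : ℝ) ^ 2) * ‖v‖ ^ 2 := by
  have h : ⟪γ.symbol r v, γ.symbol r v⟫_ℂ = ((∑ j, (r j : ℝ) ^ 2 : ℝ) : ℂ) * ⟪v, v⟫_ℂ := by
    rw [inner_symbol]
    have : γ.symbol r (γ.symbol r v) = ((∑ j, (r j : ℝ) ^ 2 : ℝ) : ℂ) • v :=
      congrArg (fun T : Spinor n →L[ℂ] Spinor n => T v) (γ.symbol_mul_self r)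
    rw [this, inner_smul_right]
  rw [inner_self_eq_norm_sq_to_K, inner_self_eq_norm_sq_to_K] at h
  apply Complex.ofReal_injective
  rw [Complex.ofReal_mul, Complex.ofReal_pow, Complex.ofReal_pow]
  exact h

/-- The Dirac operator `D = ∑ δ_j ⊗ γ_j` on `ℓ²(ℤⁿ) ⊗ ℂ^N`, with its domain of self-adjointness. -/
def dirac : TorusL2 n (Spinor n) →ₗ.[ℂ] TorusL2 n (Spinor n) where
  domain :=
    { carrier := {x | Summable fun r => ‖γ.symbol r (x r)‖ ^ 2}
      add_mem' := by
        intro x y hx hy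
        refine Summable.of_nonneg_of_le (fun r => by positivity) (fun r => ?_)
          ((hx.mul_left 2).add (hy.mul_left 2))
        rw [TorusL2.add_apply, map_add, ← mul_add]
        calc ‖γ.symbol r (x r) + γ.symbol r (y r)‖ ^ 2
            ≤ (‖γ.symbol r (x r)‖ + ‖γ.symbol r (y r)‖) ^ 2 := by
              gcongr; exact norm_add_le _ _
          _ ≤ _ := by nlinarith [sq_nonneg (‖γ.symbol r (x r)‖ - ‖γ.symbol r (y r)‖)]
      zero_mem' := by
        change Summable fun r : Fin n → ℤ => ‖γ.symbol r (0 : Spinor n)‖ ^ 2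
        simp
      smul_mem' := by
        intro c x hx
        refine (hx.mul_left (‖c‖ ^ 2)).congr fun r => ?_
        rw [TorusL2.smul_apply, map_smul, norm_smul, mul_pow] }
  toFun :=
    { toFun := fun x => TorusL2.mk (fun r => γ.symbol r ((x : TorusL2 n (Spinor n)) r)) x.2
      map_add' := fun x y => TorusL2.ext fun r => map_add (γ.symbol r) _ _
      map_smul' := fun c x => TorusL2.ext fun r => map_smul (γ.symbol r) c _ }

theorem mem_dirac_domain {x : TorusL2 n (Spinor n)} :
    x ∈ γ.dirac.domain ↔ Summable fun r => ‖γ.symbol r (x r)‖ ^ 2 := Iff.rfl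

theorem dirac_apply (x : γ.dirac.domain) (r : Fin n → ℤ) :
    γ.dirac x r = γ.symbol r ((x : TorusL2 n (Spinor n)) r) := rfl

theorem single_mem_domain (r : Fin n → ℤ) (v : Spinor n) :
    TorusL2.single r v ∈ γ.dirac.domain := by
  rw [mem_dirac_domain]
  refine summable_of_ne_finset_zero (s := {r}) fun s hs => ?_
  rw [TorusL2.single_apply, if_neg (by simpa using hs)]
  simp

theorem dirac_dense : Dense (γ.dirac.domain : Set (TorusL2 n (Spinor n))) := by
  rw [Submodule.dense_iff_topologicalClosure_eq_top, Submodule.topologicalClosure_eq_top_iff,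
    Submodule.eq_bot_iff]
  intro x hx
  refine TorusL2.ext fun r => ?_
  refine ext_inner_left ℂ fun v => ?_
  have := (Submodule.mem_orthogonal _ _).1 hx _ (γ.single_mem_domain r v)
  rw [TorusL2.inner_single_left] at this
  rw [this]
  exact (inner_zero_right _).symm

theorem dirac_selfAdjoint : IsSelfAdjoint γ.dirac := by
  rw [LinearPMap.isSelfAdjoint_def]
  refine le_antisymm ?_ ?_
  · have key : ∀ (y : γ.dirac.adjoint.domain) r,
        γ.dirac.adjoint y r = γ.symbol r ((y : TorusL2 n (Spinor n)) r) := by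
      intro y r
      refine ext_inner_right ℂ fun v => ?_
      have h := LinearPMap.adjoint_isFormalAdjoint γ.dirac_dense y ⟨_, γ.single_mem_domain r v⟩
      rw [TorusL2.inner_single_right] at h
      rw [h]
      have : γ.dirac ⟨_, γ.single_mem_domain r v⟩ = TorusL2.single r (γ.symbol r v) := by
        refine TorusL2.ext fun s => ?_
        rw [dirac_apply, TorusL2.single_apply, TorusL2.single_apply]
        split_ifs with hs
        · rw [hs]
        · exact map_zero _
      rw [this, TorusL2.inner_single_right, inner_symbol]
    refine ⟨fun y hy => ?_, fun y z hyz => ?_⟩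
    · rw [mem_dirac_domain]
      have := TorusL2.summable_sq (γ.dirac.adjoint ⟨y, hy⟩)
      simpa only [key] using this
    · refine TorusL2.ext fun r => ?_
      rw [key, dirac_apply, hyz]
  · apply LinearPMap.IsFormalAdjoint.le_adjoint γ.dirac_dense
    intro x y
    rw [TorusL2.inner_eq, TorusL2.inner_eq]
    simp only [dirac_apply, inner_symbol]

/-- The Euclidean length of a lattice vector. -/
def latticeNorm (r : Fin n → ℤ) : ℝ := √(∑ j, (r j : ℝ) ^ 2)

theorem one_le_latticeNorm {r : Fin n → ℤ} (hr : r ≠ 0) : 1 ≤ latticeNorm r := by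
  obtain ⟨j, hj⟩ := Function.ne_iff.1 hr
  rw [latticeNorm, Real.one_le_sqrt]
  have h1 : (1 : ℝ) ≤ (r j : ℝ) ^ 2 := by
    rw [one_le_sq_iff_one_le_abs]
    exact_mod_cast Int.one_le_abs hj
  exact h1.trans (Finset.single_le_sum (f := fun j => (r j : ℝ) ^ 2)
    (fun _ _ => by positivity) (Finset.mem_univ j))

/-- The operator `|D|^{-d}`, which is `0` on the kernel of `D`: since `D²` acts on `e_r ⊗ ℂ^N` as
multiplication by `|r|²`, it is multiplication by `|r|^{-d}` there, `r ≠ 0`. -/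
def absDiracInvPow (n d : ℕ) : TorusL2 n (Spinor n) →L[ℂ] TorusL2 n (Spinor n) :=
  TorusL2.diag (fun r => if r = 0 then 0 else (((latticeNorm r ^ d)⁻¹ : ℝ) : ℂ) • 1) 1 (by
    intro r
    split_ifs with hr
    · simp
    · have h1 : 1 ≤ latticeNorm r ^ d := one_le_pow₀ (one_le_latticeNorm hr)
      rw [norm_smul, Complex.norm_real, Real.norm_of_nonneg (by positivity)]
      calc (latticeNorm r ^ d)⁻¹ * ‖(1 : Spinor n →L[ℂ] Spinor n)‖ ≤ 1 * 1 := by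
            gcongr
            · exact inv_le_one_of_one_le₀ h1
            · exact ContinuousLinearMap.norm_id_le
        _ = 1 := one_mul _)

/-- `|D|^{-d}` is the function `λ ↦ |λ|^{-d}`, with value `0` at `λ = 0`, of the Dirac operator: it
acts in this way on every eigenvector. -/
theorem absDiracInvPow_eigenvector (d : ℕ) (c : ℝ) (x : γ.dirac.domain)
    (hx : γ.dirac x = (c : ℂ) • (x : TorusL2 n (Spinor n))) :
    absDiracInvPow n d x = if c = 0 then 0 else (((|c| ^ d)⁻¹ : ℝ) : ℂ) • (x : TorusL2 n (Spinor n)) := by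
  have h1 : ∀ r, (x : TorusL2 n (Spinor n)) r = 0 ∨ latticeNorm r = |c| := by
    intro r
    have h := congrArg (fun y : TorusL2 n (Spinor n) => ‖y r‖ ^ 2) hx
    simp only [dirac_apply, norm_symbol_sq, TorusL2.smul_apply, norm_smul, mul_pow,
      Complex.norm_real, Real.norm_eq_abs] at h
    rcases eq_or_ne ((x : TorusL2 n (Spinor n)) r) 0 with h0 | h0
    · exact Or.inl h0
    · right
      have := mul_right_cancel₀ (pow_ne_zero 2 (norm_ne_zero_iff.2 h0)) h
      rw [latticeNorm, this, Real.sqrt_sq (abs_nonneg c)]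
  refine TorusL2.ext fun r => ?_
  rw [absDiracInvPow, TorusL2.diag_apply]
  rcases h1 r with h0 | h0
  · rw [h0, map_zero]
    split_ifs
    · rfl
    · rw [TorusL2.smul_apply, h0, smul_zero]
  · by_cases hr : r = 0
    · have hc : c = 0 := by
        rw [hr] at h0
        simpa [latticeNorm] using h0.symm
      rw [if_pos hr, if_pos hc]
      rfl
    · have hc : c ≠ 0 := by
        intro hc
        have := one_le_latticeNorm hr
        rw [h0, hc, abs_zero] at this
        linarith
      rw [if_neg hr, if_neg hc, h0]
      rfl

theorem finite_latticeNorm_le (C : ℝ) : {r : Fin n → ℤ | latticeNorm r ≤ C}.Finite := by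
  refine (Set.finite_Icc (fun _ : Fin n => -⌈C⌉) (fun _ => ⌈C⌉)).subset fun r hr => ?_
  have h : ∀ j, |(r j : ℝ)| ≤ ⌈C⌉ := fun j => by
    refine le_trans ?_ (hr.trans (Int.le_ceil C))
    rw [← Real.sqrt_sq_eq_abs]
    exact Real.sqrt_le_sqrt (Finset.single_le_sum (f := fun j => (r j : ℝ) ^ 2)
      (fun _ _ => by positivity) (Finset.mem_univ j))
  have h' : ∀ j, |r j| ≤ ⌈C⌉ := fun j => by exact_mod_cast h j
  exact ⟨fun j => (abs_le.1 (h' j)).1, fun j => (abs_le.1 (h' j)).2⟩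

/-- The blocks of the resolvent `(D + i)⁻¹ = (D - i) (D² + 1)⁻¹`. -/
def resolventBlock (r : Fin n → ℤ) : Spinor n →L[ℂ] Spinor n :=
  ((((∑ j, (r j : ℝ) ^ 2) + 1)⁻¹ : ℝ) : ℂ) • (γ.symbol r - Complex.I • 1)

theorem symbol_resolventBlock (r : Fin n → ℤ) (v : Spinor n) :
    γ.symbol r (γ.resolventBlock r v) + Complex.I • γ.resolventBlock r v = v := by
  have hne : ((((∑ j, (r j : ℝ) ^ 2) + 1 : ℝ)) : ℂ) ≠ 0 := by
    have : (0 : ℝ) < (∑ j, (r j : ℝ) ^ 2) + 1 := by positivity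
    exact_mod_cast this.ne'
  have h : (γ.symbol r + Complex.I • 1) * γ.resolventBlock r = 1 := by
    have e : (γ.symbol r + Complex.I • 1) * (γ.symbol r - Complex.I • 1) =
        ((((∑ j, (r j : ℝ) ^ 2) + 1 : ℝ)) : ℂ) • 1 := by
      rw [add_mul, mul_sub, mul_sub, symbol_mul_self, Complex.ofReal_add, add_smul]
      simp [smul_smul]
      abel
    rw [resolventBlock, mul_smul_comm, e, smul_smul, Complex.ofReal_inv, inv_mul_cancel₀ hne,
      one_smul]
  exact congrArg (fun T : Spinor n →L[ℂ] Spinor n => T v) h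

theorem norm_resolventBlock_sq (r : Fin n → ℤ) (v : Spinor n) :
    ((∑ j, (r j : ℝ) ^ 2) + 1) * ‖γ.resolventBlock r v‖ ^ 2 = ‖v‖ ^ 2 := by
  have h := γ.symbol_resolventBlock r v
  set w := γ.resolventBlock r v
  have h0 : RCLike.re ⟪γ.symbol r w, Complex.I • w⟫_ℂ = 0 := by
    rw [inner_smul_right]
    have h1 : (starRingEnd ℂ) ⟪γ.symbol r w, w⟫_ℂ = ⟪γ.symbol r w, w⟫_ℂ := by
      rw [inner_conj_symm, inner_symbol]
    have h2 := Complex.conj_eq_iff_im.1 h1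
    simp [h2]
  rw [← h, norm_add_sq (𝕜 := ℂ), h0, norm_symbol_sq, norm_smul, Complex.norm_I, one_mul]
  ring

theorem norm_resolventBlock_le (r : Fin n → ℤ) : ‖γ.resolventBlock r‖ ≤ (√((∑ j, (r j : ℝ) ^ 2) + 1))⁻¹ := by
  refine ContinuousLinearMap.opNorm_le_bound _ (by positivity) fun v => ?_
  have hp : (0 : ℝ) < (∑ j, (r j : ℝ) ^ 2) + 1 := by positivity
  refine le_of_sq_le_sq ?_ (by positivity)
  rw [mul_pow, inv_pow, Real.sq_sqrt hp.le, ← γ.norm_resolventBlock_sq r v, ← mul_assoc,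
    inv_mul_cancel₀ hp.ne', one_mul]

theorem norm_resolventBlock_le_one (r : Fin n → ℤ) : ‖γ.resolventBlock r‖ ≤ 1 := by
  refine (γ.norm_resolventBlock_le r).trans (inv_le_one_of_one_le₀ ?_)
  rw [Real.one_le_sqrt]
  have : (0 : ℝ) ≤ ∑ j, (r j : ℝ) ^ 2 := by positivity
  linarith

theorem dirac_compact_resolvent :
    ∃ R : TorusL2 n (Spinor n) →L[ℂ] TorusL2 n (Spinor n), IsCompactOperator R ∧
      ∀ x, ∃ h : R x ∈ γ.dirac.domain, γ.dirac ⟨R x, h⟩ + Complex.I • R x = x := by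
  refine ⟨TorusL2.diag γ.resolventBlock 1 γ.norm_resolventBlock_le_one, ?_, fun x => ?_⟩
  · let F : Finset (Fin n → ℤ) → TorusL2 n (Spinor n) →L[ℂ] TorusL2 n (Spinor n) := fun s =>
      ∑ r ∈ s, (TorusL2.single r).comp ((γ.resolventBlock r).comp (TorusL2.eval r))
    have hF : ∀ s, IsCompactOperator (F s) := by
      intro s
      change F s ∈ compactOperator (RingHom.id ℂ) (TorusL2 n (Spinor n)) (TorusL2 n (Spinor n))
      refine Submodule.sum_mem _ fun r _ => ?_
      have : ProperSpace (Spinor n) := FiniteDimensional.proper ℂ _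
      have h1 : IsCompactOperator (id : Spinor n → Spinor n) := isCompactOperator_id
      exact (h1.comp_clm (TorusL2.eval r)).clm_comp ((TorusL2.single r).comp (γ.resolventBlock r))
    refine isCompactOperator_of_tendsto (l := atTop) (F := F) ?_ (Eventually.of_forall hF)
    have hFa : ∀ s x r, F s x r = if r ∈ s then γ.resolventBlock r (x r) else 0 := by
      intro s x r
      have : F s x r = ∑ t ∈ s, TorusL2.single t (γ.resolventBlock t (x t)) r := by
        change TorusL2.eval r (F s x) = _
        simp only [F, _root_.sum_apply, map_sum]
        rfl
      rw [this]
      simp only [TorusL2.single_apply, Finset.sum_ite_eq]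
    rw [Metric.tendsto_atTop]
    intro ε hε
    refine ⟨(finite_latticeNorm_le (n := n) (2 / ε)).toFinset, fun s hs => ?_⟩
    rw [dist_eq_norm]
    refine lt_of_le_of_lt (b := ε / 2) ?_ (by linarith)
    refine ContinuousLinearMap.opNorm_le_bound _ (by positivity) fun x => ?_
    refine le_of_sq_le_sq ?_ (by positivity)
    rw [mul_pow, TorusL2.norm_sq, TorusL2.norm_sq, ← tsum_mul_left]
    have key : ∀ r, ‖(F s - TorusL2.diag γ.resolventBlock 1 γ.norm_resolventBlock_le_one) x r‖ ^ 2 ≤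
        (ε / 2) ^ 2 * ‖x r‖ ^ 2 := by
      intro r
      have e : (F s - TorusL2.diag γ.resolventBlock 1 γ.norm_resolventBlock_le_one) x r =
          (if r ∈ s then γ.resolventBlock r (x r) else 0) - γ.resolventBlock r (x r) := by
        rw [← hFa]; rfl
      rw [e]
      split_ifs with h
      · rw [sub_self, norm_zero, zero_pow two_ne_zero]; positivity
      · rw [zero_sub, norm_neg, ← mul_pow]
        gcongr
        refine ContinuousLinearMap.le_of_opNorm_le _ ((γ.norm_resolventBlock_le r).trans ?_) _
        have h1 : 2 / ε < latticeNorm r := by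
          by_contra hc
          exact h (hs (by simpa using hc))
        have h2 : latticeNorm r ≤ √((∑ j, (r j : ℝ) ^ 2) + 1) :=
          Real.sqrt_le_sqrt (by linarith)
        rw [← inv_div]
        exact inv_anti₀ (by positivity) (h1.le.trans h2)
    exact Summable.tsum_le_tsum key (TorusL2.summable_sq _) ((TorusL2.summable_sq x).mul_left _)
  · have hm : TorusL2.diag γ.resolventBlock 1 γ.norm_resolventBlock_le_one x ∈ γ.dirac.domain := by
      rw [mem_dirac_domain]
      refine Summable.of_nonneg_of_le (fun r => by positivity) (fun r => ?_)
        (TorusL2.summable_sq x)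
      rw [TorusL2.diag_apply, norm_symbol_sq, ← γ.norm_resolventBlock_sq r (x r)]
      gcongr
      linarith
    refine ⟨hm, TorusL2.ext fun r => ?_⟩
    exact γ.symbol_resolventBlock r (x r)

/-- `1 ⊗ γ_j` on `ℓ²(ℤⁿ) ⊗ ℂ^N`. -/
def ampl (j : Fin n) : TorusL2 n (Spinor n) →L[ℂ] TorusL2 n (Spinor n) :=
  TorusL2.diag (fun _ => γ.clm j) ‖γ.clm j‖ (fun _ => le_rfl)

/-- `[D, a] = ∑ δ_j(a) ⊗ γ_j`. -/
theorem dirac_comm {Θ : Matrix (Fin n) (Fin n) ℝ} (a : SmoothTorus Θ) (x : γ.dirac.domain) :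
    ∃ h : SmoothTorus.rep (Spinor n) a (x : TorusL2 n (Spinor n)) ∈ γ.dirac.domain,
      γ.dirac ⟨_, h⟩ - SmoothTorus.rep (Spinor n) a (γ.dirac x) =
        (∑ j, γ.ampl j * SmoothTorus.rep (Spinor n) (SmoothTorus.deriv j a)) x := by
  have key : ∀ r, γ.symbol r (SmoothTorus.rep (Spinor n) a (x : TorusL2 n (Spinor n)) r) =
      (SmoothTorus.rep (Spinor n) a (γ.dirac x) +
        (∑ j, γ.ampl j * SmoothTorus.rep (Spinor n) (SmoothTorus.deriv j a)) x :
          TorusL2 n (Spinor n)) r := by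
    intro r
    have h1 := (SmoothTorus.hasSum_op_apply a (x : TorusL2 n (Spinor n)) r).mapL (γ.symbol r)
    have h2 := SmoothTorus.hasSum_op_apply a (γ.dirac x) r
    have h3 := hasSum_sum (s := Finset.univ) fun j _ => (SmoothTorus.hasSum_op_apply
      (SmoothTorus.deriv j a) (x : TorusL2 n (Spinor n)) r).mapL (γ.clm j)
    have e : (∑ j, γ.ampl j * SmoothTorus.rep (Spinor n) (SmoothTorus.deriv j a) :
          TorusL2 n (Spinor n) →L[ℂ] TorusL2 n (Spinor n)) x r =
        ∑ j, γ.clm j ((SmoothTorus.deriv j a).op (Spinor n) (x : TorusL2 n (Spinor n)) r) := by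
      change TorusL2.eval r ((∑ j, γ.ampl j * SmoothTorus.rep (Spinor n) (SmoothTorus.deriv j a) :
          TorusL2 n (Spinor n) →L[ℂ] TorusL2 n (Spinor n)) x) = _
      simp only [_root_.sum_apply, map_sum]
      rfl
    rw [TorusL2.add_apply, e]
    refine h1.unique ?_
    convert h2.add h3 using 1
    · ext1 s
      rw [dirac_apply]
      have hs : γ.symbol r = γ.symbol (r - s) + γ.symbol s := by
        rw [← symbol_add, sub_add_cancel]
      have h4 : ∀ y : Spinor n, γ.symbol s y = ∑ j, (s j : ℂ) • γ.clm j y := by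
        intro y
        rw [symbol, _root_.sum_apply]
        rfl
      rw [hs]
      change (γ.symbol (r - s)) _ + (γ.symbol s) _ = _
      rw [map_smul, map_smul, h4]
      congr 1
      refine Finset.sum_congr rfl fun j _ => ?_
      rw [map_smul, map_smul, map_smul, map_smul, SmoothTorus.coeff_deriv, mul_smul]
    · rfl
  have hm : SmoothTorus.rep (Spinor n) a (x : TorusL2 n (Spinor n)) ∈ γ.dirac.domain := by
    rw [mem_dirac_domain]
    simp only [key]
    exact TorusL2.summable_sq _
  refine ⟨hm, ?_⟩
  rw [sub_eq_iff_eq_add']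
  exact TorusL2.ext key

/-- The spectral triple `(A_Θ, ℓ²(ℤⁿ) ⊗ ℂ^N, D)` of the noncommutative torus. -/
def torusTriple (Θ : Matrix (Fin n) (Fin n) ℝ) :
    SpectralTriple (SmoothTorus Θ) (TorusL2 n (Spinor n)) where
  rep := SmoothTorus.rep (Spinor n)
  faithful := SmoothTorus.op_injective
  D := γ.dirac
  selfAdjoint := γ.dirac_selfAdjoint
  compact_resolvent := γ.dirac_compact_resolvent
  bounded_comm a := ⟨_, γ.dirac_comm a⟩

/-- The basis one-form `σ_j = π(U_j^* dU_j)` of `Ω¹_D`. -/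
def sigma (Θ : Matrix (Fin n) (Fin n) ℝ) (j : Fin n) : (γ.torusTriple Θ).Omega1 :=
  star (SmoothTorus.gen Θ j) • (γ.torusTriple Θ).d0 (SmoothTorus.gen Θ j)

/-- `∇_1, …, ∇_n` are the components of the connection `∇`, that is, `∇ξ = ∑ ∇_j ξ ⊗ σ_j`. -/
def IsComponents {Θ : Matrix (Fin n) (Fin n) ℝ} {q : ℕ}
    {p : Matrix (Fin q) (Fin q) (SmoothTorus Θ)} (c : (γ.torusTriple Θ).CompatibleConnection p)
    (comp : Fin n → projModule p →ₗ[ℂ] projModule p) : Prop :=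
  ∀ ξ, c.toFun ξ = ∑ j, btmul (SmoothTorus Θ) (comp j ξ) (γ.sigma Θ j)

end GammaMatrices

/-- The extended trace `τ_q = τ ⊗ Trace` on `M_q(A_Θ)`. -/
def SmoothTorus.matrixTrace {n : ℕ} {Θ : Matrix (Fin n) (Fin n) ℝ} {q : ℕ}
    (M : Matrix (Fin q) (Fin q) (SmoothTorus Θ)) : ℂ :=
  ∑ k, (M k k).trace

end

/-! Algebra. Since $[D,U_j]=U_j\otimes\gamma_j$ and $U_j$ is unitary, $\sigma_j=1\otimes\gamma_j$.
These operators commute with $A_\Theta$, and the Clifford relations make them linearly independent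
over it. So $\Omega^1_D$ is a free left module on the $\sigma_j$ (`sigmaBasis`), and the components
$\nabla_j$ are the coefficients of $\nabla\xi$. They satisfy a Leibniz rule with respect to
$\delta_j$. The subspace $\pi(dJ_0^1)$ is exactly $A_\Theta\otimes 1$. It contains this algebra
because $U^*dU+U\,dU^*$ is killed by $\pi$ while its differential goes to $-2$
(`mem_piDJ_of_eq_rep`). It is no larger because commuting derivations force the coefficient matrix
of $\pi(dw)$ to be symmetric when $\pi(w)=0$, so that anticommutation leaves only the diagonal
(`exists_eq_rep_of_mem_piDJ`). Hence in $\Omega^2_D$ one has $\sigma_m^2=0$,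
$\sigma_j\sigma_m=-\sigma_m\sigma_j$ and $d\sigma_j=0$, and the curvature is
$\sum_{m<j}[\nabla_m,\nabla_j]\otimes\sigma_m\sigma_j$.

Inner product. The functional $X\mapsto\mathrm{Tr}_\omega(X|D|^{-n})$ is invariant under conjugation
by unitaries commuting with $|D|^{-n}$. Gauge unitaries make it vanish on $U^s\otimes M$ for
$s\ne0$, and unitaries $1\otimes u$ make it a multiple of the matrix trace on $1\otimes M$. So on
$A_\Theta\otimes M_N(\mathbb C)$ it equals
$\mathrm{Tr}_\omega(|D|^{-n})\,\tau\otimes\frac1N\mathrm{Trace}$, which is a sum of vector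
functionals (`diracFunctional_eq_sum_vacuum`). This gives positivity of the form and the Hilbert
completion. The products $\gamma_m\gamma_j$, $m<j$, are orthonormal for the normalized trace and
orthogonal to $1$. The antisymmetric representative of the curvature is therefore orthogonal to
$\pi(dJ_0^1)$, the projection $P$ fixes it, and its norm is read off coefficientwise.

Analysis. What remains is that the Dixmier trace is a bounded linear functional on the operators in
play. These have singular numbers $O(1/k)$: counting lattice points shows that those of $|D|^{-n}$
lie between two positive multiples of $1/(k+1)$. The upper bound gives finiteness, the lower one
positivity of $\mathrm{Tr}_\omega(|D|^{-n})$. Additivity on positive operators follows from two Ky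
Fan inequalities, `singularSum_add_le` and `le_singularSum_add`. The second doubles the number of
singular values, and the dilation invariance of $\omega$ absorbs this (`dixmierPos_eq_dilated`). -/

noncomputable section

/-! ### Singular numbers and the two halves of the min-max principle -/

section SingularNumber

variable {H : Type} [NormedAddCommGroup H] [InnerProductSpace ℂ H] [CompleteSpace H]

theorem singularNumber_le {T F : H →L[ℂ] H} {k : ℕ}
    (hF : LinearMap.rank (F : H →ₗ[ℂ] H) ≤ k) : singularNumber T k ≤ ‖T - F‖ :=
  csInf_le ⟨0, by rintro _ ⟨F, -, rfl⟩; exact norm_nonneg _⟩ ⟨F, hF, rfl⟩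

theorem le_singularNumber {T : H →L[ℂ] H} {k : ℕ} {t : ℝ}
    (h : ∀ F : H →L[ℂ] H, LinearMap.rank (F : H →ₗ[ℂ] H) ≤ k → t ≤ ‖T - F‖) :
    t ≤ singularNumber T k := by
  refine le_csInf ⟨_, 0, ?_, rfl⟩ ?_
  · rw [ContinuousLinearMap.toLinearMap_zero, LinearMap.rank_zero]
    exact zero_le
  · rintro _ ⟨F, hF, rfl⟩
    exact h F hF

theorem singularNumber_nonneg (T : H →L[ℂ] H) (k : ℕ) : 0 ≤ singularNumber T k :=
  le_singularNumber fun _ _ => norm_nonneg _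

theorem singularNumber_le_norm (T : H →L[ℂ] H) (k : ℕ) : singularNumber T k ≤ ‖T‖ := by
  refine (singularNumber_le (F := 0) ?_).trans_eq (by rw [sub_zero])
  rw [ContinuousLinearMap.toLinearMap_zero, LinearMap.rank_zero]
  exact zero_le

theorem singularNumber_antitone (T : H →L[ℂ] H) : Antitone (singularNumber T) :=
  fun _ _ h => le_singularNumber fun _ hF => singularNumber_le (hF.trans (by exact_mod_cast h))

theorem singularNumber_mul_left_le (X T : H →L[ℂ] H) (k : ℕ) :
    singularNumber (X * T) k ≤ ‖X‖ * singularNumber T k := by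
  rcases eq_or_ne X 0 with rfl | hX
  · rw [zero_mul, norm_zero, zero_mul]
    exact (singularNumber_le_norm _ _).trans_eq norm_zero
  have hX' : 0 < ‖X‖ := norm_pos_iff.2 hX
  rw [← div_le_iff₀' hX']
  refine le_singularNumber fun F hF => ?_
  rw [div_le_iff₀' hX']
  refine (singularNumber_le (F := X * F) ?_).trans ?_
  · exact (LinearMap.rank_comp_le_right (F : H →ₗ[ℂ] H) (X : H →ₗ[ℂ] H)).trans hF
  · rw [← mul_sub]
    exact norm_mul_le _ _

theorem singularNumber_mul_right_le (T X : H →L[ℂ] H) (k : ℕ) :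
    singularNumber (T * X) k ≤ singularNumber T k * ‖X‖ := by
  rcases eq_or_ne X 0 with rfl | hX
  · rw [mul_zero, norm_zero, mul_zero]
    exact (singularNumber_le_norm _ _).trans_eq norm_zero
  have hX' : 0 < ‖X‖ := norm_pos_iff.2 hX
  rw [← div_le_iff₀ hX']
  refine le_singularNumber fun F hF => ?_
  rw [div_le_iff₀ hX']
  refine (singularNumber_le (F := F * X) ?_).trans ?_
  · exact (LinearMap.rank_comp_le_left (X : H →ₗ[ℂ] H) (F : H →ₗ[ℂ] H)).trans hF
  · rw [← sub_mul]
    exact norm_mul_le _ _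

theorem singularNumber_smul (c : ℂ) (T : H →L[ℂ] H) (k : ℕ) :
    singularNumber (c • T) k = ‖c‖ * singularNumber T k := by
  have key : ∀ (c : ℂ) (T : H →L[ℂ] H), singularNumber (c • T) k ≤ ‖c‖ * singularNumber T k := by
    intro c T
    have h := singularNumber_mul_left_le (c • 1) T k
    rw [smul_mul_assoc, one_mul] at h
    refine h.trans (mul_le_mul_of_nonneg_right ?_ (singularNumber_nonneg _ _))
    rw [norm_smul]
    exact mul_le_of_le_one_right (norm_nonneg _) ContinuousLinearMap.norm_id_le
  refine le_antisymm (key c T) ?_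
  rcases eq_or_ne c 0 with rfl | hc
  · rw [norm_zero, zero_mul]
    exact singularNumber_nonneg _ _
  · have h := key c⁻¹ (c • T)
    rwa [smul_smul, inv_mul_cancel₀ hc, one_smul, norm_inv,
      le_inv_mul_iff₀ (norm_pos_iff.2 hc)] at h

theorem singularNumber_add_le (S T : H →L[ℂ] H) (j k : ℕ) :
    singularNumber (S + T) (j + k) ≤ singularNumber S j + singularNumber T k := by
  rw [← sub_le_iff_le_add]
  refine le_singularNumber fun F hF => ?_
  rw [sub_le_comm]
  refine le_singularNumber fun G hG => ?_
  rw [sub_le_iff_le_add]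
  refine (singularNumber_le (F := F + G) ?_).trans ?_
  · rw [ContinuousLinearMap.toLinearMap_add]
    refine (LinearMap.rank_add_le _ _).trans ?_
    push_cast
    exact add_le_add hF hG
  · rw [add_sub_add_comm, add_comm]
    rw [add_comm ‖T - G‖, add_comm (T - G)]
    exact norm_add_le _ _

/-- A linear map is injective on the orthogonal complement of its kernel. -/
theorem rank_orthogonal_ker_le (F : H →L[ℂ] H) :
    Module.rank ℂ (LinearMap.ker (F : H →ₗ[ℂ] H))ᗮ ≤ LinearMap.rank (F : H →ₗ[ℂ] H) := by
  set K := LinearMap.ker (F : H →ₗ[ℂ] H)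
  refine LinearMap.rank_le_of_injective
    ((F : H →ₗ[ℂ] H).rangeRestrict ∘ₗ Kᗮ.subtype) ?_
  rw [← LinearMap.ker_eq_bot, LinearMap.ker_eq_bot']
  rintro ⟨x, hx⟩ h
  have h1 : F x = 0 := congrArg Subtype.val h
  have h2 : x ∈ K := h1
  exact Subtype.ext (inner_self_eq_zero.1 ((Submodule.mem_orthogonal _ _).1 hx x h2))

theorem rank_starProjection (V : Submodule ℂ H) [V.HasOrthogonalProjection] :
    LinearMap.rank (V.starProjection : H →ₗ[ℂ] H) = Module.rank ℂ V := by
  have : LinearMap.range (V.starProjection : H →ₗ[ℂ] H) = V := V.range_starProjection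
  rw [LinearMap.rank, this]

/-- Singular numbers are monotone with respect to the pointwise norm. -/
theorem singularNumber_le_of_norm_apply_le {A B : H →L[ℂ] H} (h : ∀ x, ‖A x‖ ≤ ‖B x‖) (k : ℕ) :
    singularNumber A k ≤ singularNumber B k := by
  refine le_singularNumber fun F hF => ?_
  set K := LinearMap.ker (F : H →ₗ[ℂ] H)
  have hK : IsClosed (K : Set H) := F.isClosed_ker
  have : CompleteSpace K := hK.completeSpace_coe
  -- An approximant `F` of `B` yields the approximant of `A` that agrees with `A` off `ker F`. The
  -- error lives on `ker F`, where `A` is dominated by `B`, and `B` equals `B - F` there.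
  refine (singularNumber_le (F := A * Kᗮ.starProjection) ?_).trans ?_
  · refine (LinearMap.rank_comp_le_right (Kᗮ.starProjection : H →ₗ[ℂ] H) (A : H →ₗ[ℂ] H)).trans ?_
    rw [rank_starProjection]
    exact (rank_orthogonal_ker_le F).trans hF
  · refine ContinuousLinearMap.opNorm_le_bound _ (norm_nonneg _) fun x => ?_
    have e : (A - A * Kᗮ.starProjection) x = A (K.starProjection x) := by
      rw [Submodule.starProjection_orthogonal']
      simp
    have e2 : B (K.starProjection x) = (B - F) (K.starProjection x) := by
      have : F (K.starProjection x) = 0 := K.starProjection_apply_mem x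
      rw [_root_.sub_apply, this, sub_zero]
    rw [e]
    refine (h _).trans ?_
    rw [e2]
    refine ((B - F).le_opNorm _).trans ?_
    gcongr
    exact K.norm_starProjection_apply_le x

theorem norm_sqrt_apply_sq {T : H →L[ℂ] H} (hT : 0 ≤ T) (x : H) :
    ‖CFC.sqrt T x‖ ^ 2 = (⟪T x, x⟫_ℂ).re := by
  have h1 : CFC.sqrt T * CFC.sqrt T = T := CFC.sqrt_mul_sqrt_self T hT
  have h2 : star (CFC.sqrt T) = CFC.sqrt T := (CFC.sqrt_nonneg T).star_eq
  have h3 : T x = CFC.sqrt T (CFC.sqrt T x) := by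
    conv_lhs => rw [← h1]
    rfl
  rw [h3, ← ContinuousLinearMap.adjoint_inner_right, ← ContinuousLinearMap.star_eq_adjoint, h2,
    inner_self_eq_norm_sq_to_K]
  norm_cast

/-- Upper half of the min-max principle, without compactness. With `S` the square root of `T`, `Q`
the projection onto `V` and `P = 1 - Q`, the operator `S Q S` has rank at most `k`, and the error `T
- S Q S = (S P)(S P)^*` has norm `‖S P‖²`, which the form bound on `Vᗮ` controls. -/
theorem singularNumber_le_of_forall_orthogonal {T : H →L[ℂ] H} (hT : 0 ≤ T) (V : Submodule ℂ H)
    [V.HasOrthogonalProjection] {k : ℕ} (hV : Module.rank ℂ V ≤ k) {t : ℝ} (ht : 0 ≤ t)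
    (h : ∀ x ∈ Vᗮ, (⟪T x, x⟫_ℂ).re ≤ t * ‖x‖ ^ 2) : singularNumber T k ≤ t := by
  set S := CFC.sqrt T
  have h1 : S * S = T := CFC.sqrt_mul_sqrt_self T hT
  have h2 : star S = S := (CFC.sqrt_nonneg T).star_eq
  set Q := V.starProjection
  set P := Vᗮ.starProjection
  have hPQ : P = 1 - Q := V.starProjection_orthogonal'
  have hPs : star P = P := (isStarProjection_starProjection (U := Vᗮ)).isSelfAdjoint
  have hPP : P * P = P := (isStarProjection_starProjection (U := Vᗮ)).isIdempotentElem
  have e : T - S * Q * S = (S * P) * star (S * P) := by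
    rw [star_mul, hPs, h2, mul_assoc S P, ← mul_assoc P P S, hPP, hPQ, ← h1]
    noncomm_ring
  have hn : ‖S * P‖ ≤ √t := by
    refine ContinuousLinearMap.opNorm_le_bound _ (Real.sqrt_nonneg _) fun x => ?_
    refine le_of_sq_le_sq ?_ (by positivity)
    change ‖S (P x)‖ ^ 2 ≤ _
    rw [norm_sqrt_apply_sq hT, mul_pow, Real.sq_sqrt ht]
    refine (h _ (Vᗮ.starProjection_apply_mem x)).trans ?_
    gcongr
    exact Vᗮ.norm_starProjection_apply_le x
  refine (singularNumber_le (F := S * Q * S) ?_).trans ?_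
  · refine (LinearMap.rank_comp_le_left (S : H →ₗ[ℂ] H) ((S * Q : H →L[ℂ] H) : H →ₗ[ℂ] H)).trans ?_
    refine (LinearMap.rank_comp_le_right (Q : H →ₗ[ℂ] H) (S : H →ₗ[ℂ] H)).trans ?_
    rwa [rank_starProjection]
  · rw [e, CStarRing.norm_self_mul_star]
    calc ‖S * P‖ * ‖S * P‖ ≤ √t * √t := by gcongr
      _ = t := Real.mul_self_sqrt ht

/-- Lower half of the min-max principle: an operator of rank at most `k` kills a nonzero vector of
any `(k+1)`-dimensional space, and on that vector `T - F` coincides with `T`. -/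
theorem le_singularNumber_of_linearIndependent {T : H →L[ℂ] H} {k : ℕ} {e : Fin (k + 1) → H}
    (he : LinearIndependent ℂ e) {t : ℝ}
    (h : ∀ c : Fin (k + 1) → ℂ, t * ‖∑ i, c i • e i‖ ^ 2 ≤
      (⟪T (∑ i, c i • e i), ∑ i, c i • e i⟫_ℂ).re) : t ≤ singularNumber T k := by
  refine le_singularNumber fun F hF => ?_
  let L : (Fin (k + 1) → ℂ) →ₗ[ℂ] H := Fintype.linearCombination ℂ e
  obtain ⟨c, hc, hc0⟩ : ∃ c, F (L c) = 0 ∧ c ≠ 0 := by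
    by_contra! hcon
    have hinj : Function.Injective ((F : H →ₗ[ℂ] H).rangeRestrict ∘ₗ L) := by
      rw [← LinearMap.ker_eq_bot, LinearMap.ker_eq_bot']
      intro c hc
      exact hcon c (congrArg Subtype.val hc)
    have h1 := (LinearMap.rank_le_of_injective _ hinj).trans hF
    rw [rank_fun', Fintype.card_fin] at h1
    exact absurd (Nat.cast_le.1 h1) (by omega)
  have hx0 : L c ≠ 0 := fun h0 => hc0 (funext fun i =>
    Fintype.linearIndependent_iff.1 he c (by simpa [L, Fintype.linearCombination_apply] using h0) i)
  have h2 := h c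
  have e1 : ∑ i, c i • e i = L c := by simp [L, Fintype.linearCombination_apply]
  rw [e1] at h2
  have hp : 0 < ‖L c‖ ^ 2 := by positivity
  refine le_of_mul_le_mul_right (h2.trans ?_) hp
  have e2 : T (L c) = (T - F) (L c) := by rw [_root_.sub_apply, hc, sub_zero]
  rw [e2]
  calc (⟪(T - F) (L c), L c⟫_ℂ).re ≤ ‖⟪(T - F) (L c), L c⟫_ℂ‖ := Complex.re_le_norm _
    _ ≤ ‖(T - F) (L c)‖ * ‖L c‖ := norm_inner_le_norm _ _
    _ ≤ ‖T - F‖ * ‖L c‖ * ‖L c‖ := by gcongr; exact (T - F).le_opNorm _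
    _ = _ := by ring

end SingularNumber

/-! ### Ky Fan inequalities for sums of singular numbers -/

section KyFan

variable {H : Type} [NormedAddCommGroup H] [InnerProductSpace ℂ H] [CompleteSpace H]

/-- The sum of the first `N` singular numbers. -/
def singularSum (T : H →L[ℂ] H) (N : ℕ) : ℝ := ∑ k ∈ Finset.range N, singularNumber T k

theorem singularSum_mono (T : H →L[ℂ] H) : Monotone (singularSum T) := fun _ _ h =>
  Finset.sum_le_sum_of_subset_of_nonneg (Finset.range_mono h) fun _ _ _ => singularNumber_nonneg _ _

theorem singularSum_nonneg (T : H →L[ℂ] H) (N : ℕ) : 0 ≤ singularSum T N :=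
  Finset.sum_nonneg fun _ _ => singularNumber_nonneg _ _

/-- The compression of an operator to a finite dimensional subspace. -/
def compression (V : Submodule ℂ H) [FiniteDimensional ℂ V] (T : H →L[ℂ] H) : V →ₗ[ℂ] V :=
  (V.orthogonalProjectionOnto.comp (T.comp V.subtypeL) : V →L[ℂ] V)

theorem inner_compression (V : Submodule ℂ H) [FiniteDimensional ℂ V] (T : H →L[ℂ] H) (x y : V) :
    ⟪compression V T x, y⟫_ℂ = ⟪T x, (y : H)⟫_ℂ :=
  V.inner_orthogonalProjectionOnto_eq_of_mem_right y (T x)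

theorem compression_add (V : Submodule ℂ H) [FiniteDimensional ℂ V] (S T : H →L[ℂ] H) :
    compression V (S + T) = compression V S + compression V T := by
  ext x
  simp [compression]

theorem compression_isSymmetric (V : Submodule ℂ H) [FiniteDimensional ℂ V] {T : H →L[ℂ] H}
    (hT : 0 ≤ T) : (compression V T).IsSymmetric := by
  intro x y
  have hs := ((ContinuousLinearMap.nonneg_iff_isPositive T).1 hT).isSymmetric
  rw [inner_compression, ← inner_conj_symm x, inner_compression, inner_conj_symm]
  exact hs _ _

theorem compression_eigenvalues_nonneg (V : Submodule ℂ H) [FiniteDimensional ℂ V]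
    {T : H →L[ℂ] H} (hT : 0 ≤ T) (i : Fin (Module.finrank ℂ V)) :
    0 ≤ (compression_isSymmetric V hT).eigenvalues rfl i := by
  refine LinearMap.IsPositive.nonneg_eigenvalues ⟨compression_isSymmetric V hT, fun x => ?_⟩ rfl i
  rw [inner_compression]
  exact ((ContinuousLinearMap.nonneg_iff_isPositive T).1 hT).re_inner_nonneg_left _

theorem inner_compression_self_eq_sum (V : Submodule ℂ H) [FiniteDimensional ℂ V]
    {T : H →L[ℂ] H} (hT : 0 ≤ T) (x : V) :
    (⟪T x, (x : H)⟫_ℂ).re = ∑ i, (compression_isSymmetric V hT).eigenvalues rfl i *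
      ‖⟪(compression_isSymmetric V hT).eigenvectorBasis rfl i, x⟫_ℂ‖ ^ 2 := by
  set hS := compression_isSymmetric V hT
  set b := hS.eigenvectorBasis rfl
  rw [← inner_compression, ← b.sum_inner_mul_inner, Complex.re_sum]
  refine Finset.sum_congr rfl fun i _ => ?_
  rw [hS, hS.apply_eigenvectorBasis, inner_smul_right, mul_assoc, ← inner_conj_symm x,
    mul_comm ((starRingEnd ℂ) _), Complex.mul_conj, Complex.normSq_eq_norm_sq]
  exact (Complex.re_ofReal_mul _ _).trans (by rw [Complex.ofReal_re]; rfl)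

/-- Eigenvalues are listed in decreasing order from index `0`, so on the span of the first `i + 1`
eigenvectors the quadratic form is at least the `i`-th eigenvalue. The lower half of the min-max
principle applies to that span. -/
theorem compression_eigenvalues_le_singularNumber (V : Submodule ℂ H) [FiniteDimensional ℂ V]
    {T : H →L[ℂ] H} (hT : 0 ≤ T) (i : Fin (Module.finrank ℂ V)) :
    (compression_isSymmetric V hT).eigenvalues rfl i ≤ singularNumber T i := by
  set hS := compression_isSymmetric V hT
  set b := hS.eigenvectorBasis rfl with hb
  let f : Fin (i + 1) → Fin (Module.finrank ℂ V) := fun j => ⟨j, by omega⟩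
  have hf : Function.Injective f := fun j j' h => Fin.ext (by simpa [f] using h)
  have ho : Orthonormal ℂ (b ∘ f) := b.orthonormal.comp f hf
  refine le_singularNumber_of_linearIndependent (e := fun j => (b (f j) : H)) ?_ fun c => ?_
  · have : LinearIndependent ℂ (V.subtype ∘ (b ∘ f)) :=
      ho.linearIndependent.map' V.subtype V.ker_subtype
    exact this
  · have e : ∑ j, c j • (b (f j) : H) = ((∑ j, c j • (b ∘ f) j : V) : H) := by
      rw [Submodule.coe_sum]
      rfl
    rw [e, inner_compression_self_eq_sum V hT]
    set x : V := ∑ j, c j • (b ∘ f) j with hx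
    have hz : ∀ j, j ∉ Set.range f → ⟪b j, x⟫_ℂ = 0 := by
      intro j hj
      rw [hx, inner_sum]
      refine Finset.sum_eq_zero fun l _ => ?_
      rw [inner_smul_right, Function.comp_apply, b.orthonormal.inner_eq_zero, mul_zero]
      rintro rfl
      exact hj ⟨l, rfl⟩
    have hn : ‖(x : H)‖ ^ 2 = ∑ j, ‖⟪b j, x⟫_ℂ‖ ^ 2 := (b.sum_sq_norm_inner_right x).symm
    rw [hn, Finset.mul_sum]
    refine Finset.sum_le_sum fun j _ => ?_
    by_cases hj : j ∈ Set.range f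
    · obtain ⟨l, rfl⟩ := hj
      gcongr
      exact hS.eigenvalues_antitone rfl (Fin.le_def.2 (by simp only [f]; omega))
    · rw [← hb, hz j hj]
      simp

/-- The trace of the compression of `T` to a subspace is at most a sum of singular numbers. -/
theorem re_trace_compression_le (V : Submodule ℂ H) [FiniteDimensional ℂ V]
    {T : H →L[ℂ] H} (hT : 0 ≤ T) {N : ℕ} (hN : Module.finrank ℂ V ≤ N) :
    (LinearMap.trace ℂ V (compression V T)).re ≤ singularSum T N := by
  have h := (compression_isSymmetric V hT).re_trace_eq_sum_eigenvalues rfl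
  refine (h.le.trans ?_).trans (singularSum_mono T hN)
  rw [singularSum, Finset.sum_range]
  exact Finset.sum_le_sum fun i _ => compression_eigenvalues_le_singularNumber V hT i

/-- In the eigenbasis of the compression, the left side is a combination of the nonnegative
eigenvalues, and Bessel's inequality bounds each weight by `1`. -/
theorem sum_inner_le_re_trace_compression (V : Submodule ℂ H) [FiniteDimensional ℂ V]
    {T : H →L[ℂ] H} (hT : 0 ≤ T) {s : Finset H} (hs : Orthonormal ℂ (Subtype.val : s → H))
    (hV : ∀ x ∈ s, x ∈ V) :
    ∑ x ∈ s, (⟪T x, x⟫_ℂ).re ≤ (LinearMap.trace ℂ V (compression V T)).re := by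
  have h := (compression_isSymmetric V hT).re_trace_eq_sum_eigenvalues rfl
  refine le_of_le_of_eq ?_ h.symm
  let v : s → V := fun x => ⟨x, hV x x.2⟩
  have hv : Orthonormal ℂ v := ⟨fun x => hs.1 x, fun x y h => hs.2 h⟩
  rw [← Finset.sum_coe_sort]
  have h1 : ∀ x : s, (⟪T x, (x : H)⟫_ℂ).re = _ := fun x => inner_compression_self_eq_sum V hT (v x)
  rw [Finset.sum_congr rfl fun x _ => h1 x, Finset.sum_comm]
  refine Finset.sum_le_sum fun i _ => ?_
  rw [← Finset.mul_sum]
  refine mul_le_of_le_one_right (compression_eigenvalues_nonneg V hT i) ?_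
  set b := (compression_isSymmetric V hT).eigenvectorBasis rfl
  have hB := hv.sum_inner_products_le (b i) (s := Finset.univ)
  rw [b.orthonormal.1 i, one_pow] at hB
  refine le_of_eq_of_le (Finset.sum_congr rfl fun x _ => ?_) hB
  rw [norm_inner_symm]

/-- Greedy choice: the vectors already chosen span a space of dimension at most `N`, so the upper
half of the min-max principle provides a unit vector orthogonal to them at which the form exceeds
the `N`-th singular number minus `ε`. The loss `ε` replaces the eigenvectors that a noncompact `T`
need not have. -/
theorem exists_orthonormal_singularSum_le {T : H →L[ℂ] H} (hT : 0 ≤ T) {ε : ℝ} (hε : 0 < ε)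
    (N : ℕ) : ∃ s : Finset H, Orthonormal ℂ (Subtype.val : s → H) ∧ s.card ≤ N ∧
      singularSum T N ≤ ∑ x ∈ s, (⟪T x, x⟫_ℂ).re + N * ε := by
  classical
  induction N with
  | zero => exact ⟨∅, by simp, le_rfl, by simp [singularSum]⟩
  | succ N ih =>
    obtain ⟨s, hs, hc, hle⟩ := ih
    have hsum : singularSum T (N + 1) = singularSum T N + singularNumber T N :=
      Finset.sum_range_succ _ _
    -- A singular number below `ε` is absorbed in the error and no vector is added. Otherwise the
    -- threshold `singularNumber T N - ε` is nonnegative, as the min-max bound requires.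
    by_cases hsmall : singularNumber T N ≤ ε
    · refine ⟨s, hs, hc.trans N.le_succ, ?_⟩
      rw [hsum]
      push_cast
      linarith
    let V : Submodule ℂ H := Submodule.span ℂ (s : Set H)
    have hfin : FiniteDimensional ℂ V := FiniteDimensional.span_finset ℂ s
    have hrank : Module.rank ℂ V ≤ N :=
      (rank_span_finset_le s).trans (by exact_mod_cast hc)
    obtain ⟨x, hxV, hx⟩ : ∃ x ∈ Vᗮ, (singularNumber T N - ε) * ‖x‖ ^ 2 < (⟪T x, x⟫_ℂ).re := by
      by_contra! hcon
      have := singularNumber_le_of_forall_orthogonal hT V hrank (by linarith) hcon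
      linarith
    have hx0 : x ≠ 0 := by
      rintro rfl
      simp at hx
    have hxp : 0 < ‖x‖ := norm_pos_iff.2 hx0
    let y : H := ((‖x‖⁻¹ : ℝ) : ℂ) • x
    have hy1 : ‖y‖ = 1 := by
      rw [norm_smul, Complex.norm_real, norm_inv, norm_norm, inv_mul_cancel₀ hxp.ne']
    have hyV : y ∈ Vᗮ := Submodule.smul_mem _ _ hxV
    have hyT : (⟪T y, y⟫_ℂ).re = (⟪T x, x⟫_ℂ).re / ‖x‖ ^ 2 := by
      simp only [y, map_smul, inner_smul_left, inner_smul_right, Complex.conj_ofReal]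
      rw [Complex.re_ofReal_mul, Complex.re_ofReal_mul]
      field_simp
    have horth : ∀ z ∈ s, ⟪z, y⟫_ℂ = 0 := fun z hz =>
      (Submodule.mem_orthogonal _ _).1 hyV z (Submodule.subset_span hz)
    have hys : y ∉ s := by
      intro h
      have := inner_self_eq_zero.1 (horth y h)
      rw [this, norm_zero] at hy1
      exact zero_ne_one hy1
    refine ⟨insert y s, ?_, ?_, ?_⟩
    · refine ⟨?_, ?_⟩
      · rintro ⟨z, hz⟩
        rcases Finset.mem_insert.1 hz with rfl | hz
        · exact hy1
        · exact hs.1 ⟨z, hz⟩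
      · rintro ⟨z, hz⟩ ⟨w, hw⟩ hne
        have hne' : z ≠ w := fun h => hne (Subtype.ext h)
        change ⟪z, w⟫_ℂ = 0
        rcases Finset.mem_insert.1 hz with rfl | hz <;> rcases Finset.mem_insert.1 hw with rfl | hw
        · exact absurd rfl hne'
        · rw [← inner_conj_symm, horth w hw, map_zero]
        · exact horth z hz
        · exact hs.2 (i := ⟨z, hz⟩) (j := ⟨w, hw⟩) fun h => hne' (congrArg Subtype.val h)
    · rw [Finset.card_insert_of_notMem hys]
      omega
    · rw [Finset.sum_insert hys, hsum, hyT]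
      have : singularNumber T N - ε ≤ (⟪T x, x⟫_ℂ).re / ‖x‖ ^ 2 := by
        rw [le_div_iff₀ (by positivity)]
        exact hx.le
      push_cast
      linarith

theorem sum_inner_le_singularSum {T : H →L[ℂ] H} (hT : 0 ≤ T) {s : Finset H}
    (hs : Orthonormal ℂ (Subtype.val : s → H)) {N : ℕ} (hN : s.card ≤ N) :
    ∑ x ∈ s, (⟪T x, x⟫_ℂ).re ≤ singularSum T N := by
  let V : Submodule ℂ H := Submodule.span ℂ (s : Set H)
  have hfin : FiniteDimensional ℂ V := FiniteDimensional.span_finset ℂ s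
  exact (sum_inner_le_re_trace_compression V hT hs fun x hx => Submodule.subset_span hx).trans
    (re_trace_compression_le V hT ((finrank_span_finset_le_card s).trans hN))

/-- Ky Fan's inequality for positive operators. -/
theorem singularSum_add_le {A B : H →L[ℂ] H} (hA : 0 ≤ A) (hB : 0 ≤ B) (N : ℕ) :
    singularSum (A + B) N ≤ singularSum A N + singularSum B N := by
  refine le_of_forall_pos_le_add fun ε hε => ?_
  have hN : (0 : ℝ) < N + 1 := by positivity
  -- Vectors nearly optimal for `A + B` are merely admissible for `A` and for `B`. The tolerance `ε
  -- / (N + 1)` keeps the total error of `N` vectors below `ε`.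
  obtain ⟨s, hs, hc, hle⟩ := exists_orthonormal_singularSum_le (add_nonneg hA hB)
    (div_pos hε hN) N
  have h1 : N * (ε / (N + 1)) ≤ ε := by
    rw [← mul_div_assoc, div_le_iff₀ hN]
    nlinarith
  have h2 := sum_inner_le_singularSum hA hs hc
  have h3 := sum_inner_le_singularSum hB hs hc
  have h4 : ∑ x ∈ s, (⟪(A + B) x, x⟫_ℂ).re =
      ∑ x ∈ s, (⟪A x, x⟫_ℂ).re + ∑ x ∈ s, (⟪B x, x⟫_ℂ).re := by
    rw [← Finset.sum_add_distrib]
    exact Finset.sum_congr rfl fun x _ => by rw [_root_.add_apply, inner_add_left, Complex.add_re]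
  linarith

/-- The reverse inequality for sums of positive operators, with twice as many singular numbers. -/
theorem le_singularSum_add {A B : H →L[ℂ] H} (hA : 0 ≤ A) (hB : 0 ≤ B) (N : ℕ) :
    singularSum A N + singularSum B N ≤ singularSum (A + B) (2 * N) := by
  classical
  refine le_of_forall_pos_le_add fun ε hε => ?_
  have hN : (0 : ℝ) < 2 * (N + 1) := by positivity
  obtain ⟨s, hs, hsc, hsle⟩ := exists_orthonormal_singularSum_le hA (div_pos hε hN) N
  obtain ⟨t, ht, htc, htle⟩ := exists_orthonormal_singularSum_le hB (div_pos hε hN) N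
  have h1 : N * (ε / (2 * (N + 1))) ≤ ε / 2 := by
    rw [← mul_div_assoc, div_le_iff₀ hN]
    nlinarith
  -- The near-optimal systems for `A` and `B` differ. Both lie in this common space of dimension at
  -- most `2 N`, where the trace of the compression is additive.
  let V : Submodule ℂ H := Submodule.span ℂ ((s ∪ t : Finset H) : Set H)
  have hfin : FiniteDimensional ℂ V := FiniteDimensional.span_finset ℂ _
  have h2 := sum_inner_le_re_trace_compression V hA hs fun x hx =>
    Submodule.subset_span (Finset.mem_coe.2 (Finset.mem_union_left _ hx))
  have h3 := sum_inner_le_re_trace_compression V hB ht fun x hx =>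
    Submodule.subset_span (Finset.mem_coe.2 (Finset.mem_union_right _ hx))
  have h4 := re_trace_compression_le V (add_nonneg hA hB) (N := 2 * N)
    ((finrank_span_finset_le_card _).trans ((Finset.card_union_le _ _).trans (by omega)))
  rw [compression_add, map_add, Complex.add_re] at h4
  linarith

end KyFan

/-! ### Order properties of generalized limits -/

namespace DixmierLimit

variable (ω : DixmierLimit)

theorem mono {f g : lp (fun _ : ℕ => ℝ) ∞} (h : ∀ i, f i ≤ g i) : ω.toFun f ≤ ω.toFun g := by
  have := ω.nonneg (g - f) fun i => sub_nonneg.2 (h i)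
  rwa [map_sub, sub_nonneg] at this

theorem congr_of_tendsto {f g : lp (fun _ : ℕ => ℝ) ∞}
    (h : Tendsto (fun i => f i - g i) atTop (𝓝 0)) : ω.toFun f = ω.toFun g := by
  have := ω.eq_lim (f - g) 0 h
  rwa [map_sub, sub_eq_zero] at this

theorem memℓp_of_le {f : ℕ → ℝ} {C : ℝ} (h0 : ∀ i, 0 ≤ f i) (h : ∀ i, f i ≤ C) :
    Memℓp (E := fun _ : ℕ => ℝ) f ∞ := by
  rw [memℓp_infty_iff]
  refine ⟨C, ?_⟩
  rintro _ ⟨i, rfl⟩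
  change ‖f i‖ ≤ C
  rw [Real.norm_of_nonneg (h0 i)]
  exact h i

/-- Positivity compares sequences at all indices. Replacing `f` by `max f C` only increases it and
makes it eventually equal to `C`, hence convergent to `C`. -/
theorem toFun_le {f : lp (fun _ : ℕ => ℝ) ∞} {C : ℝ} (h : ∀ᶠ i in atTop, f i ≤ C) :
    ω.toFun f ≤ C := by
  let m : ℕ → ℝ := fun i => max (f i) C
  obtain ⟨B, hB⟩ := memℓp_infty_iff.1 f.2
  have hm : Memℓp (E := fun _ : ℕ => ℝ) m ∞ := by
    rw [memℓp_infty_iff]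
    refine ⟨B + |C|, ?_⟩
    rintro _ ⟨i, rfl⟩
    have h1 : |f i| ≤ B := hB ⟨i, rfl⟩
    change |max (f i) C| ≤ _
    have h2 := abs_max_le_max_abs_abs (a := f i) (b := C)
    have h3 := abs_nonneg (f i)
    have h4 := abs_nonneg C
    exact h2.trans (max_le (by linarith) (by linarith))
  have h1 : ω.toFun f ≤ ω.toFun ⟨m, hm⟩ := ω.mono fun i => le_max_left _ _
  refine h1.trans_eq (ω.eq_lim _ C ?_)
  refine tendsto_const_nhds.congr' ?_
  filter_upwards [h] with i hi
  exact (max_eq_right hi).symm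

theorem le_toFun {f : lp (fun _ : ℕ => ℝ) ∞} {C : ℝ} (h : ∀ᶠ i in atTop, C ≤ f i) :
    C ≤ ω.toFun f := by
  have := ω.toFun_le (f := -f) (C := -C) (h.mono fun i hi => neg_le_neg hi)
  rwa [map_neg, neg_le_neg_iff] at this

end DixmierLimit

/-! ### The weak trace class and additivity of the Dixmier trace on its positive operators -/

section SingularBound

variable {H : Type} [NormedAddCommGroup H] [InnerProductSpace ℂ H] [CompleteSpace H]

/-- The operator `T` belongs to the weak trace class, with quasinorm at most `C`. -/
def SingularBound (T : H →L[ℂ] H) (C : ℝ) : Prop :=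
  ∀ k : ℕ, (k + 1) * singularNumber T k ≤ C

variable {S T : H →L[ℂ] H} {C C' : ℝ}

theorem SingularBound.nonneg (h : SingularBound T C) : 0 ≤ C :=
  (mul_nonneg (by positivity) (singularNumber_nonneg T 0)).trans (h 0)

theorem SingularBound.singularNumber_le (h : SingularBound T C) (k : ℕ) :
    singularNumber T k ≤ C := by
  refine le_trans ?_ (h k)
  have := singularNumber_nonneg T k
  have hk : (0 : ℝ) ≤ k := Nat.cast_nonneg k
  nlinarith

/-- Both terms are taken at index `k / 2`, and `k + 1 ≤ 2 (k / 2 + 1)` costs the factor `2`; the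
bound is only a quasinorm. -/
theorem SingularBound.add (hS : SingularBound S C) (hT : SingularBound T C') :
    SingularBound (S + T) (2 * (C + C')) := by
  intro k
  have h1 : singularNumber (S + T) k ≤ singularNumber S (k / 2) + singularNumber T (k / 2) :=
    (singularNumber_antitone _ (by omega : k / 2 + k / 2 ≤ k)).trans
      (singularNumber_add_le S T (k / 2) (k / 2))
  have h2 : (k + 1 : ℝ) ≤ 2 * ((k / 2 : ℕ) + 1) := by
    have : k + 1 ≤ 2 * (k / 2 + 1) := by omega
    exact_mod_cast this
  calc (k + 1 : ℝ) * singularNumber (S + T) k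
      ≤ 2 * ((k / 2 : ℕ) + 1) * (singularNumber S (k / 2) + singularNumber T (k / 2)) := by
        gcongr
        exact singularNumber_nonneg _ _
    _ = 2 * (((k / 2 : ℕ) + 1) * singularNumber S (k / 2) +
          ((k / 2 : ℕ) + 1) * singularNumber T (k / 2)) := by ring
    _ ≤ _ := by gcongr; exacts [hS _, hT _]

theorem SingularBound.smul (hT : SingularBound T C) (c : ℂ) :
    SingularBound (c • T) (‖c‖ * C) := fun k => by
  rw [singularNumber_smul, mul_left_comm]
  exact mul_le_mul_of_nonneg_left (hT k) (norm_nonneg _)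

theorem SingularBound.of_singularNumber_le (hT : SingularBound T C)
    (h : ∀ k, singularNumber S k ≤ singularNumber T k) : SingularBound S C := fun k =>
  (mul_le_mul_of_nonneg_left (h k) (by positivity)).trans (hT k)

theorem SingularBound.mul_left (hT : SingularBound T C) (X : H →L[ℂ] H) :
    SingularBound (X * T) (‖X‖ * C) := fun k => by
  refine (mul_le_mul_of_nonneg_left (singularNumber_mul_left_le X T k) (by positivity)).trans ?_
  rw [mul_left_comm]
  exact mul_le_mul_of_nonneg_left (hT k) (norm_nonneg _)

/-- The range of the adjoint lies in the orthogonal complement of `ker F`, on which `F` is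
injective. -/
theorem rank_star_le (F : H →L[ℂ] H) :
    LinearMap.rank ((star F : H →L[ℂ] H) : H →ₗ[ℂ] H) ≤ LinearMap.rank (F : H →ₗ[ℂ] H) := by
  refine le_trans ?_ (rank_orthogonal_ker_le F)
  refine Submodule.rank_mono ?_
  rintro _ ⟨y, rfl⟩
  rw [Submodule.mem_orthogonal]
  intro x hx
  have hx' : F x = 0 := hx
  change ⟪x, (star F : H →L[ℂ] H) y⟫_ℂ = 0
  rw [ContinuousLinearMap.star_eq_adjoint, ContinuousLinearMap.adjoint_inner_right, hx',
    inner_zero_left]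

theorem singularNumber_star_le (T : H →L[ℂ] H) (k : ℕ) :
    singularNumber (star T) k ≤ singularNumber T k := by
  refine le_singularNumber fun F hF => ?_
  refine (_root_.singularNumber_le (F := star F) ((rank_star_le F).trans hF)).trans_eq ?_
  rw [← star_sub, norm_star]

theorem SingularBound.star (hT : SingularBound T C) : SingularBound (star T) C :=
  hT.of_singularNumber_le (singularNumber_star_le T)

theorem SingularBound.realPart (hT : SingularBound T C) :
    SingularBound (realPart T : H →L[ℂ] H) (2 * C) := by
  have h := (hT.add hT.star).smul (2⁻¹ : ℂ)
  have e : (_root_.realPart T : H →L[ℂ] H) = (2⁻¹ : ℂ) • (T + Star.star T) := by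
    rw [realPart_apply_coe, ← Complex.coe_smul]
    push_cast
    rfl
  rw [e]
  refine fun k => (h k).trans_eq ?_
  rw [norm_inv, Complex.norm_ofNat]
  ring

/-- The product of the positive and negative parts is zero, so their values at `x` are orthogonal.
Consequently each part is dominated pointwise in norm by `A`, and the singular numbers of the parts
are dominated as well. -/
theorem norm_sq_eq_posPart_add_negPart {A : H →L[ℂ] H} (hA : IsSelfAdjoint A) (x : H) :
    ‖A x‖ ^ 2 = ‖(A⁺ : H →L[ℂ] H) x‖ ^ 2 + ‖(A⁻ : H →L[ℂ] H) x‖ ^ 2 := by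
  have h1 : A x = (A⁺ : H →L[ℂ] H) x - (A⁻ : H →L[ℂ] H) x := by
    conv_lhs => rw [← CFC.posPart_sub_negPart A hA]
    rfl
  have h2 : ⟪(A⁺ : H →L[ℂ] H) x, (A⁻ : H →L[ℂ] H) x⟫_ℂ = 0 := by
    have h3 : star (A⁺ : H →L[ℂ] H) = A⁺ := (CFC.posPart_nonneg A).star_eq
    rw [← h3, ContinuousLinearMap.star_eq_adjoint, ContinuousLinearMap.adjoint_inner_left]
    have h4 : (A⁺ : H →L[ℂ] H) ((A⁻ : H →L[ℂ] H) x) = 0 :=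
      congrArg (fun B : H →L[ℂ] H => B x) (CFC.posPart_mul_negPart A)
    rw [h4, inner_zero_right]
  rw [h1, norm_sub_sq (𝕜 := ℂ), h2]
  simp

theorem SingularBound.posPart {A : H →L[ℂ] H} (hA : IsSelfAdjoint A) (h : SingularBound A C) :
    SingularBound (A⁺) C :=
  h.of_singularNumber_le (singularNumber_le_of_norm_apply_le fun x => by
    have := norm_sq_eq_posPart_add_negPart hA x
    refine le_of_sq_le_sq ?_ (norm_nonneg _)
    nlinarith [sq_nonneg ‖(A⁻ : H →L[ℂ] H) x‖])

theorem SingularBound.negPart {A : H →L[ℂ] H} (hA : IsSelfAdjoint A) (h : SingularBound A C) :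
    SingularBound (A⁻) C :=
  h.of_singularNumber_le (singularNumber_le_of_norm_apply_le fun x => by
    have := norm_sq_eq_posPart_add_negPart hA x
    refine le_of_sq_le_sq ?_ (norm_nonneg _)
    nlinarith [sq_nonneg ‖(A⁺ : H →L[ℂ] H) x‖])

theorem SingularBound.singularSum_le (hT : SingularBound T C) (N : ℕ) :
    singularSum T N ≤ C * (1 + Real.log N) := by
  have h1 : singularSum T N ≤ C * (harmonic N : ℝ) := by
    rw [singularSum, harmonic]
    push_cast
    rw [Finset.mul_sum]
    refine Finset.sum_le_sum fun k _ => ?_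
    rw [← div_eq_mul_inv, le_div_iff₀' (by positivity)]
    exact hT k
  exact h1.trans (mul_le_mul_of_nonneg_left (harmonic_le_one_add_log N) hT.nonneg)

theorem dixmierSeq_eq (T : H →L[ℂ] H) (i : ℕ) :
    dixmierSeq T i = singularSum T (i + 1) / Real.log (i + 1 : ℝ) := rfl

theorem log_nat_add_one_nonneg (i : ℕ) : 0 ≤ Real.log (i + 1 : ℝ) :=
  Real.log_nonneg (by have : (0 : ℝ) ≤ i := i.cast_nonneg; linarith)

theorem dixmierSeq_nonneg (T : H →L[ℂ] H) (i : ℕ) : 0 ≤ dixmierSeq T i :=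
  div_nonneg (singularSum_nonneg _ _) (log_nat_add_one_nonneg i)

theorem half_le_log_nat_add_one {i : ℕ} (hi : 1 ≤ i) : 1 / 2 ≤ Real.log (i + 1 : ℝ) := by
  have h1 : (1 : ℝ) ≤ i := by exact_mod_cast hi
  have h2 : Real.log 2 ≤ Real.log (i + 1 : ℝ) := Real.log_le_log (by norm_num) (by linarith)
  have := Real.log_two_gt_d9
  linarith

/-- At index `0` the denominator is `log 1 = 0` and the term is `0` by the convention for division.
From index `1` on the logarithm is at least `1 / 2`, so `1 + log` is at most `3 log`. -/
theorem SingularBound.dixmierSeq_le (hT : SingularBound T C) (i : ℕ) :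
    dixmierSeq T i ≤ 3 * C := by
  have hC := hT.nonneg
  rcases Nat.eq_zero_or_pos i with rfl | hi
  · rw [dixmierSeq_eq]
    simpa using hC
  · have h1 := half_le_log_nat_add_one hi
    have h2 := hT.singularSum_le (i + 1)
    push_cast at h2
    rw [dixmierSeq_eq, div_le_iff₀ (by linarith)]
    nlinarith

theorem SingularBound.memℓp (hT : SingularBound T C) :
    Memℓp (E := fun _ : ℕ => ℝ) (dixmierSeq T) ∞ :=
  DixmierLimit.memℓp_of_le (dixmierSeq_nonneg T) hT.dixmierSeq_le

theorem SingularBound.dixmierPos_eq (hT : SingularBound T C) (ω : DixmierLimit) :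
    dixmierPos ω T = ω.toFun ⟨dixmierSeq T, hT.memℓp⟩ := dif_pos hT.memℓp

theorem SingularBound.dixmierPos_le (hT : SingularBound T C) (ω : DixmierLimit) :
    dixmierPos ω T ≤ 3 * C := by
  rw [hT.dixmierPos_eq ω]
  exact ω.toFun_le (Eventually.of_forall hT.dixmierSeq_le)

theorem SingularBound.dixmierPos_nonneg (hT : SingularBound T C) (ω : DixmierLimit) :
    0 ≤ dixmierPos ω T := by
  rw [hT.dixmierPos_eq ω]
  exact ω.nonneg _ (dixmierSeq_nonneg T)

theorem dixmierPos_congr (ω : DixmierLimit) (h : ∀ k, singularNumber S k = singularNumber T k) :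
    dixmierPos ω S = dixmierPos ω T := by
  have : dixmierSeq S = dixmierSeq T := by
    funext i
    rw [dixmierSeq, dixmierSeq]
    simp only [h]
  rw [dixmierPos, dixmierPos]
  generalize dixmierSeq S = f at this ⊢
  subst this
  rfl

theorem SingularBound.dixmierPos_smul (hT : SingularBound T C) (ω : DixmierLimit) {r : ℝ}
    (hr : 0 ≤ r) : dixmierPos ω (r • T) = r * dixmierPos ω T := by
  have e : r • T = (r : ℂ) • T := (Complex.coe_smul r T).symm
  rw [e, (hT.smul (r : ℂ)).dixmierPos_eq ω, hT.dixmierPos_eq ω]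
  refine Eq.trans ?_ (ω.toFun.map_smul r ⟨dixmierSeq T, hT.memℓp⟩)
  congr 1
  ext i
  change dixmierSeq ((r : ℂ) • T) i = r * dixmierSeq T i
  rw [dixmierSeq, dixmierSeq, ← mul_div_assoc, Finset.mul_sum]
  simp only [singularNumber_smul, Complex.norm_real, Real.norm_of_nonneg hr]

/-- Dilating the partial sums by a factor two does not change a Dixmier limit. -/
theorem SingularBound.dixmierPos_eq_dilated (hT : SingularBound T C) (ω : DixmierLimit) :
    ∃ u : lp (fun _ : ℕ => ℝ) ∞, (∀ i : ℕ, u i = singularSum T (2 * (i + 1)) / Real.log (i + 1 : ℝ)) ∧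
      dixmierPos ω T = ω.toFun u := by
  have hC := hT.nonneg
  let f : ℕ → ℝ := fun i => singularSum T (2 * (i + 1)) / Real.log (i + 1 : ℝ)
  have hf0 : ∀ i, 0 ≤ f i := fun i => div_nonneg (singularSum_nonneg _ _) (log_nat_add_one_nonneg i)
  -- The numerator is at most `C (1 + log 2 + log (i + 1))`. With the logarithm at least `1 / 2`,
  -- the quotient is at most `C (1 + 2 (1 + log 2))`, which is below `5 C`.
  have hf1 : ∀ i, f i ≤ 5 * C := by
    intro i
    rcases Nat.eq_zero_or_pos i with rfl | hi
    · simpa [f] using hC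
    · have h1 := half_le_log_nat_add_one hi
      have h2 := hT.singularSum_le (2 * (i + 1))
      push_cast at h2
      rw [Real.log_mul (by norm_num) (by positivity)] at h2
      have h3 := Real.log_two_lt_d9
      rw [div_le_iff₀ (by linarith)]
      nlinarith
  refine ⟨⟨f, DixmierLimit.memℓp_of_le hf0 hf1⟩, fun _ => rfl, ?_⟩
  let v : lp (fun _ : ℕ => ℝ) ∞ :=
    ⟨fun i => f (i / 2), DixmierLimit.memℓp_of_le (fun i => hf0 _) (fun i => hf1 _)⟩
  -- Invariance of `ω` replaces `f` by `i ↦ f (i / 2)`, whose numerators are singular sums of length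
  -- `i + 1` or `i + 2`. It remains to see that this sequence is asymptotic to `dixmierSeq T`.
  rw [← ω.dilation ⟨f, DixmierLimit.memℓp_of_le hf0 hf1⟩ v (fun _ => rfl), hT.dixmierPos_eq ω]
  refine ω.congr_of_tendsto ?_
  -- The numerators differ by at most one singular number, hence by `C`. The logarithms differ by at
  -- most `log 2`, which is multiplied by a term of size at most `3 C`. Finally `1 + 3 log 2 < 4`.
  have hlim : Tendsto (fun i : ℕ => 4 * C / Real.log ((i / 2 : ℕ) + 1 : ℝ)) atTop (𝓝 0) := by
    refine Tendsto.const_div_atTop (Real.tendsto_log_atTop.comp ?_) _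
    refine tendsto_atTop_add_const_right _ _ (tendsto_natCast_atTop_atTop.comp ?_)
    exact Nat.tendsto_div_const_atTop two_ne_zero
  refine squeeze_zero_norm' ?_ hlim
  filter_upwards [eventually_ge_atTop 2] with i hi
  change ‖dixmierSeq T i - f (i / 2)‖ ≤ _
  set M : ℝ := (i / 2 : ℕ) + 1 with hM
  have hi2 : 1 ≤ i / 2 := by omega
  have hlogM : 1 / 2 ≤ Real.log M := half_le_log_nat_add_one hi2
  have hlogi : 1 / 2 ≤ Real.log (i + 1 : ℝ) := half_le_log_nat_add_one (by omega)
  have hM2 : (i + 1 : ℝ) ≤ 2 * M := by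
    have : i + 1 ≤ 2 * (i / 2 + 1) := by omega
    rw [hM]
    exact_mod_cast this
  have hMi : M ≤ i + 1 := by
    have : i / 2 + 1 ≤ i + 1 := by omega
    rw [hM]
    exact_mod_cast this
  have hMpos : 0 < M := by positivity
  have hl1 : Real.log (i + 1 : ℝ) ≤ Real.log 2 + Real.log M := by
    rw [← Real.log_mul (by norm_num) hMpos.ne']
    exact Real.log_le_log (by positivity) hM2
  have hl2 : Real.log M ≤ Real.log (i + 1 : ℝ) := Real.log_le_log hMpos hMi
  have hs1 : singularSum T (i + 1) ≤ singularSum T (2 * (i / 2 + 1)) :=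
    singularSum_mono T (by omega)
  have hs2 : singularSum T (2 * (i / 2 + 1)) ≤ singularSum T (i + 1) + C := by
    refine (singularSum_mono T (by omega : 2 * (i / 2 + 1) ≤ i + 1 + 1)).trans ?_
    rw [singularSum, Finset.sum_range_succ]
    exact add_le_add le_rfl (hT.singularNumber_le _)
  have hd := hT.dixmierSeq_le i
  have hd0 := dixmierSeq_nonneg T i
  have hde : dixmierSeq T i * Real.log (i + 1 : ℝ) = singularSum T (i + 1) := by
    rw [dixmierSeq_eq, div_mul_cancel₀]
    linarith
  have hfe : f (i / 2) = singularSum T (2 * (i / 2 + 1)) / Real.log M := rfl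
  have hlog2 := Real.log_two_lt_d9
  have hMp : 0 < Real.log M := by linarith
  rw [Real.norm_eq_abs, abs_sub_comm, abs_of_nonneg, hfe, sub_le_iff_le_add, div_add' _ _ _ hMp.ne']
  · gcongr
    nlinarith
  · rw [hfe, sub_nonneg, le_div_iff₀ hMp]
    nlinarith

theorem dixmierPos_add {A B : H →L[ℂ] H} (hA : 0 ≤ A) (hB : 0 ≤ B) (bA : SingularBound A C)
    (bB : SingularBound B C') (ω : DixmierLimit) :
    dixmierPos ω (A + B) = dixmierPos ω A + dixmierPos ω B := by
  have bAB := bA.add bB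
  refine le_antisymm ?_ ?_
  · rw [bAB.dixmierPos_eq, bA.dixmierPos_eq, bB.dixmierPos_eq, ← map_add]
    refine ω.mono fun i => ?_
    change dixmierSeq (A + B) i ≤ dixmierSeq A i + dixmierSeq B i
    rw [dixmierSeq_eq, dixmierSeq_eq, dixmierSeq_eq, ← add_div]
    exact div_le_div_of_nonneg_right (singularSum_add_le hA hB _) (log_nat_add_one_nonneg i)
  -- The reverse Ky Fan inequality needs `2 (i + 1)` singular numbers of `A + B`; the dilated
  -- sequence computes the same limit with exactly that many.
  · obtain ⟨u, hu, e⟩ := bAB.dixmierPos_eq_dilated ω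
    rw [e, bA.dixmierPos_eq, bB.dixmierPos_eq, ← map_add]
    refine ω.mono fun i => ?_
    change dixmierSeq A i + dixmierSeq B i ≤ u i
    rw [hu, dixmierSeq_eq, dixmierSeq_eq, ← add_div]
    exact div_le_div_of_nonneg_right (le_singularSum_add hA hB _) (log_nat_add_one_nonneg i)

end SingularBound

/-! ### Linearity, boundedness and unitary invariance of the Dixmier trace -/

section DixmierTrace

variable {H : Type} [NormedAddCommGroup H] [InnerProductSpace ℂ H] [CompleteSpace H]
  {S T : H →L[ℂ] H} {C C' : ℝ} (ω : DixmierLimit)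

/-- The Dixmier trace of a self-adjoint operator. -/
def dixmierSelfAdjoint (A : H →L[ℂ] H) : ℝ := dixmierPos ω (A⁺) - dixmierPos ω (A⁻)

theorem dixmierSelfAdjoint_neg (A : H →L[ℂ] H) :
    dixmierSelfAdjoint ω (-A) = -dixmierSelfAdjoint ω A := by
  rw [dixmierSelfAdjoint, dixmierSelfAdjoint, CFC.posPart_neg, CFC.negPart_neg, neg_sub]

theorem dixmierSelfAdjoint_add {A B : H →L[ℂ] H} (hA : IsSelfAdjoint A) (hB : IsSelfAdjoint B)
    (bA : SingularBound A C) (bB : SingularBound B C') :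
    dixmierSelfAdjoint ω (A + B) = dixmierSelfAdjoint ω A + dixmierSelfAdjoint ω B := by
  have hAB := hA.add hB
  have bAB := bA.add bB
  have pA := CFC.posPart_nonneg A
  have nA := CFC.negPart_nonneg A
  have pB := CFC.posPart_nonneg B
  have nB := CFC.negPart_nonneg B
  have pAB := CFC.posPart_nonneg (A + B)
  have nAB := CFC.negPart_nonneg (A + B)
  -- The two decompositions of `A + B` into differences of positive operators, rearranged so that
  -- only sums of positive operators occur and additivity on these applies.
  have e : (A + B)⁺ + (A⁻ + B⁻) = (A + B)⁻ + (A⁺ + B⁺) := by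
    have e1 := CFC.posPart_sub_negPart A hA
    have e2 := CFC.posPart_sub_negPart B hB
    have e3 := CFC.posPart_sub_negPart (A + B) hAB
    rw [← sub_eq_zero]
    calc _ = ((A + B)⁺ - (A + B)⁻) - (A⁺ - A⁻) - (B⁺ - B⁻) := by abel
      _ = 0 := by rw [e1, e2, e3]; abel
  have h := congrArg (dixmierPos ω) e
  rw [dixmierPos_add pAB (add_nonneg nA nB) (bAB.posPart hAB)
      ((bA.negPart hA).add (bB.negPart hB)),
    dixmierPos_add nA nB (bA.negPart hA) (bB.negPart hB),
    dixmierPos_add nAB (add_nonneg pA pB) (bAB.negPart hAB)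
      ((bA.posPart hA).add (bB.posPart hB)),
    dixmierPos_add pA pB (bA.posPart hA) (bB.posPart hB)] at h
  rw [dixmierSelfAdjoint, dixmierSelfAdjoint, dixmierSelfAdjoint]
  linarith

theorem dixmierSelfAdjoint_smul {A : H →L[ℂ] H} (hA : IsSelfAdjoint A) (bA : SingularBound A C)
    (r : ℝ) : dixmierSelfAdjoint ω (r • A) = r * dixmierSelfAdjoint ω A := by
  have key : ∀ r : ℝ, 0 ≤ r → dixmierSelfAdjoint ω (r • A) = r * dixmierSelfAdjoint ω A := by
    intro r hr
    rw [dixmierSelfAdjoint, dixmierSelfAdjoint, CFC.posPart_smul_of_nonneg hr,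
      CFC.negPart_smul_of_nonneg hr, (bA.posPart hA).dixmierPos_smul ω hr,
      (bA.negPart hA).dixmierPos_smul ω hr, mul_sub]
  rcases le_total 0 r with hr | hr
  · exact key r hr
  · have h := key (-r) (neg_nonneg.2 hr)
    rw [neg_smul, dixmierSelfAdjoint_neg] at h
    linarith

theorem abs_dixmierSelfAdjoint_le {A : H →L[ℂ] H} (hA : IsSelfAdjoint A)
    (bA : SingularBound A C) : |dixmierSelfAdjoint ω A| ≤ 3 * C := by
  have h1 := (bA.posPart hA).dixmierPos_le ω
  have h2 := (bA.posPart hA).dixmierPos_nonneg ω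
  have h3 := (bA.negPart hA).dixmierPos_le ω
  have h4 := (bA.negPart hA).dixmierPos_nonneg ω
  rw [dixmierSelfAdjoint, abs_le]
  constructor <;> linarith

/-- The real part of the Dixmier trace. -/
def dixmierRe (T : H →L[ℂ] H) : ℝ := dixmierSelfAdjoint ω (realPart T : H →L[ℂ] H)

/-- The imaginary part of `T` is minus the real part of `iT`. Complex linearity thus reduces to real
linearity of the single functional `dixmierRe`. -/
theorem dixmierTrace_eq (T : H →L[ℂ] H) :
    dixmierTrace ω T = dixmierRe ω T - Complex.I * dixmierRe ω (Complex.I • T) := by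
  have h : dixmierRe ω (Complex.I • T) =
      -dixmierSelfAdjoint ω (imaginaryPart T : H →L[ℂ] H) := by
    rw [dixmierRe, realPart_I_smul, ← dixmierSelfAdjoint_neg]
    rfl
  rw [h]
  push_cast
  rw [mul_neg, sub_neg_eq_add]
  rfl

theorem dixmierRe_add (bS : SingularBound S C) (bT : SingularBound T C') :
    dixmierRe ω (S + T) = dixmierRe ω S + dixmierRe ω T := by
  rw [dixmierRe, map_add]
  exact dixmierSelfAdjoint_add ω (realPart S).2 (realPart T).2 bS.realPart bT.realPart

theorem dixmierRe_smul (bT : SingularBound T C) (r : ℝ) :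
    dixmierRe ω ((r : ℂ) • T) = r * dixmierRe ω T := by
  rw [dixmierRe, Complex.coe_smul, map_smul]
  exact dixmierSelfAdjoint_smul ω (realPart T).2 bT.realPart r

theorem dixmierTrace_add (bS : SingularBound S C) (bT : SingularBound T C') :
    dixmierTrace ω (S + T) = dixmierTrace ω S + dixmierTrace ω T := by
  rw [dixmierTrace_eq, dixmierTrace_eq, dixmierTrace_eq, smul_add, dixmierRe_add ω bS bT,
    dixmierRe_add ω (bS.smul _) (bT.smul _)]
  push_cast
  ring

theorem dixmierTrace_smul (bT : SingularBound T C) (c : ℂ) :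
    dixmierTrace ω (c • T) = c * dixmierTrace ω T := by
  have hr : ∀ (r : ℝ) {S : H →L[ℂ] H} {C : ℝ}, SingularBound S C →
      dixmierTrace ω ((r : ℂ) • S) = r * dixmierTrace ω S := by
    intro r S C bS
    rw [dixmierTrace_eq, dixmierTrace_eq, smul_comm Complex.I, dixmierRe_smul ω bS,
      dixmierRe_smul ω (bS.smul _)]
    push_cast
    ring
  have hI : dixmierTrace ω (Complex.I • T) = Complex.I * dixmierTrace ω T := by
    have h1 : dixmierRe ω (Complex.I • Complex.I • T) = -dixmierRe ω T := by
      have := dixmierRe_smul ω bT (-1)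
      rw [smul_smul, Complex.I_mul_I]
      push_cast at this
      rw [this]
      ring
    rw [dixmierTrace_eq, dixmierTrace_eq, h1]
    push_cast
    linear_combination (dixmierRe ω (Complex.I • T) : ℂ) * Complex.I_mul_I
  have hc : c • T = (c.re : ℂ) • T + (c.im : ℂ) • Complex.I • T := by
    rw [smul_smul, ← add_smul, Complex.re_add_im]
  rw [hc, dixmierTrace_add ω (bT.smul _) ((bT.smul _).smul _), hr _ bT, hr _ (bT.smul _), hI]
  linear_combination dixmierTrace ω T * Complex.re_add_im c

/-- Each of the two self-adjoint parts has weak trace class bound `2 C` and contributes at most `3 ·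
2 C`. -/
theorem norm_dixmierTrace_le (bT : SingularBound T C) : ‖dixmierTrace ω T‖ ≤ 12 * C := by
  have h1 := abs_dixmierSelfAdjoint_le ω (realPart T).2 bT.realPart
  have h2 := abs_dixmierSelfAdjoint_le ω (realPart (Complex.I • T)).2
    (bT.smul Complex.I).realPart
  rw [Complex.norm_I, one_mul] at h2
  rw [dixmierTrace_eq]
  refine (norm_sub_le _ _).trans ?_
  rw [norm_mul, Complex.norm_I, one_mul, Complex.norm_real, Complex.norm_real]
  exact (add_le_add h1 h2).trans_eq (by ring)

theorem norm_le_one_of_star_mul_self {u : H →L[ℂ] H} (h : star u * u = 1) : ‖u‖ ≤ 1 := by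
  have h1 : ‖u‖ * ‖u‖ ≤ 1 := by
    rw [← CStarRing.norm_star_mul_self, h]
    exact ContinuousLinearMap.norm_id_le
  nlinarith [norm_nonneg u]

theorem singularNumber_conj {u : H →L[ℂ] H} (h1 : star u * u = 1) (h2 : u * star u = 1)
    (T : H →L[ℂ] H) (k : ℕ) : singularNumber (u * T * star u) k = singularNumber T k := by
  have key : ∀ (v : H →L[ℂ] H) (T : H →L[ℂ] H), star v * v = 1 →
      singularNumber (v * T * star v) k ≤ singularNumber T k := by
    intro v T hv
    have hn := norm_le_one_of_star_mul_self hv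
    calc singularNumber (v * T * star v) k ≤ singularNumber (v * T) k * ‖star v‖ :=
          singularNumber_mul_right_le _ _ _
      _ ≤ singularNumber (v * T) k * 1 := by
          gcongr
          · exact singularNumber_nonneg _ _
          · rwa [norm_star]
      _ ≤ ‖v‖ * singularNumber T k := by rw [mul_one]; exact singularNumber_mul_left_le _ _ _
      _ ≤ 1 * singularNumber T k := by
          gcongr
          exact singularNumber_nonneg _ _
      _ = _ := one_mul _
  refine le_antisymm (key u T h1) ?_
  have h := key (star u) (u * T * star u) (by rw [star_star, h2])
  have e : star u * (u * T * star u) * star (star u) = T := by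
    rw [star_star]
    calc star u * (u * T * star u) * u = (star u * u) * T * (star u * u) := by noncomm_ring
      _ = T := by rw [h1, one_mul, mul_one]
  rwa [e] at h

theorem dixmierSelfAdjoint_conj {u : H →L[ℂ] H} (h1 : star u * u = 1) (h2 : u * star u = 1)
    {A : H →L[ℂ] H} (hA : IsSelfAdjoint A) :
    dixmierSelfAdjoint ω (u * A * star u) = dixmierSelfAdjoint ω A := by
  -- The conjugated parts are positive with product zero, so by uniqueness they are the positive and
  -- negative parts of the conjugate.
  obtain ⟨e1, e2⟩ := CFC.posPart_negPart_unique (a := u * A * star u) (b := u * A⁺ * star u)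
    (c := u * A⁻ * star u)
    (by rw [← sub_mul, ← mul_sub, CFC.posPart_sub_negPart A hA])
    (by
      calc u * A⁺ * star u * (u * A⁻ * star u) = u * A⁺ * (star u * u) * (A⁻ * star u) := by
            noncomm_ring
        _ = u * (A⁺ * A⁻) * star u := by rw [h1]; noncomm_ring
        _ = 0 := by rw [CFC.posPart_mul_negPart]; simp)
    (star_right_conjugate_nonneg (CFC.posPart_nonneg A) u)
    (star_right_conjugate_nonneg (CFC.negPart_nonneg A) u)
  rw [dixmierSelfAdjoint, dixmierSelfAdjoint, e1, e2,
    dixmierPos_congr ω (singularNumber_conj h1 h2 _), dixmierPos_congr ω (singularNumber_conj h1 h2 _)]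

/-- The Dixmier trace is invariant under unitary conjugation. -/
theorem dixmierTrace_conj {u : H →L[ℂ] H} (h1 : star u * u = 1) (h2 : u * star u = 1)
    (T : H →L[ℂ] H) : dixmierTrace ω (u * T * star u) = dixmierTrace ω T := by
  have key : ∀ T : H →L[ℂ] H, dixmierRe ω (u * T * star u) = dixmierRe ω T := by
    intro T
    rw [dixmierRe, dixmierRe, ← dixmierSelfAdjoint_conj ω h1 h2 (realPart T).2]
    congr 1
    rw [realPart_apply_coe, realPart_apply_coe, star_mul, star_mul, star_star, mul_smul_comm,
      smul_mul_assoc, mul_add, add_mul, mul_assoc u (star T)]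
  have e : Complex.I • (u * T * star u) = u * (Complex.I • T) * star u := by
    rw [mul_smul_comm, smul_mul_assoc]
  rw [dixmierTrace_eq, dixmierTrace_eq, e, key, key]

theorem dixmierTrace_of_nonneg {A : H →L[ℂ] H} (hA : 0 ≤ A) :
    dixmierTrace ω A = dixmierPos ω A := by
  have hs : IsSelfAdjoint A := .of_nonneg hA
  have h0 : SingularBound (0 : H →L[ℂ] H) 0 := fun k => by
    have := (singularNumber_le_norm (0 : H →L[ℂ] H) k).trans_eq norm_zero
    have hk : (0 : ℝ) ≤ k := k.cast_nonneg
    nlinarith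
  have hz : dixmierPos ω (0 : H →L[ℂ] H) = 0 :=
    le_antisymm ((h0.dixmierPos_le ω).trans_eq (mul_zero _)) (h0.dixmierPos_nonneg ω)
  have h1 : dixmierRe ω A = dixmierPos ω A := by
    rw [dixmierRe, hs.coe_realPart, dixmierSelfAdjoint, (CFC.posPart_eq_self A).2 hA,
      (CFC.negPart_eq_zero_iff A hs).2 hA, hz, sub_zero]
  have h2 : dixmierRe ω (Complex.I • A) = 0 := by
    rw [dixmierRe, realPart_I_smul, hs.imaginaryPart, neg_zero]
    have := dixmierSelfAdjoint_neg ω (0 : H →L[ℂ] H)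
    rw [neg_zero] at this
    change dixmierSelfAdjoint ω 0 = 0
    linarith
  rw [dixmierTrace_eq, h1, h2]
  simp

end DixmierTrace

/-! ### Singular numbers of $|D|^{-n}$ by counting lattice points -/

section Diag

variable {n : ℕ} {V : Type} [NormedAddCommGroup V] [InnerProductSpace ℂ V]

theorem TorusL2.star_diag [CompleteSpace V] (B B' : (Fin n → ℤ) → V →L[ℂ] V) (C C' : ℝ)
    (hB : ∀ r, ‖B r‖ ≤ C) (hB' : ∀ r, ‖B' r‖ ≤ C') (h : ∀ r, star (B r) = B' r) :
    star (TorusL2.diag B C hB) = TorusL2.diag B' C' hB' := by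
  symm
  rw [ContinuousLinearMap.star_eq_adjoint, ContinuousLinearMap.eq_adjoint_iff]
  intro x y
  rw [TorusL2.inner_eq, TorusL2.inner_eq]
  congr 1
  ext r
  rw [TorusL2.diag_apply, TorusL2.diag_apply, ← h, ContinuousLinearMap.star_eq_adjoint,
    ContinuousLinearMap.adjoint_inner_left]

end Diag

namespace GammaMatrices

variable {n : ℕ}

theorem latticeNorm_nonneg (r : Fin n → ℤ) : 0 ≤ latticeNorm r := Real.sqrt_nonneg _

/-- The eigenvalue of `|D|^{-d}` on `e_r ⊗ ℂ^N`. -/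
def diracWeight (d : ℕ) (r : Fin n → ℤ) : ℝ := if r = 0 then 0 else (latticeNorm r ^ d)⁻¹

theorem diracWeight_nonneg (d : ℕ) (r : Fin n → ℤ) : 0 ≤ diracWeight d r := by
  rw [diracWeight]
  split_ifs
  · exact le_rfl
  · have := latticeNorm_nonneg r
    positivity

theorem diracWeight_le_one (d : ℕ) (r : Fin n → ℤ) : diracWeight d r ≤ 1 := by
  rw [diracWeight]
  split_ifs with h
  · exact zero_le_one
  · exact inv_le_one_of_one_le₀ (one_le_pow₀ (one_le_latticeNorm h))

theorem absDiracInvPow_apply (d : ℕ) (x : TorusL2 n (Spinor n)) (r : Fin n → ℤ) :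
    absDiracInvPow n d x r = (diracWeight d r : ℂ) • x r := by
  rw [absDiracInvPow, TorusL2.diag_apply, diracWeight]
  split_ifs
  · simp
  · rfl

theorem absDiracInvPow_single (d : ℕ) (r : Fin n → ℤ) (v : Spinor n) :
    absDiracInvPow n d (TorusL2.single r v) = (diracWeight d r : ℂ) • TorusL2.single r v := by
  refine TorusL2.ext fun s => ?_
  rw [absDiracInvPow_apply, TorusL2.smul_apply, TorusL2.single_apply]
  split_ifs with h
  · rw [h]
  · rw [smul_zero, smul_zero]

theorem absDiracInvPow_nonneg (d : ℕ) : 0 ≤ absDiracInvPow n d := by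
  have hb : ∀ r : Fin n → ℤ,
      ‖((√(diracWeight d r) : ℝ) : ℂ) • (1 : Spinor n →L[ℂ] Spinor n)‖ ≤ 1 := by
    intro r
    rw [norm_smul, Complex.norm_real, Real.norm_of_nonneg (Real.sqrt_nonneg _)]
    exact mul_le_one₀ (Real.sqrt_le_one.2 (diracWeight_le_one d r)) (norm_nonneg _)
      ContinuousLinearMap.norm_id_le
  let Q := TorusL2.diag _ 1 hb
  have hQ : star Q = Q := TorusL2.star_diag _ _ _ _ hb hb fun r => by
    rw [star_smul, star_one, Complex.star_def, Complex.conj_ofReal]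
  have e : absDiracInvPow n d = star Q * Q := by
    rw [hQ]
    ext x
    refine TorusL2.ext fun r => ?_
    change _ = ((√(diracWeight d r) : ℝ) : ℂ) • ((√(diracWeight d r) : ℝ) : ℂ) • x r
    rw [absDiracInvPow_apply, smul_smul, ← Complex.ofReal_mul,
      Real.mul_self_sqrt (diracWeight_nonneg d r)]
  rw [e]
  exact star_mul_self_nonneg Q

/-- Truncating the block diagonal operator to the frequencies in `s` gives rank at most `|s|` times
the spinor dimension, and what is left is multiplication by the weights outside `s`. -/
theorem singularNumber_absDiracInvPow_le (d : ℕ) {k : ℕ} {s : Finset (Fin n → ℤ)}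
    (hs : s.card * 2 ^ (n / 2) ≤ k) {t : ℝ} (ht : 0 ≤ t) (h : ∀ r ∉ s, diracWeight d r ≤ t) :
    singularNumber (absDiracInvPow n d) k ≤ t := by
  let F : TorusL2 n (Spinor n) →L[ℂ] TorusL2 n (Spinor n) :=
    ∑ r ∈ s, (TorusL2.single r).comp ((diracWeight d r : ℂ) • TorusL2.eval r)
  have hFa : ∀ x r, F x r = if r ∈ s then (diracWeight d r : ℂ) • x r else 0 := by
    intro x r
    have : F x r = ∑ t ∈ s, TorusL2.single t ((diracWeight d t : ℂ) • x t) r := by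
      change TorusL2.eval r (F x) = _
      simp only [F, _root_.sum_apply, map_sum]
      rfl
    rw [this]
    simp only [TorusL2.single_apply, Finset.sum_ite_eq]
  refine (singularNumber_le (F := F) ?_).trans ?_
  · rw [ContinuousLinearMap.toLinearMap_sum]
    refine (LinearMap.rank_finsetSum_le _ _).trans ?_
    have hr : ∀ r ∈ s, LinearMap.rank (((TorusL2.single r).comp
        ((diracWeight d r : ℂ) • TorusL2.eval r) : TorusL2 n (Spinor n) →L[ℂ] TorusL2 n (Spinor n)) :
          TorusL2 n (Spinor n) →ₗ[ℂ] TorusL2 n (Spinor n)) ≤ (2 ^ (n / 2) : ℕ) := by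
      intro r _
      refine (LinearMap.rank_comp_le_left
        (((diracWeight d r : ℂ) • TorusL2.eval r : TorusL2 n (Spinor n) →L[ℂ] Spinor n) :
          TorusL2 n (Spinor n) →ₗ[ℂ] Spinor n)
        ((TorusL2.single r : Spinor n →L[ℂ] TorusL2 n (Spinor n)) :
          Spinor n →ₗ[ℂ] TorusL2 n (Spinor n))).trans ?_
      refine (LinearMap.rank_le_domain _).trans ?_
      have : Module.rank ℂ (EuclideanSpace ℂ (Fin (2 ^ (n / 2)))) = (2 ^ (n / 2) : ℕ) := by
        rw [← Module.finrank_eq_rank, finrank_euclideanSpace, Fintype.card_fin]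
      exact this.le
    refine (Finset.sum_le_card_nsmul _ _ _ hr).trans ?_
    rw [nsmul_eq_mul]
    exact_mod_cast hs
  · refine ContinuousLinearMap.opNorm_le_bound _ ht fun x => ?_
    refine le_of_sq_le_sq ?_ (by positivity)
    rw [mul_pow, TorusL2.norm_sq, TorusL2.norm_sq, ← tsum_mul_left]
    refine Summable.tsum_le_tsum (fun r => ?_) (TorusL2.summable_sq _)
      ((TorusL2.summable_sq x).mul_left _)
    change ‖absDiracInvPow n d x r - F x r‖ ^ 2 ≤ _
    rw [hFa, absDiracInvPow_apply]
    split_ifs with hr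
    · rw [sub_self, norm_zero, zero_pow two_ne_zero]
      positivity
    · rw [sub_zero, norm_smul, Complex.norm_real, Real.norm_of_nonneg (diracWeight_nonneg d r),
        ← mul_pow]
      have := h r hr
      have := diracWeight_nonneg d r
      gcongr

/-- A single unit spinor `v` suffices: the vectors $e_r\otimes v$, $r\in s$, are orthonormal
eigenvectors. Ignoring the spinor multiplicity only weakens the constant. -/
theorem le_singularNumber_absDiracInvPow (d : ℕ) {k : ℕ} {s : Finset (Fin n → ℤ)}
    (hs : k + 1 ≤ s.card) {t : ℝ} (h : ∀ r ∈ s, t ≤ diracWeight d r) :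
    t ≤ singularNumber (absDiracInvPow n d) k := by
  obtain ⟨v, hv⟩ := exists_norm_eq (Spinor n) zero_le_one
  let f : Fin (k + 1) → (Fin n → ℤ) := fun i => s.equivFin.symm (Fin.castLE hs i)
  have hfs : ∀ i, f i ∈ s := fun i => (s.equivFin.symm (Fin.castLE hs i)).2
  have hf : Function.Injective f := Subtype.val_injective.comp
    (s.equivFin.symm.injective.comp (Fin.castLE_injective hs))
  have ho : Orthonormal ℂ fun i => TorusL2.single (f i) v := by
    rw [orthonormal_iff_ite]
    intro i j
    rw [TorusL2.inner_single_left, TorusL2.single_apply]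
    by_cases hij : i = j
    · rw [if_pos hij, if_pos (congrArg f hij), inner_self_eq_norm_sq_to_K, hv]
      simp
    · rw [if_neg hij, if_neg fun e => hij (hf e), inner_zero_right]
  refine le_singularNumber_of_linearIndependent ho.linearIndependent fun c => ?_
  have e1 : absDiracInvPow n d (∑ i, c i • TorusL2.single (f i) v) =
      ∑ i, (c i * (diracWeight d (f i) : ℂ)) • TorusL2.single (f i) v := by
    simp only [map_sum, map_smul, absDiracInvPow_single, smul_smul]
  have e2 : ‖∑ i, c i • TorusL2.single (f i) v‖ ^ 2 = ∑ i, ‖c i‖ ^ 2 := by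
    have h1 := ho.inner_sum c c Finset.univ
    rw [inner_self_eq_norm_sq_to_K] at h1
    apply Complex.ofReal_injective
    push_cast
    refine h1.trans (Finset.sum_congr rfl fun i _ => ?_)
    rw [mul_comm, Complex.mul_conj, Complex.normSq_eq_norm_sq]
    push_cast
    rfl
  rw [e1, ho.inner_sum, e2, Finset.mul_sum, Complex.re_sum]
  refine Finset.sum_le_sum fun i _ => ?_
  have e3 : (starRingEnd ℂ) (c i * (diracWeight d (f i) : ℂ)) * c i =
      ((diracWeight d (f i) * ‖c i‖ ^ 2 : ℝ) : ℂ) := by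
    rw [map_mul, Complex.conj_ofReal, mul_right_comm, mul_comm _ (c i), Complex.mul_conj,
      Complex.normSq_eq_norm_sq]
    push_cast
    ring
  rw [e3, Complex.ofReal_re]
  exact mul_le_mul_of_nonneg_right (h _ (hfs i)) (by positivity)

/-- The lattice points of sup norm at most `m`. -/
def latticeBox (n m : ℕ) : Finset (Fin n → ℤ) := Finset.Icc (fun _ => -(m : ℤ)) (fun _ => m)

theorem card_latticeBox (n m : ℕ) : (latticeBox n m).card = (2 * m + 1) ^ n := by
  rw [latticeBox, Pi.card_Icc]
  simp only [Int.card_Icc, Finset.prod_const, Finset.card_univ, Fintype.card_fin]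
  congr 1
  omega

theorem le_latticeNorm_of_notMem {m : ℕ} {r : Fin n → ℤ} (hr : r ∉ latticeBox n m) :
    (m + 1 : ℝ) ≤ latticeNorm r := by
  obtain ⟨j, hj⟩ : ∃ j, (m : ℤ) < |r j| := by
    by_contra! hcon
    refine hr (Finset.mem_Icc.2 ⟨fun j => ?_, fun j => ?_⟩)
    · exact (abs_le.1 (hcon j)).1
    · exact (abs_le.1 (hcon j)).2
  have h1 : (m + 1 : ℝ) ≤ |(r j : ℝ)| := by exact_mod_cast hj
  refine h1.trans ?_
  rw [← Real.sqrt_sq_eq_abs]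
  exact Real.sqrt_le_sqrt (Finset.single_le_sum (f := fun j => (r j : ℝ) ^ 2)
    (fun _ _ => by positivity) (Finset.mem_univ j))

theorem latticeNorm_le_of_mem {m : ℕ} {r : Fin n → ℤ} (hr : r ∈ latticeBox n m) :
    latticeNorm r ≤ √n * m := by
  rw [latticeBox, Finset.mem_Icc] at hr
  rw [latticeNorm]
  refine Real.sqrt_le_iff.2 ⟨by positivity, ?_⟩
  rw [mul_pow, Real.sq_sqrt (Nat.cast_nonneg n)]
  calc ∑ j, (r j : ℝ) ^ 2 ≤ ∑ _j : Fin n, (m : ℝ) ^ 2 := by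
        refine Finset.sum_le_sum fun j _ => ?_
        have h1 : |r j| ≤ (m : ℤ) := abs_le.2 ⟨hr.1 j, hr.2 j⟩
        have h2 : |(r j : ℝ)| ≤ m := by exact_mod_cast h1
        rw [← sq_abs]
        gcongr
    _ = _ := by simp

/-- The box of sup norm `m` holds $(2m+1)^n$ points, and outside it the weight is at most
$(m+1)^{-n}$. The exponent `n` is the one at which the two powers cancel and the decay is exactly of
order `1 / k`. -/
theorem singularBound_absDiracInvPow (hn : 0 < n) :
    SingularBound (absDiracInvPow n n) (2 ^ (n / 2) * 3 ^ n : ℝ) := by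
  intro k
  have hex : ∃ m, k < 2 ^ (n / 2) * (2 * m + 1) ^ n := by
    refine ⟨k, ?_⟩
    calc k < 2 * k + 1 := by omega
      _ ≤ (2 * k + 1) ^ n := Nat.le_self_pow hn.ne' _
      _ ≤ _ := Nat.le_mul_of_pos_left _ (by positivity)
  -- For the least such `m`, the box of size `m - 1` still fits into rank `k`, while `k + 1` is
  -- bounded by the dimension over the box of size `m`. The case `m = 0` has no smaller box and uses
  -- the norm bound.
  obtain ⟨m, hm, hmin⟩ : ∃ m, k < 2 ^ (n / 2) * (2 * m + 1) ^ n ∧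
      ∀ m' < m, 2 ^ (n / 2) * (2 * m' + 1) ^ n ≤ k := by
    classical
    exact ⟨Nat.find hex, Nat.find_spec hex, fun m' h => not_lt.1 (Nat.find_min hex h)⟩
  rcases m with _ | m
  · have h1 : singularNumber (absDiracInvPow n n) k ≤ 1 :=
      singularNumber_absDiracInvPow_le n (s := ∅) (by simp) zero_le_one
        fun r _ => diracWeight_le_one n r
    have h2 : (k + 1 : ℝ) ≤ 2 ^ (n / 2) := by
      simp only [mul_zero, zero_add, one_pow, mul_one] at hm
      exact_mod_cast hm
    calc (k + 1 : ℝ) * singularNumber (absDiracInvPow n n) k ≤ 2 ^ (n / 2) * 1 := by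
          gcongr
          exact singularNumber_nonneg _ _
      _ ≤ _ := by
          gcongr
          exact one_le_pow₀ (by norm_num)
  · have hm' := hmin m (Nat.lt_succ_self m)
    have h1 : singularNumber (absDiracInvPow n n) k ≤ ((m + 1 : ℝ) ^ n)⁻¹ := by
      refine singularNumber_absDiracInvPow_le n (s := latticeBox n m) ?_ (by positivity) ?_
      · rwa [card_latticeBox, mul_comm]
      · intro r hr
        have h := le_latticeNorm_of_notMem hr
        rw [diracWeight]
        split_ifs
        · positivity
        · gcongr
    have h2 : (k + 1 : ℝ) ≤ 2 ^ (n / 2) * (3 * (m + 1)) ^ n := by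
      have : k + 1 ≤ 2 ^ (n / 2) * (3 * (m + 1)) ^ n := by
        refine (Nat.succ_le_of_lt hm).trans ?_
        gcongr
        omega
      exact_mod_cast this
    calc (k + 1 : ℝ) * singularNumber (absDiracInvPow n n) k
        ≤ (2 ^ (n / 2) * (3 * (m + 1)) ^ n) * ((m + 1 : ℝ) ^ n)⁻¹ := by
          gcongr
          exact singularNumber_nonneg _ _
      _ = _ := by
          rw [mul_pow]
          field_simp

/-- In the box of size `m` the Euclidean length is at most $\sqrt n\,m$, so the weights of its
nonzero points are at least $(\sqrt n\,m)^{-n}$. The least `m` with $k+1<(m+1)^n$ provides `k + 1`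
such points even after the origin is removed, while minimality gives $m^n\le k+1$. -/
theorem le_mul_singularNumber_absDiracInvPow (hn : 0 < n) (k : ℕ) :
    (√n ^ n)⁻¹ ≤ (k + 1) * singularNumber (absDiracInvPow n n) k := by
  have hex : ∃ m, k + 1 < (m + 1) ^ n := by
    refine ⟨k + 1, ?_⟩
    calc k + 1 < k + 1 + 1 := by omega
      _ ≤ _ := Nat.le_self_pow hn.ne' _
  obtain ⟨m, hm, hmin⟩ : ∃ m, k + 1 < (m + 1) ^ n ∧ ∀ m' < m, (m' + 1) ^ n ≤ k + 1 := by
    classical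
    exact ⟨Nat.find hex, Nat.find_spec hex, fun m' h => not_lt.1 (Nat.find_min hex h)⟩
  rcases m with _ | m
  · simp at hm
  have hm' : ((m + 1 : ℕ) : ℝ) ^ n ≤ k + 1 := by exact_mod_cast hmin m (Nat.lt_succ_self m)
  have hsn : 0 < √(n : ℝ) := Real.sqrt_pos.2 (by exact_mod_cast hn)
  have h1 : ((√n * (m + 1 : ℕ)) ^ n)⁻¹ ≤ singularNumber (absDiracInvPow n n) k := by
    refine le_singularNumber_absDiracInvPow n (s := (latticeBox n (m + 1)).erase 0) ?_ ?_
    · have h0 : (0 : Fin n → ℤ) ∈ latticeBox n (m + 1) := by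
        rw [latticeBox, Finset.mem_Icc]
        exact ⟨fun j => by simp only [Pi.zero_apply]; omega, fun j => by simp only [Pi.zero_apply]; omega⟩
      rw [Finset.card_erase_of_mem h0, card_latticeBox]
      have : (m + 1 + 1) ^ n ≤ (2 * (m + 1) + 1) ^ n := by gcongr; omega
      omega
    · intro r hr
      obtain ⟨hr0, hr⟩ := Finset.mem_erase.1 hr
      rw [diracWeight, if_neg hr0]
      have := one_le_latticeNorm hr0
      have := latticeNorm_le_of_mem hr
      gcongr
  have hpos : (0 : ℝ) < ((m + 1 : ℕ) : ℝ) ^ n := by positivity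
  calc (√n ^ n)⁻¹ = ((m + 1 : ℕ) : ℝ) ^ n * ((√n * (m + 1 : ℕ)) ^ n)⁻¹ := by
        rw [mul_pow, mul_inv]
        field_simp
    _ ≤ (k + 1) * singularNumber (absDiracInvPow n n) k := by gcongr

/-- The Dixmier trace of `|D|^{-n}` is positive. -/
theorem dixmierTrace_absDiracInvPow (hn : 0 < n) (ω : DixmierLimit) :
    ∃ c : ℝ, 0 < c ∧ dixmierTrace ω (absDiracInvPow n n) = c := by
  have hb := singularBound_absDiracInvPow hn
  refine ⟨dixmierPos ω (absDiracInvPow n n), ?_, dixmierTrace_of_nonneg ω (absDiracInvPow_nonneg n)⟩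
  have hsn : 0 < √(n : ℝ) := Real.sqrt_pos.2 (by exact_mod_cast hn)
  have hc : 0 < (√(n : ℝ) ^ n)⁻¹ := by positivity
  refine hc.trans_le ?_
  rw [hb.dixmierPos_eq ω]
  -- Singular numbers bounded below by a constant over `k + 1` have partial sums at least that
  -- constant times a harmonic number, which dominates the logarithm in the denominator.
  refine ω.le_toFun ?_
  filter_upwards [eventually_ge_atTop 1] with i hi
  have hl := half_le_log_nat_add_one hi
  rw [dixmierSeq_eq, le_div_iff₀ (by linarith)]
  calc (√(n : ℝ) ^ n)⁻¹ * Real.log (i + 1 : ℝ)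
      ≤ (√(n : ℝ) ^ n)⁻¹ * (harmonic (i + 1) : ℝ) := by
        gcongr
        refine le_trans ?_ (log_add_one_le_harmonic (i + 1))
        refine Real.log_le_log (by positivity) ?_
        push_cast
        linarith
    _ ≤ _ := by
        rw [singularSum, harmonic]
        push_cast
        rw [Finset.mul_sum]
        refine Finset.sum_le_sum fun k _ => ?_
        rw [← div_eq_mul_inv, div_le_iff₀' (by positivity)]
        exact le_mul_singularNumber_absDiracInvPow hn k

end GammaMatrices

/-! ### Operators acting on the spinor factor only -/

section ConstBlock

variable {n : ℕ}

/-- The operator `1 ⊗ M` on `ℓ²(ℤⁿ) ⊗ ℂ^N`. -/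
def constBlock (M : Spinor n →L[ℂ] Spinor n) : TorusL2 n (Spinor n) →L[ℂ] TorusL2 n (Spinor n) :=
  TorusL2.diag (fun _ => M) ‖M‖ fun _ => le_rfl

theorem constBlock_apply (M : Spinor n →L[ℂ] Spinor n) (x : TorusL2 n (Spinor n))
    (r : Fin n → ℤ) : constBlock M x r = M (x r) := rfl

theorem constBlock_mul (M M' : Spinor n →L[ℂ] Spinor n) :
    constBlock (M * M') = constBlock M * constBlock M' := rfl

theorem constBlock_one : constBlock (1 : Spinor n →L[ℂ] Spinor n) = 1 := rfl

theorem star_constBlock (M : Spinor n →L[ℂ] Spinor n) :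
    star (constBlock M) = constBlock (star M) :=
  TorusL2.star_diag _ _ _ _ _ _ fun _ => rfl

/-- `M ↦ 1 ⊗ M` as a linear map. -/
def constBlockₗ : (Spinor n →L[ℂ] Spinor n) →ₗ[ℂ]
    (TorusL2 n (Spinor n) →L[ℂ] TorusL2 n (Spinor n)) where
  toFun := constBlock
  map_add' _ _ := rfl
  map_smul' _ _ := rfl

theorem constBlock_single (M : Spinor n →L[ℂ] Spinor n) (r : Fin n → ℤ) (v : Spinor n) :
    constBlock M (TorusL2.single r v) = TorusL2.single r (M v) := by
  refine TorusL2.ext fun s => ?_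
  rw [constBlock_apply, TorusL2.single_apply, TorusL2.single_apply]
  split_ifs
  · rfl
  · exact map_zero M

theorem constBlock_mul_shift (Θ : Matrix (Fin n) (Fin n) ℝ) (M : Spinor n →L[ℂ] Spinor n)
    (s : Fin n → ℤ) :
    constBlock M * TorusL2.shift Θ s = TorusL2.shift Θ s * constBlock M := by
  ext x
  exact TorusL2.ext fun r => map_smul M _ _

theorem constBlock_mul_rep {Θ : Matrix (Fin n) (Fin n) ℝ} (M : Spinor n →L[ℂ] Spinor n)
    (a : SmoothTorus Θ) :
    constBlock M * SmoothTorus.rep (Spinor n) a = SmoothTorus.rep (Spinor n) a * constBlock M := by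
  have h := SmoothTorus.hasSum_op (V := Spinor n) a
  have h' := h.mul_right (constBlock M)
  refine (h.mul_left (constBlock M)).unique ?_
  simp only [smul_mul_assoc] at h'
  simp only [mul_smul_comm, constBlock_mul_shift]
  exact h'

theorem constBlock_mul_absDiracInvPow (M : Spinor n →L[ℂ] Spinor n) (d : ℕ) :
    constBlock M * GammaMatrices.absDiracInvPow n d =
      GammaMatrices.absDiracInvPow n d * constBlock M := by
  ext x
  refine TorusL2.ext fun r => ?_
  change M (GammaMatrices.absDiracInvPow n d x r) =
    GammaMatrices.absDiracInvPow n d (constBlock M x) r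
  rw [GammaMatrices.absDiracInvPow_apply, GammaMatrices.absDiracInvPow_apply, map_smul,
    constBlock_apply]

end ConstBlock

/-! ### The functional $X\mapsto\mathrm{Tr}_\omega(X|D|^{-n})$ -/

section DiracFunctional

variable {n : ℕ} (hn : 0 < n) (ω : DixmierLimit)

/-- The functional `X ↦ Tr_ω(X |D|^{-n})` on bounded operators. -/
def diracFunctional : (TorusL2 n (Spinor n) →L[ℂ] TorusL2 n (Spinor n)) →L[ℂ] ℂ :=
  LinearMap.mkContinuous
    { toFun := fun X => dixmierTrace ω (X * GammaMatrices.absDiracInvPow n n)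
      map_add' := fun X Y => by
        have h := GammaMatrices.singularBound_absDiracInvPow hn
        rw [add_mul, dixmierTrace_add ω (h.mul_left X) (h.mul_left Y)]
      map_smul' := fun c X => by
        have h := GammaMatrices.singularBound_absDiracInvPow hn
        rw [smul_mul_assoc, dixmierTrace_smul ω (h.mul_left X)]
        rfl }
    (12 * (2 ^ (n / 2) * 3 ^ n))
    (fun X => by
      refine (norm_dixmierTrace_le ω
        ((GammaMatrices.singularBound_absDiracInvPow hn).mul_left X)).trans_eq ?_
      ring)

theorem diracFunctional_apply (X : TorusL2 n (Spinor n) →L[ℂ] TorusL2 n (Spinor n)) :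
    diracFunctional hn ω X = dixmierTrace ω (X * GammaMatrices.absDiracInvPow n n) := rfl

/-- As `u` commutes with $|D|^{-n}$, so does its adjoint, and the weight can be moved inside the
conjugation. This symmetry is the only trace property needed to identify the functional. -/
theorem diracFunctional_conj {u : TorusL2 n (Spinor n) →L[ℂ] TorusL2 n (Spinor n)}
    (h1 : star u * u = 1) (h2 : u * star u = 1)
    (hu : u * GammaMatrices.absDiracInvPow n n = GammaMatrices.absDiracInvPow n n * u)
    (X : TorusL2 n (Spinor n) →L[ℂ] TorusL2 n (Spinor n)) :
    diracFunctional hn ω (u * X * star u) = diracFunctional hn ω X := by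
  set R := GammaMatrices.absDiracInvPow n n
  have e : u * X * star u * R = u * (X * R) * star u := by
    have h3 : star u * R = R * star u := by
      calc star u * R = star u * R * (u * star u) := by rw [h2, mul_one]
        _ = star u * (R * u) * star u := by simp only [mul_assoc]
        _ = star u * u * (R * star u) := by rw [← hu]; simp only [mul_assoc]
        _ = _ := by rw [h1, one_mul]
    rw [mul_assoc (u * X), h3]
    simp only [mul_assoc]
  rw [diracFunctional_apply, diracFunctional_apply, e, dixmierTrace_conj ω h1 h2]

/-- The gauge unitary `e_r ⊗ v ↦ e^{iθ r_j} e_r ⊗ v`. -/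
def gaugeUnitary (θ : ℝ) (j : Fin n) : TorusL2 n (Spinor n) →L[ℂ] TorusL2 n (Spinor n) :=
  TorusL2.diag (fun r => Complex.exp ((θ * r j : ℝ) * Complex.I) • 1) 1 fun r => by
    rw [norm_smul, Complex.norm_exp_ofReal_mul_I, one_mul]
    exact ContinuousLinearMap.norm_id_le

theorem gaugeUnitary_apply (θ : ℝ) (j : Fin n) (x : TorusL2 n (Spinor n)) (r : Fin n → ℤ) :
    gaugeUnitary θ j x r = Complex.exp ((θ * r j : ℝ) * Complex.I) • x r := rfl

theorem gaugeUnitary_mul_neg (θ : ℝ) (j : Fin n) :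
    gaugeUnitary θ j * gaugeUnitary (-θ) j = 1 := by
  ext x
  refine TorusL2.ext fun r => ?_
  change Complex.exp ((θ * r j : ℝ) * Complex.I) • Complex.exp ((-θ * r j : ℝ) * Complex.I) • x r =
    x r
  rw [smul_smul, ← Complex.exp_add, ← add_mul, ← Complex.ofReal_add]
  simp

theorem star_gaugeUnitary (θ : ℝ) (j : Fin n) :
    star (gaugeUnitary θ j) = gaugeUnitary (-θ) j := by
  refine TorusL2.star_diag _ _ _ _ _ _ fun r => ?_
  rw [star_smul, star_one, Complex.star_def, ← Complex.exp_conj, map_mul, Complex.conj_ofReal,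
    Complex.conj_I]
  congr 2
  push_cast
  ring

/-- The gauge unitary of angle `θ` in a direction `j` with $s_j\ne0$ multiplies $U^s$ by $e^{i\theta
s_j}$ under conjugation. The choice $\theta=\pi/s_j$ makes this sign `-1`, and the invariant
functional equals its own negative. -/
theorem diracFunctional_shift_mul_constBlock (Θ : Matrix (Fin n) (Fin n) ℝ) {s : Fin n → ℤ}
    (hs : s ≠ 0) (M : Spinor n →L[ℂ] Spinor n) :
    diracFunctional hn ω (TorusL2.shift Θ s * constBlock M) = 0 := by
  obtain ⟨j, hj⟩ := Function.ne_iff.1 hs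
  have hj' : (s j : ℝ) ≠ 0 := by exact_mod_cast hj
  set θ : ℝ := Real.pi / s j
  set X := TorusL2.shift Θ s * constBlock M
  have hu1 : star (gaugeUnitary θ j) * gaugeUnitary θ j = 1 := by
    rw [star_gaugeUnitary]
    simpa using gaugeUnitary_mul_neg (-θ) j
  have hu2 : gaugeUnitary θ j * star (gaugeUnitary θ j) = 1 := by
    rw [star_gaugeUnitary, gaugeUnitary_mul_neg]
  have hanti : gaugeUnitary θ j * X = -(X * gaugeUnitary θ j) := by
    ext x
    refine TorusL2.ext fun r => ?_
    change Complex.exp ((θ * r j : ℝ) * Complex.I) • torusCocycle Θ s (r - s) • M (x (r - s)) =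
      -(torusCocycle Θ s (r - s) •
        M (Complex.exp ((θ * (r - s) j : ℝ) * Complex.I) • x (r - s)))
    have e : Complex.exp ((θ * r j : ℝ) * Complex.I) =
        -Complex.exp ((θ * (r - s) j : ℝ) * Complex.I) := by
      have h1 : θ * (r j : ℝ) = θ * ((r - s) j : ℤ) + Real.pi := by
        rw [Pi.sub_apply]
        push_cast
        rw [mul_sub, div_mul_cancel₀ _ hj']
        ring
      rw [h1, Complex.ofReal_add, add_mul, Complex.exp_add, Complex.exp_pi_mul_I, mul_neg_one]
    rw [e, map_smul, neg_smul, smul_comm]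
  have hR : gaugeUnitary θ j * GammaMatrices.absDiracInvPow n n =
      GammaMatrices.absDiracInvPow n n * gaugeUnitary θ j := by
    ext x
    refine TorusL2.ext fun r => ?_
    change Complex.exp ((θ * r j : ℝ) * Complex.I) • GammaMatrices.absDiracInvPow n n x r =
      GammaMatrices.absDiracInvPow n n (gaugeUnitary θ j x) r
    rw [GammaMatrices.absDiracInvPow_apply, GammaMatrices.absDiracInvPow_apply,
      gaugeUnitary_apply, smul_comm]
  have h := diracFunctional_conj hn ω hu1 hu2 hR X
  rw [hanti, neg_mul, mul_assoc, hu2, mul_one, map_neg] at h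
  exact self_eq_neg.1 h.symm

/-- By continuity the functional can be applied termwise to the norm convergent series of `a`, and
only the term $U^0$ survives. -/
theorem diracFunctional_rep_mul_constBlock {Θ : Matrix (Fin n) (Fin n) ℝ} (a : SmoothTorus Θ)
    (M : Spinor n →L[ℂ] Spinor n) :
    diracFunctional hn ω (SmoothTorus.rep (Spinor n) a * constBlock M) =
      a.trace * diracFunctional hn ω (constBlock M) := by
  have h := ((SmoothTorus.hasSum_op (V := Spinor n) a).mul_right (constBlock M)).mapL
    (diracFunctional hn ω)
  refine h.unique ?_
  convert hasSum_ite_eq (0 : Fin n → ℤ) (a.trace * diracFunctional hn ω (constBlock M)) using 1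
  ext1 s
  rw [smul_mul_assoc, map_smul]
  split_ifs with hs
  · rw [hs, TorusL2.shift_zero, one_mul]
    rfl
  · rw [diracFunctional_shift_mul_constBlock hn ω Θ hs, smul_zero]

theorem diracFunctional_constBlock_rankOne_map (U : Spinor n ≃ₗᵢ[ℂ] Spinor n) (x y : Spinor n) :
    diracFunctional hn ω (constBlock (InnerProductSpace.rankOne ℂ (U x) (U y))) =
      diracFunctional hn ω (constBlock (InnerProductSpace.rankOne ℂ x y)) := by
  let u : Spinor n →L[ℂ] Spinor n := (U.toContinuousLinearEquiv : Spinor n →L[ℂ] Spinor n)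
  have hus : star u = (U.symm.toContinuousLinearEquiv : Spinor n →L[ℂ] Spinor n) := by
    rw [ContinuousLinearMap.star_eq_adjoint]
    exact U.adjoint_eq_symm
  have h1 : star u * u = 1 := by
    rw [hus]
    ext z
    exact U.symm_apply_apply z
  have h2 : u * star u = 1 := by
    rw [hus]
    ext z
    exact U.apply_symm_apply z
  have e : constBlock (InnerProductSpace.rankOne ℂ (U x) (U y)) =
      constBlock u * constBlock (InnerProductSpace.rankOne ℂ x y) * star (constBlock u) := by
    rw [star_constBlock, ← constBlock_mul, ← constBlock_mul]
    congr 1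
    ext z
    change InnerProductSpace.rankOne ℂ (U x) (U y) z =
      U (InnerProductSpace.rankOne ℂ x y ((star u : Spinor n →L[ℂ] Spinor n) z))
    have : ⟪U y, z⟫_ℂ = ⟪y, U.symm z⟫_ℂ := by
      rw [← U.inner_map_map y, U.apply_symm_apply]
    rw [hus, InnerProductSpace.rankOne_apply, InnerProductSpace.rankOne_apply, map_smul, this]
    rfl
  rw [e]
  refine diracFunctional_conj hn ω ?_ ?_ (constBlock_mul_absDiracInvPow u n) _
  · rw [star_constBlock, ← constBlock_mul, h1, constBlock_one]
  · rw [star_constBlock, ← constBlock_mul, h2, constBlock_one]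

/-- An orthonormal basis of `ℂ^N`. -/
def Spinor.basis (n : ℕ) : OrthonormalBasis (Fin (2 ^ (n / 2))) ℂ (Spinor n) :=
  (EuclideanSpace.basisFun (Fin (2 ^ (n / 2))) ℂ :
    OrthonormalBasis (Fin (2 ^ (n / 2))) ℂ (EuclideanSpace ℂ (Fin (2 ^ (n / 2)))))

theorem eq_sum_rankOne (M : Spinor n →L[ℂ] Spinor n) :
    M = ∑ i, ∑ j, ⟪Spinor.basis n i, M (Spinor.basis n j)⟫_ℂ •
      InnerProductSpace.rankOne ℂ (Spinor.basis n i) (Spinor.basis n j) := by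
  set b := Spinor.basis n
  ext1 z
  conv_lhs => rw [← b.sum_repr' z, map_sum]
  simp only [_root_.sum_apply, _root_.smul_apply, InnerProductSpace.rankOne_apply]
  rw [Finset.sum_comm]
  refine Finset.sum_congr rfl fun j _ => ?_
  conv_lhs => rw [map_smul, ← b.sum_repr' (M (b j)), Finset.smul_sum]
  exact Finset.sum_congr rfl fun i _ => smul_comm _ _ _

/-- A unitarily invariant functional on matrices is a multiple of the trace. The reflection that
negates one basis vector kills the off-diagonal matrix units, transpositions of the basis identify
the diagonal ones, and `M = 1` fixes the factor. -/
theorem diracFunctional_constBlock (M : Spinor n →L[ℂ] Spinor n) :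
    diracFunctional hn ω (constBlock M) =
      dixmierTrace ω (GammaMatrices.absDiracInvPow n n) / (2 ^ (n / 2) : ℕ) *
        ∑ i, ⟪Spinor.basis n i, M (Spinor.basis n i)⟫_ℂ := by
  set b := Spinor.basis n
  let f : (Spinor n →L[ℂ] Spinor n) →ₗ[ℂ] ℂ := (diracFunctional hn ω).toLinearMap ∘ₗ constBlockₗ
  have hoff : ∀ i j, i ≠ j → f (InnerProductSpace.rankOne ℂ (b i) (b j)) = 0 := by
    intro i j hij
    have h := diracFunctional_constBlock_rankOne_map hn ω ((ℂ ∙ b i)ᗮ.reflection) (b i) (b j)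
    have h1 : (ℂ ∙ b i)ᗮ.reflection (b i) = -b i :=
      Submodule.reflection_orthogonalComplement_singleton_eq_neg (b i)
    have h2 : (ℂ ∙ b i)ᗮ.reflection (b j) = b j := by
      refine Submodule.reflection_mem_subspace_eq_self ?_
      rw [Submodule.mem_orthogonal_singleton_iff_inner_right]
      exact b.orthonormal.2 hij
    rw [h1, h2, map_neg, _root_.neg_apply] at h
    have h3 : f (-InnerProductSpace.rankOne ℂ (b i) (b j)) =
      f (InnerProductSpace.rankOne ℂ (b i) (b j)) := h
    rw [map_neg] at h3
    exact self_eq_neg.1 h3.symm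
  have hdiag : ∀ i j, f (InnerProductSpace.rankOne ℂ (b i) (b i)) =
      f (InnerProductSpace.rankOne ℂ (b j) (b j)) := by
    intro i j
    have h := diracFunctional_constBlock_rankOne_map hn ω (b.equiv b (Equiv.swap i j)) (b j) (b j)
    rw [b.equiv_apply_basis, Equiv.swap_apply_right] at h
    exact h
  have i₀ : Fin (2 ^ (n / 2)) := ⟨0, by positivity⟩
  have hf : ∀ M, f M = f (InnerProductSpace.rankOne ℂ (b i₀) (b i₀)) * ∑ i, ⟪b i, M (b i)⟫_ℂ := by
    intro M
    conv_lhs => rw [eq_sum_rankOne M]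
    rw [map_sum, Finset.mul_sum]
    refine Finset.sum_congr rfl fun i _ => ?_
    rw [map_sum, Finset.sum_eq_single i]
    · rw [map_smul, hdiag i i₀, smul_eq_mul, mul_comm]
    · intro j _ hj
      rw [map_smul, hoff i j hj.symm, smul_zero]
    · simp
  have hone : dixmierTrace ω (GammaMatrices.absDiracInvPow n n) =
      f (InnerProductSpace.rankOne ℂ (b i₀) (b i₀)) * (2 ^ (n / 2) : ℕ) := by
    have h := hf 1
    have h1 : f 1 = dixmierTrace ω (GammaMatrices.absDiracInvPow n n) := by
      change dixmierTrace ω (constBlock 1 * _) = _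
      rw [constBlock_one, one_mul]
    rw [← h1, h]
    congr 1
    simp [inner_self_eq_norm_sq_to_K]
  have hN : ((2 ^ (n / 2) : ℕ) : ℂ) ≠ 0 := by
    exact_mod_cast (by positivity : (2 ^ (n / 2) : ℕ) ≠ 0)
  rw [hone, mul_div_cancel_right₀ _ hN]
  exact hf M

end DiracFunctional

/-! ### The functional as a sum of vector functionals -/

section BlockAlgebra

variable {n : ℕ} (Θ : Matrix (Fin n) (Fin n) ℝ)

/-- The span of the operators `a ⊗ M`. -/
def blockAlgebra : Submodule ℂ (TorusL2 n (Spinor n) →L[ℂ] TorusL2 n (Spinor n)) :=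
  Submodule.span ℂ {X | ∃ (a : SmoothTorus Θ) (M : Spinor n →L[ℂ] Spinor n),
    X = SmoothTorus.rep (Spinor n) a * constBlock M}

variable {Θ}

theorem rep_mul_constBlock_mem (a : SmoothTorus Θ) (M : Spinor n →L[ℂ] Spinor n) :
    SmoothTorus.rep (Spinor n) a * constBlock M ∈ blockAlgebra Θ :=
  Submodule.subset_span ⟨a, M, rfl⟩

theorem rep_mem_blockAlgebra (a : SmoothTorus Θ) :
    SmoothTorus.rep (Spinor n) a ∈ blockAlgebra Θ := by
  have := rep_mul_constBlock_mem a 1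
  rwa [constBlock_one, mul_one] at this

theorem rep_mul_constBlock_mul (a b : SmoothTorus Θ) (M M' : Spinor n →L[ℂ] Spinor n) :
    SmoothTorus.rep (Spinor n) a * constBlock M * (SmoothTorus.rep (Spinor n) b * constBlock M') =
      SmoothTorus.rep (Spinor n) (a * b) * constBlock (M * M') := by
  rw [map_mul, constBlock_mul, mul_assoc, ← mul_assoc (constBlock M), constBlock_mul_rep]
  simp only [mul_assoc]

theorem star_rep_mul_constBlock (a : SmoothTorus Θ) (M : Spinor n →L[ℂ] Spinor n) :
    star (SmoothTorus.rep (Spinor n) a * constBlock M) =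
      SmoothTorus.rep (Spinor n) (star a) * constBlock (star M) := by
  rw [star_mul, star_constBlock, ← map_star, constBlock_mul_rep]

theorem mul_mem_blockAlgebra {X Y : TorusL2 n (Spinor n) →L[ℂ] TorusL2 n (Spinor n)}
    (hX : X ∈ blockAlgebra Θ) (hY : Y ∈ blockAlgebra Θ) : X * Y ∈ blockAlgebra Θ := by
  have h := Submodule.mul_mem_mul hX hY
  rw [blockAlgebra, Submodule.span_mul_span] at h
  refine Submodule.span_mono ?_ h
  rintro _ ⟨_, ⟨a, M, rfl⟩, _, ⟨b, M', rfl⟩, rfl⟩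
  exact ⟨a * b, M * M', rep_mul_constBlock_mul a b M M'⟩

theorem star_mem_blockAlgebra {X : TorusL2 n (Spinor n) →L[ℂ] TorusL2 n (Spinor n)}
    (hX : X ∈ blockAlgebra Θ) : star X ∈ blockAlgebra Θ := by
  induction hX using Submodule.span_induction with
  | mem x h =>
    obtain ⟨a, M, rfl⟩ := h
    rw [star_rep_mul_constBlock]
    exact rep_mul_constBlock_mem _ _
  | zero => rw [star_zero]; exact Submodule.zero_mem _
  | add x y _ _ hx hy => rw [star_add]; exact Submodule.add_mem _ hx hy
  | smul c x _ hx => rw [star_smul]; exact Submodule.smul_mem _ _ hx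

/-- The vectors `e_0 ⊗ v` for `v` in an orthonormal basis of `ℂ^N`. -/
def vacuum (i : Fin (2 ^ (n / 2))) : TorusL2 n (Spinor n) := TorusL2.single 0 (Spinor.basis n i)

/-- The vectors $e_0\otimes v_i$ compute both $\tau$ and the matrix trace. The form
$\mathrm{Tr}_\omega(S^*T|D|^{-n})$ thereby becomes a multiple of a sum of Hilbert space inner
products. -/
theorem diracFunctional_eq_sum_vacuum (hn : 0 < n) (ω : DixmierLimit)
    {X : TorusL2 n (Spinor n) →L[ℂ] TorusL2 n (Spinor n)} (hX : X ∈ blockAlgebra Θ) :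
    diracFunctional hn ω X = dixmierTrace ω (GammaMatrices.absDiracInvPow n n) /
      (2 ^ (n / 2) : ℕ) * ∑ i, ⟪vacuum i, X (vacuum i)⟫_ℂ := by
  induction hX using Submodule.span_induction with
  | mem x h =>
    obtain ⟨a, M, rfl⟩ := h
    rw [diracFunctional_rep_mul_constBlock, diracFunctional_constBlock, mul_left_comm]
    congr 1
    rw [Finset.mul_sum]
    refine Finset.sum_congr rfl fun i _ => ?_
    change _ = ⟪vacuum i, a.op (Spinor n) (constBlock M (vacuum i))⟫_ℂ
    rw [vacuum, constBlock_single, TorusL2.inner_single_left, SmoothTorus.op_single_zero,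
      inner_smul_right]
    rfl
  | zero => simp
  | add x y _ _ hx hy =>
    simp only [map_add, hx, hy, _root_.add_apply, inner_add_right, Finset.sum_add_distrib, mul_add]
  | smul c x _ hx =>
    simp only [map_smul, hx, _root_.smul_apply, inner_smul_right, ← Finset.mul_sum, smul_eq_mul]
    ring

theorem dixmierTrace_star_mul (hn : 0 < n) (ω : DixmierLimit)
    {S T : TorusL2 n (Spinor n) →L[ℂ] TorusL2 n (Spinor n)} (hS : S ∈ blockAlgebra Θ)
    (hT : T ∈ blockAlgebra Θ) :
    dixmierTrace ω (star S * T * GammaMatrices.absDiracInvPow n n) =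
      dixmierTrace ω (GammaMatrices.absDiracInvPow n n) / (2 ^ (n / 2) : ℕ) *
        ∑ i, ⟪S (vacuum i), T (vacuum i)⟫_ℂ := by
  rw [← diracFunctional_apply hn ω, diracFunctional_eq_sum_vacuum hn ω
    (mul_mem_blockAlgebra (star_mem_blockAlgebra hS) hT)]
  congr 1
  refine Finset.sum_congr rfl fun i _ => ?_
  change ⟪vacuum i, (star S : TorusL2 n (Spinor n) →L[ℂ] TorusL2 n (Spinor n)) (T (vacuum i))⟫_ℂ = _
  rw [ContinuousLinearMap.star_eq_adjoint, ContinuousLinearMap.adjoint_inner_right]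

end BlockAlgebra

/-! ### The Hilbert space completion of $\pi(\Omega^2)$ -/

namespace GammaMatrices

variable {n : ℕ} (γ : GammaMatrices n) (Θ : Matrix (Fin n) (Fin n) ℝ)

theorem torusTriple_rep (a : SmoothTorus Θ) :
    (γ.torusTriple Θ).rep a = SmoothTorus.rep (Spinor n) a := rfl

variable {Θ}

theorem torusTriple_comm (a : SmoothTorus Θ) :
    (γ.torusTriple Θ).comm a =
      ∑ j, SmoothTorus.rep (Spinor n) (SmoothTorus.deriv j a) * constBlock (γ.clm j) := by
  have h : (γ.torusTriple Θ).IsComm a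
    (∑ j, γ.ampl j * SmoothTorus.rep (Spinor n) (SmoothTorus.deriv j a)) := γ.dirac_comm a
  rw [SpectralTriple.IsComm.unique _ ((γ.torusTriple Θ).isComm_comm a) h]
  exact Finset.sum_congr rfl fun j _ => constBlock_mul_rep _ _

theorem comm_mem_blockAlgebra (a : SmoothTorus Θ) :
    (γ.torusTriple Θ).comm a ∈ blockAlgebra Θ := by
  rw [torusTriple_comm]
  exact Submodule.sum_mem _ fun j _ => rep_mul_constBlock_mem _ _

theorem piOmega2_le_blockAlgebra : (γ.torusTriple Θ).piOmega2 ≤ blockAlgebra Θ := by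
  rintro _ ⟨w, rfl⟩
  induction w using SpectralTriple.univForm2_induction with
  | h0 => rw [map_zero]; exact Submodule.zero_mem _
  | h1 a b c =>
    rw [SpectralTriple.pi2_tmul]
    exact mul_mem_blockAlgebra (rep_mem_blockAlgebra a)
      (mul_mem_blockAlgebra (γ.comm_mem_blockAlgebra b) (γ.comm_mem_blockAlgebra c))
  | h2 x y hx hy => rw [map_add]; exact Submodule.add_mem _ hx hy

/-- The map `T ↦ (T (e_0 ⊗ v_i))_i` on `π(Ω²)`, scaled so as to be isometric for the inner product
`Tr_ω(T₁^* T₂ |D|^{-n})`. -/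
def vacuumMap (c : ℝ) : (γ.torusTriple Θ).piOmega2 →ₗ[ℂ]
    PiLp 2 fun _ : Fin (2 ^ (n / 2)) => TorusL2 n (Spinor n) where
  toFun T := WithLp.toLp 2 fun i => ((√(c / (2 ^ (n / 2) : ℕ)) : ℝ) : ℂ) •
    (T : TorusL2 n (Spinor n) →L[ℂ] TorusL2 n (Spinor n)) (vacuum i)
  map_add' S T := by
    ext1 i
    exact smul_add _ _ _
  map_smul' a T := by
    ext1 i
    exact smul_comm ((√(c / (2 ^ (n / 2) : ℕ)) : ℝ) : ℂ) a
      ((T : TorusL2 n (Spinor n) →L[ℂ] TorusL2 n (Spinor n)) (vacuum i))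

theorem inner_vacuumMap (hn : 0 < n) (ω : DixmierLimit) {c : ℝ} (hc : 0 < c)
    (h : dixmierTrace ω (absDiracInvPow n n) = c) (S T : (γ.torusTriple Θ).piOmega2) :
    ⟪γ.vacuumMap c S, γ.vacuumMap c T⟫_ℂ = dixmierTrace ω
      (star (S : TorusL2 n (Spinor n) →L[ℂ] TorusL2 n (Spinor n)) *
        (T : TorusL2 n (Spinor n) →L[ℂ] TorusL2 n (Spinor n)) * absDiracInvPow n n) := by
  rw [dixmierTrace_star_mul hn ω (γ.piOmega2_le_blockAlgebra S.2) (γ.piOmega2_le_blockAlgebra T.2),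
    h, PiLp.inner_apply, Finset.mul_sum]
  refine Finset.sum_congr rfl fun i _ => ?_
  change ⟪((√(c / (2 ^ (n / 2) : ℕ)) : ℝ) : ℂ) • (S : TorusL2 n (Spinor n) →L[ℂ] TorusL2 n (Spinor n)) (vacuum i),
    ((√(c / (2 ^ (n / 2) : ℕ)) : ℝ) : ℂ) • (T : TorusL2 n (Spinor n) →L[ℂ] TorusL2 n (Spinor n)) (vacuum i)⟫_ℂ = _
  rw [inner_smul_left, inner_smul_right, Complex.conj_ofReal, ← mul_assoc, ← Complex.ofReal_mul,
    Real.mul_self_sqrt (by positivity)]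
  push_cast
  rfl

/-- The form is the pullback of a genuine inner product along `vacuumMap`, whose scaling factor is
real because $\mathrm{Tr}_\omega(|D|^{-n})>0$. Completing the range of that map gives the required
space. -/
theorem nonempty_completion2 (hn : 0 < n) (ω : DixmierLimit) :
    Nonempty ((γ.torusTriple Θ).Completion2 ω (absDiracInvPow n n)) := by
  obtain ⟨c, hc, h⟩ := dixmierTrace_absDiracInvPow hn ω
  let L : (γ.torusTriple Θ).piOmega2 →ₗ[ℂ]
    PiLp 2 fun _ : Fin (2 ^ (n / 2)) => TorusL2 n (Spinor n) := γ.vacuumMap (Θ := Θ) c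
  exact ⟨{
    space := UniformSpace.Completion (LinearMap.range L)
    normed := inferInstance
    inner := UniformSpace.Completion.innerProductSpace
    complete := inferInstance
    emb := (UniformSpace.Completion.toComplₗᵢ
      (𝕜 := ℂ) (E := LinearMap.range L)).toLinearMap ∘ₗ L.rangeRestrict
    inner_emb := fun S T => (UniformSpace.Completion.inner_coe _ _).trans
      (γ.inner_vacuumMap hn ω hc h S T)
    dense := UniformSpace.Completion.denseRange_coe.comp
      L.surjective_rangeRestrict.denseRange (UniformSpace.Completion.continuous_coe _) }⟩

end GammaMatrices

/-! ### Antisymmetrized sums and the derivations of the torus -/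

section FiniteSums

theorem sum_sum_eq_sum_lt {ι M : Type*} [Fintype ι] [LinearOrder ι] [AddCommMonoid M]
    (f : ι → ι → M) :
    ∑ i, ∑ j, f i j = (∑ i, ∑ j, if i < j then f i j + f j i else 0) + ∑ i, f i i := by
  have h : ∀ i j, f i j = ((if i < j then f i j else 0) + (if j < i then f i j else 0)) +
      if i = j then f i j else 0 := by
    intro i j
    rcases lt_trichotomy i j with h | h | h
    · simp [h, h.not_gt, h.ne]
    · simp [h]
    · simp [h, h.not_gt, h.ne']
  have h2 : ∑ i, ∑ j, (if j < i then f i j else 0) = ∑ i, ∑ j, if i < j then f j i else 0 :=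
    Finset.sum_comm
  calc ∑ i, ∑ j, f i j = ∑ i, ∑ j, (((if i < j then f i j else 0) +
        (if j < i then f i j else 0)) + if i = j then f i j else 0) :=
        Finset.sum_congr rfl fun i _ => Finset.sum_congr rfl fun j _ => h i j
    _ = _ := by
        simp only [Finset.sum_add_distrib, h2, Finset.sum_ite_eq, Finset.mem_univ, if_true]
        rw [← Finset.sum_add_distrib]
        congr 1
        refine Finset.sum_congr rfl fun i _ => ?_
        rw [← Finset.sum_add_distrib]
        refine Finset.sum_congr rfl fun j _ => ?_
        split_ifs <;> simp

end FiniteSums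

namespace SmoothTorus

variable {n : ℕ} {Θ : Matrix (Fin n) (Fin n) ℝ}

theorem deriv_add (j : Fin n) (a b : SmoothTorus Θ) :
    deriv j (a + b) = deriv j a + deriv j b := ext fun r => by
  rw [coeff_add, coeff_deriv, coeff_deriv, coeff_deriv, coeff_add, mul_add]

theorem deriv_zero (j : Fin n) : deriv j (0 : SmoothTorus Θ) = 0 := ext fun r => by
  rw [coeff_deriv, coeff_zero, mul_zero]

theorem deriv_comm (j k : Fin n) (a : SmoothTorus Θ) :
    deriv j (deriv k a) = deriv k (deriv j a) := ext fun r => by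
  rw [coeff_deriv, coeff_deriv, coeff_deriv, coeff_deriv, mul_left_comm]

theorem deriv_mul (j : Fin n) (a b : SmoothTorus Θ) :
    deriv j (a * b) = deriv j a * b + a * deriv j b := by
  refine ext fun r => ?_
  rw [coeff_add, coeff_deriv, coeff_mul, coeff_mul, coeff_mul, ← tsum_mul_left,
    ← (summable_norm_conv (deriv j a) b r).of_norm.tsum_add
      (summable_norm_conv a (deriv j b) r).of_norm]
  refine tsum_congr fun s => ?_
  rw [coeff_deriv, coeff_deriv, Pi.sub_apply]
  push_cast
  ring

theorem deriv_gen (j k : Fin n) : deriv j (gen Θ k) = if j = k then gen Θ k else 0 :=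
  ext fun r => by
    rw [coeff_deriv, gen, coeff_monomial]
    split_ifs with h1 h2 h2
    · rw [h1, h2, coeff_monomial, if_pos rfl]
      simp
    · rw [h1, coeff_zero]
      simp [h2]
    · rw [coeff_monomial, if_neg h1, mul_zero]
    · rw [coeff_zero, mul_zero]

theorem deriv_star_gen (j k : Fin n) :
    deriv j (star (gen Θ k)) = if j = k then -star (gen Θ k) else 0 := by
  have hneg : ∀ (a : SmoothTorus Θ) r, (-a).coeff r = -a.coeff r := fun _ _ => rfl
  refine ext fun r => ?_
  rw [coeff_deriv, coeff_star, gen, coeff_monomial]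
  split_ifs with h1 h2 h2
  · rw [hneg, coeff_star, coeff_monomial, if_pos h1, ← neg_eq_iff_eq_neg.2 h1.symm, h2]
    simp
  · rw [coeff_zero, ← neg_eq_iff_eq_neg.2 h1.symm]
    simp [h2]
  · rw [hneg, coeff_star, coeff_monomial, if_neg h1]
    simp
  · rw [coeff_zero]
    simp

end SmoothTorus

/-! ### The one-forms as a free module on the $\sigma_j$ -/

namespace GammaMatrices

variable {n : ℕ} (γ : GammaMatrices n)

theorem clm_mul_self (j : Fin n) : γ.clm j * γ.clm j = 1 := by
  have h := γ.clm_mul_add j j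
  rw [if_pos rfl, ← two_smul ℂ] at h
  have h2 : (2 : Spinor n →L[ℂ] Spinor n) = (2 : ℂ) • 1 := by
    rw [two_smul, one_add_one_eq_two]
  rw [h2] at h
  exact smul_right_injective _ two_ne_zero h

theorem clm_anticomm {j k : Fin n} (h : j ≠ k) :
    γ.clm j * γ.clm k = -(γ.clm k * γ.clm j) := by
  have := γ.clm_mul_add j k
  rw [if_neg h] at this
  exact eq_neg_of_add_eq_zero_left this

variable {Θ : Matrix (Fin n) (Fin n) ℝ}

/-- The operators `1 ⊗ γ_j` are linearly independent over the noncommutative torus. -/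
theorem eq_zero_of_sum_rep_mul_clm_eq_zero {a : Fin n → SmoothTorus Θ}
    (h : ∑ j, SmoothTorus.rep (Spinor n) (a j) * constBlock (γ.clm j) = 0) (k : Fin n) :
    a k = 0 := by
  refine SmoothTorus.ext fun r => ?_
  -- Evaluating the relation at $e_0\otimes v$ and taking the component at `r` isolates the `r`-th
  -- Fourier coefficients.
  have hM : ∑ j, (a j).coeff r • γ.clm j = 0 := by
    ext1 v
    have h1 := congrArg (fun T : TorusL2 n (Spinor n) →L[ℂ] TorusL2 n (Spinor n) =>
      TorusL2.eval r (T (TorusL2.single 0 v))) h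
    simp only [_root_.sum_apply, map_sum] at h1
    rw [_root_.sum_apply]
    refine Eq.trans (Finset.sum_congr rfl fun j _ => ?_) h1
    change _ = (a j).op (Spinor n) (constBlock (γ.clm j) (TorusL2.single 0 v)) r
    rw [constBlock_single, SmoothTorus.op_single_zero]
    rfl
  -- The anticommutator with $\gamma_k$ annihilates every term except the `k`-th.
  have h2 : (∑ j, (a j).coeff r • γ.clm j) * γ.clm k + γ.clm k * (∑ j, (a j).coeff r • γ.clm j) =
      (a k).coeff r • 2 := by
    rw [Finset.sum_mul, Finset.mul_sum, ← Finset.sum_add_distrib, Finset.sum_eq_single k]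
    · rw [smul_mul_assoc, mul_smul_comm, ← smul_add, clm_mul_add, if_pos rfl]
    · intro j _ hj
      rw [smul_mul_assoc, mul_smul_comm, ← smul_add, clm_mul_add, if_neg hj, smul_zero]
    · simp
  rw [hM, zero_mul, mul_zero, add_zero] at h2
  rcases smul_eq_zero.1 h2.symm with h3 | h3
  · exact h3
  · exact absurd h3 two_ne_zero

theorem torusTriple_comm_gen (j : Fin n) :
    (γ.torusTriple Θ).comm (SmoothTorus.gen Θ j) =
      SmoothTorus.rep (Spinor n) (SmoothTorus.gen Θ j) * constBlock (γ.clm j) := by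
  rw [torusTriple_comm, Finset.sum_eq_single j]
  · rw [SmoothTorus.deriv_gen, if_pos rfl]
  · intro k _ hk
    rw [SmoothTorus.deriv_gen, if_neg hk, map_zero, zero_mul]
  · simp

theorem torusTriple_comm_star_gen (j : Fin n) :
    (γ.torusTriple Θ).comm (star (SmoothTorus.gen Θ j)) =
      -(SmoothTorus.rep (Spinor n) (star (SmoothTorus.gen Θ j)) * constBlock (γ.clm j)) := by
  rw [torusTriple_comm, Finset.sum_eq_single j]
  · rw [SmoothTorus.deriv_star_gen, if_pos rfl, map_neg, neg_mul]
  · intro k _ hk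
    rw [SmoothTorus.deriv_star_gen, if_neg hk, map_zero, zero_mul]
  · simp

/-- Only $\delta_j$ acts nontrivially on $U_j$, so $[D,U_j]=U_j\otimes\gamma_j$ and the unitary
cancels. The one-form is thus constant and commutes with the algebra. -/
theorem coe_sigma (j : Fin n) :
    (γ.sigma Θ j : TorusL2 n (Spinor n) →L[ℂ] TorusL2 n (Spinor n)) = constBlock (γ.clm j) := by
  change (γ.torusTriple Θ).rep (star (SmoothTorus.gen Θ j)) *
    (γ.torusTriple Θ).comm (SmoothTorus.gen Θ j) = _
  rw [torusTriple_comm_gen, torusTriple_rep, ← mul_assoc, ← map_mul,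
    (SmoothTorus.gen_mem_unitary j).1, map_one, one_mul]

theorem coe_sum_smul_sigma (a : Fin n → SmoothTorus Θ) :
    ((∑ j, a j • γ.sigma Θ j : (γ.torusTriple Θ).Omega1) :
      TorusL2 n (Spinor n) →L[ℂ] TorusL2 n (Spinor n)) =
      ∑ j, SmoothTorus.rep (Spinor n) (a j) * constBlock (γ.clm j) := by
  rw [Submodule.coe_sum]
  refine Finset.sum_congr rfl fun j _ => ?_
  rw [SpectralTriple.Omega1.coe_smul, coe_sigma]
  rfl

theorem linearIndependent_sigma : LinearIndependent (SmoothTorus Θ) (γ.sigma Θ) := by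
  rw [Fintype.linearIndependent_iff]
  intro a h
  refine γ.eq_zero_of_sum_rep_mul_clm_eq_zero ?_
  rw [← coe_sum_smul_sigma, h]
  rfl

theorem d0_eq_sum (a : SmoothTorus Θ) :
    (γ.torusTriple Θ).d0 a = ∑ j, SmoothTorus.deriv j a • γ.sigma Θ j := by
  refine Subtype.ext ?_
  rw [coe_sum_smul_sigma]
  exact γ.torusTriple_comm a

theorem span_sigma : ⊤ ≤ Submodule.span (SmoothTorus Θ) (Set.range (γ.sigma Θ)) := by
  rintro ⟨_, w, rfl⟩ -
  induction w using SpectralTriple.univForm1_induction with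
  | h0 =>
    have : (⟨(γ.torusTriple Θ).pi1 0, 0, rfl⟩ : (γ.torusTriple Θ).Omega1) = 0 :=
      Subtype.ext (map_zero _)
    rw [this]
    exact Submodule.zero_mem _
  | h1 a b =>
    have : (⟨_, a ⊗ₜ[ℂ] (Submodule.Quotient.mk b), rfl⟩ : (γ.torusTriple Θ).Omega1) =
      a • (γ.torusTriple Θ).d0 b := Subtype.ext ((γ.torusTriple Θ).pi1_tmul a b)
    rw [this, d0_eq_sum]
    exact Submodule.smul_mem _ _ (Submodule.sum_mem _ fun j _ =>
      Submodule.smul_mem _ _ (Submodule.subset_span ⟨j, rfl⟩))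
  | h2 x y hx hy =>
    have : (⟨_, x + y, rfl⟩ : (γ.torusTriple Θ).Omega1) = ⟨_, x, rfl⟩ + ⟨_, y, rfl⟩ :=
      Subtype.ext (map_add _ _ _)
    rw [this]
    exact Submodule.add_mem _ hx hy

variable (Θ) in
/-- The forms `σ_j` as a basis of the left module `Ω¹_D`. -/
def sigmaBasis : Module.Basis (Fin n) (SmoothTorus Θ) (γ.torusTriple Θ).Omega1 :=
  .mk γ.linearIndependent_sigma γ.span_sigma

theorem sigmaBasis_apply (j : Fin n) : γ.sigmaBasis Θ j = γ.sigma Θ j :=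
  Module.Basis.mk_apply _ _ j

/-- The coefficient of `σ_j` in a one-form. -/
def formCoeff (j : Fin n) : (γ.torusTriple Θ).Omega1 →ₗ[SmoothTorus Θ] SmoothTorus Θ :=
  (γ.sigmaBasis Θ).coord j

theorem formCoeff_sigma (j k : Fin n) :
    γ.formCoeff j (γ.sigma Θ k) = if k = j then 1 else 0 := by
  rw [← sigmaBasis_apply, formCoeff, Module.Basis.coord_apply, Module.Basis.repr_self,
    Finsupp.single_apply]

theorem sum_formCoeff_smul (w : (γ.torusTriple Θ).Omega1) :
    ∑ j, γ.formCoeff j w • γ.sigma Θ j = w := by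
  have h := (γ.sigmaBasis Θ).sum_repr w
  simp only [sigmaBasis_apply] at h
  exact h

theorem formCoeff_sum (a : Fin n → SmoothTorus Θ) (j : Fin n) :
    γ.formCoeff j (∑ k, a k • γ.sigma Θ k) = a j := by
  rw [map_sum, Finset.sum_eq_single j]
  · rw [map_smul, formCoeff_sigma, if_pos rfl, smul_eq_mul, mul_one]
  · intro k _ hk
    rw [map_smul, formCoeff_sigma, if_neg hk, smul_zero]
  · simp

theorem formCoeff_d0 (j : Fin n) (a : SmoothTorus Θ) :
    γ.formCoeff j ((γ.torusTriple Θ).d0 a) = SmoothTorus.deriv j a := by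
  rw [d0_eq_sum, formCoeff_sum]

/-- Because the $\sigma_k$ commute with the algebra, a factor on the right of a form passes to the
right of its coefficients. -/
theorem formCoeff_rmul1 (j : Fin n) (a : SmoothTorus Θ) (w : (γ.torusTriple Θ).Omega1) :
    γ.formCoeff j ((γ.torusTriple Θ).rmul1 a w) = γ.formCoeff j w * a := by
  have h : (γ.torusTriple Θ).rmul1 a w = ∑ k, (γ.formCoeff k w * a) • γ.sigma Θ k := by
    refine Subtype.ext ?_
    rw [coe_sum_smul_sigma]
    change (w : TorusL2 n (Spinor n) →L[ℂ] TorusL2 n (Spinor n)) *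
      SmoothTorus.rep (Spinor n) a = _
    conv_lhs => rw [← γ.sum_formCoeff_smul w, coe_sum_smul_sigma, Finset.sum_mul]
    refine Finset.sum_congr rfl fun k _ => ?_
    rw [map_mul, mul_assoc, constBlock_mul_rep, mul_assoc]
  rw [h, formCoeff_sum]

end GammaMatrices

/-! ### The subspace $\pi(dJ_0^1)$ and the relations in $\Omega^2_D$ -/

namespace GammaMatrices

variable {n : ℕ} (γ : GammaMatrices n) {Θ : Matrix (Fin n) (Fin n) ℝ}

theorem comm_star_gen_mul_comm_gen (j : Fin n) :
    (γ.torusTriple Θ).comm (star (SmoothTorus.gen Θ j)) *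
      (γ.torusTriple Θ).comm (SmoothTorus.gen Θ j) = -1 := by
  rw [torusTriple_comm_star_gen, torusTriple_comm_gen, neg_mul, rep_mul_constBlock_mul,
    (SmoothTorus.gen_mem_unitary j).1, clm_mul_self, map_one, constBlock_one, one_mul]

theorem comm_gen_mul_comm_star_gen (j : Fin n) :
    (γ.torusTriple Θ).comm (SmoothTorus.gen Θ j) *
      (γ.torusTriple Θ).comm (star (SmoothTorus.gen Θ j)) = -1 := by
  rw [torusTriple_comm_star_gen, torusTriple_comm_gen, mul_neg, rep_mul_constBlock_mul,
    (SmoothTorus.gen_mem_unitary j).2, clm_mul_self, map_one, constBlock_one, one_mul]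

/-- For a generator $U$, the form $w=U^*dU+U\,dU^*$ satisfies $\pi(w)=0$, the two terms being
$\pm\sigma$, while $\pi(dw)=-2$. Since $\pi(w)=0$, left multiplication by $-a/2$ keeps the form in
the kernel and multiplies $\pi(dw)$ to give `a`. -/
theorem mem_piDJ_of_eq_rep (hn : 0 < n) (a : SmoothTorus Θ) (T : (γ.torusTriple Θ).piOmega2)
    (hT : (T : TorusL2 n (Spinor n) →L[ℂ] TorusL2 n (Spinor n)) = SmoothTorus.rep (Spinor n) a) :
    T ∈ (γ.torusTriple Θ).piDJ := by
  let U := SmoothTorus.gen Θ ⟨0, hn⟩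
  let w : UnivForm1 (SmoothTorus Θ) := star U ⊗ₜ[ℂ] (Submodule.Quotient.mk U) +
    U ⊗ₜ[ℂ] (Submodule.Quotient.mk (star U))
  have h1 : (γ.torusTriple Θ).pi1 w = 0 := by
    rw [map_add, SpectralTriple.pi1_tmul, SpectralTriple.pi1_tmul, torusTriple_comm_star_gen,
      torusTriple_comm_gen, torusTriple_rep, torusTriple_rep, mul_neg, ← mul_assoc, ← mul_assoc,
      ← map_mul, ← map_mul, (SmoothTorus.gen_mem_unitary _).1, (SmoothTorus.gen_mem_unitary _).2,
      add_neg_cancel]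
  have h2 : (γ.torusTriple Θ).pi2 (univD1 _ w) = (-2 : ℂ) • 1 := by
    rw [map_add, map_add, SpectralTriple.pi2_d_tmul, SpectralTriple.pi2_d_tmul,
      comm_star_gen_mul_comm_gen, comm_gen_mul_comm_star_gen, neg_smul, two_smul, neg_add]
  refine ⟨univLmul1 _ ((-2⁻¹ : ℂ) • a) w, ?_, Subtype.ext ?_⟩
  · change (γ.torusTriple Θ).pi1 _ = 0
    rw [SpectralTriple.pi1_lmul, h1, mul_zero]
  · change (γ.torusTriple Θ).pi2 (univD1 _ (univLmul1 _ ((-2⁻¹ : ℂ) • a) w)) = _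
    rw [SpectralTriple.pi2_d_lmul, h1, h2, hT, mul_zero, zero_add, torusTriple_rep, map_smul,
      smul_mul_smul_comm, mul_one]
    norm_num

/-- For $w=x\,dy$ the coefficients of $\pi(w)$ are $a_j=x\,\delta_jy$, and the Leibniz rule splits
$\delta_ma_j$ into the coefficient $\delta_mx\,\delta_jy$ of $\pi(dw)$ and the term
$x\,\delta_m\delta_jy$, symmetric because the derivations commute. All four properties are additive
in `w`. -/
theorem exists_symmetric_decomposition (w : UnivForm1 (SmoothTorus Θ)) :
    ∃ (a : Fin n → SmoothTorus Θ) (b c : Fin n → Fin n → SmoothTorus Θ),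
      (γ.torusTriple Θ).pi1 w =
        ∑ j, SmoothTorus.rep (Spinor n) (a j) * constBlock (γ.clm j) ∧
      (γ.torusTriple Θ).pi2 (univD1 _ w) =
        ∑ m, ∑ j, SmoothTorus.rep (Spinor n) (b m j) * constBlock (γ.clm m * γ.clm j) ∧
      (∀ m j, c m j = c j m) ∧ ∀ m j, SmoothTorus.deriv m (a j) = b m j + c m j := by
  induction w using SpectralTriple.univForm1_induction with
  | h0 =>
    refine ⟨0, 0, 0, ?_, ?_, fun _ _ => rfl, fun m j => ?_⟩
    · simp
    · simp
    · simp [SmoothTorus.deriv_zero]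
  | h1 x y =>
    refine ⟨fun j => x * SmoothTorus.deriv j y,
      fun m j => SmoothTorus.deriv m x * SmoothTorus.deriv j y,
      fun m j => x * SmoothTorus.deriv m (SmoothTorus.deriv j y), ?_, ?_, ?_, ?_⟩
    · rw [SpectralTriple.pi1_tmul, torusTriple_comm, torusTriple_rep, Finset.mul_sum]
      simp only [map_mul, mul_assoc]
    · rw [SpectralTriple.pi2_d_tmul, torusTriple_comm, torusTriple_comm, Finset.sum_mul]
      simp only [Finset.mul_sum, rep_mul_constBlock_mul]
    · intro m j
      exact congrArg (x * ·) (SmoothTorus.deriv_comm m j y)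
    · intro m j
      exact SmoothTorus.deriv_mul m x _
  | h2 x y hx hy =>
    obtain ⟨a, b, c, h1, h2, h3, h4⟩ := hx
    obtain ⟨a', b', c', h1', h2', h3', h4'⟩ := hy
    refine ⟨a + a', b + b', c + c', ?_, ?_, ?_, ?_⟩
    · simp only [map_add, h1, h1', Pi.add_apply, add_mul, Finset.sum_add_distrib]
    · simp only [map_add, h2, h2', Pi.add_apply, add_mul, Finset.sum_add_distrib]
    · intro m j
      simp only [Pi.add_apply, h3 m j, h3' m j]
    · intro m j
      simp only [Pi.add_apply, SmoothTorus.deriv_add, h4, h4']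
      abel

/-- When $\pi(w)=0$ the coefficients $a_j$ vanish, so $b=-c$ is symmetric. The off-diagonal terms
then cancel by anticommutation, and the diagonal ones have $\gamma_m^2=1$, leaving the algebra
element $\sum_mb_{mm}$. -/
theorem exists_eq_rep_of_mem_piDJ {T : (γ.torusTriple Θ).piOmega2}
    (hT : T ∈ (γ.torusTriple Θ).piDJ) : ∃ a : SmoothTorus Θ,
      (T : TorusL2 n (Spinor n) →L[ℂ] TorusL2 n (Spinor n)) = SmoothTorus.rep (Spinor n) a := by
  obtain ⟨w, hw, rfl⟩ := hT
  have hw' : (γ.torusTriple Θ).pi1 w = 0 := hw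
  obtain ⟨a, b, c, h1, h2, h3, h4⟩ := γ.exists_symmetric_decomposition w
  rw [hw'] at h1
  have ha := γ.eq_zero_of_sum_rep_mul_clm_eq_zero h1.symm
  have hb : ∀ m j, b m j = -c m j := fun m j => by
    have := h4 m j
    rw [ha, SmoothTorus.deriv_zero] at this
    exact eq_neg_of_add_eq_zero_left this.symm
  refine ⟨∑ m, b m m, ?_⟩
  change (γ.torusTriple Θ).pi2 (univD1 _ w) = _
  rw [h2, sum_sum_eq_sum_lt, map_sum]
  have hz : (∑ m, ∑ j, if m < j then
      SmoothTorus.rep (Spinor n) (b m j) * constBlock (γ.clm m * γ.clm j) +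
        SmoothTorus.rep (Spinor n) (b j m) * constBlock (γ.clm j * γ.clm m) else 0) = 0 := by
    refine Finset.sum_eq_zero fun m _ => Finset.sum_eq_zero fun j _ => ?_
    split_ifs with h
    · have e : constBlock (-(γ.clm j * γ.clm m)) = -constBlock (γ.clm j * γ.clm m) :=
        map_neg constBlockₗ _
      rw [hb m j, hb j m, h3 j m, γ.clm_anticomm h.ne, e, mul_neg, neg_add_cancel]
    · rfl
  rw [hz, zero_add]
  refine Finset.sum_congr rfl fun m _ => ?_
  rw [clm_mul_self, constBlock_one, mul_one]

/-- The two-form `σ_m σ_j` before passing to the quotient. -/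
def sigmaMul (Θ : Matrix (Fin n) (Fin n) ℝ) (m j : Fin n) : (γ.torusTriple Θ).piOmega2 :=
  ⟨constBlock (γ.clm m * γ.clm j), by
    have h := (γ.torusTriple Θ).mul_mem_piOmega2 (γ.sigma Θ m).2 (γ.sigma Θ j).2
    rwa [coe_sigma, coe_sigma, ← constBlock_mul] at h⟩

theorem mul11_sigma (m j : Fin n) :
    (γ.torusTriple Θ).mul11 (γ.sigma Θ m) (γ.sigma Θ j) =
      (γ.torusTriple Θ).piDJ.mkQ (γ.sigmaMul Θ m j) := by
  change (γ.torusTriple Θ).piDJ.mkQ _ = _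
  congr 1
  refine Subtype.ext ?_
  change (γ.sigma Θ m : TorusL2 n (Spinor n) →L[ℂ] TorusL2 n (Spinor n)) * (γ.sigma Θ j :
    TorusL2 n (Spinor n) →L[ℂ] TorusL2 n (Spinor n)) = constBlock (γ.clm m * γ.clm j)
  rw [coe_sigma, coe_sigma, constBlock_mul]

theorem mul11_sigma_self (m : Fin n) :
    (γ.torusTriple Θ).mul11 (γ.sigma Θ m) (γ.sigma Θ m) = 0 := by
  rw [mul11_sigma, Submodule.mkQ_apply, Submodule.Quotient.mk_eq_zero]
  refine γ.mem_piDJ_of_eq_rep (Fin.pos m) 1 _ ?_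
  change constBlock (γ.clm m * γ.clm m) = _
  rw [clm_mul_self, constBlock_one, map_one]

theorem mul11_sigma_anticomm {m j : Fin n} (h : m ≠ j) :
    (γ.torusTriple Θ).mul11 (γ.sigma Θ j) (γ.sigma Θ m) =
      -(γ.torusTriple Θ).mul11 (γ.sigma Θ m) (γ.sigma Θ j) := by
  rw [mul11_sigma, mul11_sigma, ← map_neg]
  congr 1
  refine Subtype.ext ?_
  change constBlock (γ.clm j * γ.clm m) = -constBlock (γ.clm m * γ.clm j)
  rw [γ.clm_anticomm h.symm]
  exact map_neg constBlockₗ _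

/-- The form $dU_j^*\,dU_j$ is represented by the scalar `-1`, which lies in $\pi(dJ_0^1)$. -/
theorem d1_sigma (j : Fin n) : (γ.torusTriple Θ).d1 (γ.sigma Θ j) = 0 := by
  let U := SmoothTorus.gen Θ j
  have e : γ.sigma Θ j = ⟨(γ.torusTriple Θ).pi1 (star U ⊗ₜ[ℂ] (Submodule.Quotient.mk U)), _, rfl⟩ :=
    rfl
  rw [e, SpectralTriple.d1_pi1, Submodule.mkQ_apply, Submodule.Quotient.mk_eq_zero]
  refine γ.mem_piDJ_of_eq_rep (Fin.pos j) (-1) _ ?_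
  change (γ.torusTriple Θ).pi2 (univD1 _ (star U ⊗ₜ[ℂ] (Submodule.Quotient.mk U))) = _
  rw [SpectralTriple.pi2_d_tmul, comm_star_gen_mul_comm_gen, map_neg, map_one]

/-! ### Connections and curvature in components -/

variable {q : ℕ} {p : Matrix (Fin q) (Fin q) (SmoothTorus Θ)}

/-- The component of `σ_j` in `E ⊗_A Ω¹_D`. -/
def tensorCoeff (p : Matrix (Fin q) (Fin q) (SmoothTorus Θ)) (j : Fin n) :
    BalTensor (SmoothTorus Θ) (projModule p) (γ.torusTriple Θ).Omega1 →ₗ[ℂ] projModule p :=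
  BalTensor.lift
    (LinearMap.mk₂ ℂ (fun x w => MulOpposite.op (γ.formCoeff j w) • x)
      (fun x x' w => smul_add _ _ _)
      (fun c x w => smul_comm _ _ _)
      (fun x w w' => by rw [map_add, MulOpposite.op_add, add_smul])
      (fun c x w => by
        rw [LinearMap.map_smul_of_tower, MulOpposite.op_smul, smul_assoc]))
    (fun x a w => by
      simp only [LinearMap.mk₂_apply, map_smul, smul_eq_mul, MulOpposite.op_mul, mul_smul])

theorem tensorCoeff_btmul (j : Fin n) (x : projModule p) (w : (γ.torusTriple Θ).Omega1) :
    γ.tensorCoeff p j (btmul (SmoothTorus Θ) x w) = MulOpposite.op (γ.formCoeff j w) • x :=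
  BalTensor.lift_btmul _ _ _ _

theorem sum_btmul_tensorCoeff
    (t : BalTensor (SmoothTorus Θ) (projModule p) (γ.torusTriple Θ).Omega1) :
    ∑ j, btmul (SmoothTorus Θ) (γ.tensorCoeff p j t) (γ.sigma Θ j) = t := by
  have h : ∑ j, (btmulₗ (SmoothTorus Θ) (projModule p) (γ.torusTriple Θ).Omega1).flip
      (γ.sigma Θ j) ∘ₗ γ.tensorCoeff p j = LinearMap.id := by
    refine BalTensor.hom_ext fun x w => ?_
    simp only [LinearMap.sum_apply, LinearMap.comp_apply, LinearMap.flip_apply, tensorCoeff_btmul,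
      btmulₗ_apply, LinearMap.id_apply, btmul_balanced]
    simp only [← btmulₗ_apply]
    rw [← map_sum, sum_formCoeff_smul]
  have h2 := LinearMap.congr_fun h t
  simpa only [LinearMap.sum_apply, LinearMap.comp_apply, LinearMap.flip_apply, btmulₗ_apply,
    LinearMap.id_apply] using h2

theorem tensorCoeff_sum (j : Fin n) (x : Fin n → projModule p) :
    γ.tensorCoeff p j (∑ k, btmul (SmoothTorus Θ) (x k) (γ.sigma Θ k)) = x j := by
  rw [map_sum, Finset.sum_eq_single j]
  · rw [tensorCoeff_btmul, formCoeff_sigma, if_pos rfl, MulOpposite.op_one, one_smul]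
  · intro k _ hk
    rw [tensorCoeff_btmul, formCoeff_sigma, if_neg hk, MulOpposite.op_zero, zero_smul]
  · simp

theorem tensorCoeff_tensorRmul (j : Fin n) (a : SmoothTorus Θ)
    (t : BalTensor (SmoothTorus Θ) (projModule p) (γ.torusTriple Θ).Omega1) :
    γ.tensorCoeff p j ((γ.torusTriple Θ).tensorRmul p a t) =
      MulOpposite.op a • γ.tensorCoeff p j t := by
  rw [← γ.sum_btmul_tensorCoeff t, map_sum, map_sum, tensorCoeff_sum, Finset.sum_eq_single j]
  · rw [SpectralTriple.tensorRmul, BalTensor.lift_btmul, LinearMap.compl₂_apply, btmulₗ_apply,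
      tensorCoeff_btmul, formCoeff_rmul1, formCoeff_sigma, if_pos rfl, one_mul]
  · intro k _ hk
    rw [SpectralTriple.tensorRmul, BalTensor.lift_btmul, LinearMap.compl₂_apply, btmulₗ_apply,
      tensorCoeff_btmul, formCoeff_rmul1, formCoeff_sigma, if_neg hk, zero_mul,
      MulOpposite.op_zero, zero_smul]
  · simp

theorem existsUnique_isComponents (nabla : (γ.torusTriple Θ).CompatibleConnection p) :
    ∃! comp, γ.IsComponents nabla comp := by
  refine ⟨fun j => γ.tensorCoeff p j ∘ₗ nabla.toFun, fun ξ => ?_, fun comp h => ?_⟩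
  · exact (γ.sum_btmul_tensorCoeff _).symm
  · funext j
    ext1 ξ
    change comp j ξ = γ.tensorCoeff p j (nabla.toFun ξ)
    rw [h ξ, tensorCoeff_sum]

section Components

variable {γ} {nabla : (γ.torusTriple Θ).CompatibleConnection p}
  {comp : Fin n → projModule p →ₗ[ℂ] projModule p}

theorem IsComponents.leibniz (hcomp : γ.IsComponents nabla comp) (j : Fin n) (ξ : projModule p)
    (a : SmoothTorus Θ) :
    comp j (MulOpposite.op a • ξ) =
      MulOpposite.op a • comp j ξ + MulOpposite.op (SmoothTorus.deriv j a) • ξ := by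
  have h : ∀ ξ, comp j ξ = γ.tensorCoeff p j (nabla.toFun ξ) := fun ξ => by
    rw [hcomp ξ, tensorCoeff_sum]
  rw [h, h, nabla.leibniz, map_add, tensorCoeff_tensorRmul, tensorCoeff_btmul, formCoeff_d0]

/-- The commutator `[∇_m, ∇_j]` as an endomorphism of the right module. -/
def IsComponents.commutator (hcomp : γ.IsComponents nabla comp) (m j : Fin n) :
    Module.End (SmoothTorus Θ)ᵐᵒᵖ (projModule p) where
  toFun ξ := comp m (comp j ξ) - comp j (comp m ξ)
  map_add' ξ η := by
    simp only [map_add]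
    abel
  map_smul' a ξ := by
    obtain ⟨a, rfl⟩ := MulOpposite.op_surjective a
    -- Applying the Leibniz rule twice produces mixed first order terms and the second order term
    -- $\xi\,\delta_m\delta_ja$; both are symmetric in `m` and `j` and drop out of the commutator.
    simp only [hcomp.leibniz, map_add, SmoothTorus.deriv_comm m j, RingHom.id_apply, smul_sub]
    abel

/-- Since $d\sigma_j=0$, the extension of the connection sends $\nabla_j\xi\otimes\sigma_j$ to
$(\nabla\nabla_j\xi)\sigma_j$ alone. -/
theorem IsComponents.curvature_eq (hcomp : γ.IsComponents nabla comp) (ξ : projModule p) :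
    nabla.curvature ξ = ∑ m, ∑ j, btmul (SmoothTorus Θ) (comp m (comp j ξ))
      ((γ.torusTriple Θ).mul11 (γ.sigma Θ m) (γ.sigma Θ j)) := by
  have h : ∀ j, nabla.extend (btmul (SmoothTorus Θ) (comp j ξ) (γ.sigma Θ j)) =
      ∑ m, btmul (SmoothTorus Θ) (comp m (comp j ξ))
        ((γ.torusTriple Θ).mul11 (γ.sigma Θ m) (γ.sigma Θ j)) := by
    intro j
    rw [SpectralTriple.CompatibleConnection.extend, BalTensor.lift_btmul, LinearMap.add_apply,
      LinearMap.add_apply, LinearMap.comp_apply, LinearMap.compl₂_apply, d1_sigma, map_zero,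
      add_zero, hcomp, map_sum, LinearMap.sum_apply]
    refine Finset.sum_congr rfl fun m _ => ?_
    rw [SpectralTriple.tensorMulForm, BalTensor.lift_btmul]
    rfl
  change nabla.extend (nabla.toFun ξ) = _
  rw [hcomp, map_sum, Finset.sum_comm]
  exact Finset.sum_congr rfl fun j _ => h j

/-- Squares vanish and products anticommute in $\Omega^2_D$, so pairing the indices $(m,j)$ and
$(j,m)$ turns the second order expression into commutators. -/
theorem IsComponents.coord_curvature (hcomp : γ.IsComponents nabla comp) (ξ : projModule p)
    (s : Fin q) :
    (γ.torusTriple Θ).coord p s (nabla.curvature ξ) = ∑ m, ∑ j, if m < j then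
      (hcomp.commutator m j ξ).1 s •
        (γ.torusTriple Θ).mul11 (γ.sigma Θ m) (γ.sigma Θ j) else 0 := by
  have h : (γ.torusTriple Θ).coord p s (nabla.curvature ξ) = ∑ m, ∑ j,
      (comp m (comp j ξ)).1 s • (γ.torusTriple Θ).mul11 (γ.sigma Θ m) (γ.sigma Θ j) := by
    simp only [hcomp.curvature_eq, map_sum, SpectralTriple.coord, BalTensor.lift_btmul]
    rfl
  rw [h, sum_sum_eq_sum_lt]
  simp only [mul11_sigma_self, smul_zero, Finset.sum_const_zero, add_zero]
  refine Finset.sum_congr rfl fun m _ => Finset.sum_congr rfl fun j _ => ?_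
  split_ifs with hmj
  · rw [γ.mul11_sigma_anticomm hmj.ne, smul_neg, ← sub_eq_add_neg, ← sub_smul]
    rfl
  · rfl

end Components

end GammaMatrices

/-! ### Orthogonal representatives of two-forms and the Yang–Mills functional -/

theorem projCompl_of_mem_orthogonal {K : Type} [NormedAddCommGroup K] [InnerProductSpace ℂ K]
    [CompleteSpace K] (W : Submodule ℂ K) {x : K} (hx : x ∈ Wᗮ) : projCompl W x = x := by
  change Wᗮ.starProjection x = x
  rwa [Submodule.starProjection_eq_self_iff]

namespace SpectralTriple

variable {A H : Type} [Ring A] [StarRing A] [Algebra ℂ A]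
    [NormedAddCommGroup H] [InnerProductSpace ℂ H] [CompleteSpace H]
    {S : SpectralTriple A H} {ω : DixmierLimit} {R : H →L[ℂ] H}

/-- A two-form orthogonal to `π(d J₀¹)` represents its own class. -/
theorem Completion2.proj_mkQ_of_orthogonal (𝒦 : S.Completion2 ω R) (T : S.piOmega2)
    (h : ∀ W ∈ S.piDJ, dixmierTrace ω (star (W : H →L[ℂ] H) * (T : H →L[ℂ] H) * R) = 0) :
    𝒦.proj (S.piDJ.mkQ T) = 𝒦.emb T := by
  change projCompl (S.piDJ.map 𝒦.emb) (𝒦.emb T) = 𝒦.emb T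
  refine projCompl_of_mem_orthogonal _ ?_
  rw [Submodule.mem_orthogonal]
  rintro _ ⟨W, hW, rfl⟩
  rw [𝒦.inner_emb]
  exact h W hW

end SpectralTriple

namespace GammaMatrices

variable {n : ℕ} (hn : 0 < n) (ω : DixmierLimit) (γ : GammaMatrices n)

/-- The self-adjoint unitary $1\otimes\gamma_a$ commutes with $|D|^{-n}$ and conjugates $1\otimes M$
into its negative. -/
theorem diracFunctional_constBlock_eq_zero (a : Fin n) {M : Spinor n →L[ℂ] Spinor n}
    (h : γ.clm a * M = -(M * γ.clm a)) : diracFunctional hn ω (constBlock M) = 0 := by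
  have hu : constBlock (γ.clm a) * constBlock (γ.clm a) = 1 := by
    rw [← constBlock_mul, clm_mul_self, constBlock_one]
  have hs : star (constBlock (γ.clm a)) = constBlock (γ.clm a) := by
    rw [star_constBlock, star_clm]
  have h1 := diracFunctional_conj hn ω (u := constBlock (γ.clm a)) (by rw [hs, hu])
    (by rw [hs, hu]) (constBlock_mul_absDiracInvPow _ n) (constBlock M)
  have e : constBlock (γ.clm a) * constBlock M * star (constBlock (γ.clm a)) = -constBlock M := by
    rw [hs, ← constBlock_mul, ← constBlock_mul, h, neg_mul, mul_assoc, clm_mul_self, mul_one]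
    exact map_neg constBlockₗ M
  rw [e, map_neg] at h1
  exact self_eq_neg.1 h1.symm

theorem diracFunctional_clm_mul {m j : Fin n} (h : m ≠ j) :
    diracFunctional hn ω (constBlock (γ.clm m * γ.clm j)) = 0 := by
  refine γ.diracFunctional_constBlock_eq_zero hn ω m ?_
  rw [mul_assoc, γ.clm_anticomm h.symm, mul_neg, neg_neg]

/-- The products `γ_m γ_j`, `m < j`, are orthonormal for the normalized trace. -/
theorem diracFunctional_star_clm_mul {m j k l : Fin n} (hmj : m < j) (hkl : k < l) :
    diracFunctional hn ω (constBlock (star (γ.clm m * γ.clm j) * (γ.clm k * γ.clm l))) =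
      if m = k ∧ j = l then dixmierTrace ω (absDiracInvPow n n) else 0 := by
  rw [star_mul, star_clm, star_clm]
  split_ifs with h
  · obtain ⟨rfl, rfl⟩ := h
    rw [mul_assoc, ← mul_assoc (γ.clm m), clm_mul_self, one_mul, clm_mul_self, constBlock_one,
      diracFunctional_apply, one_mul]
  -- A gamma matrix commutes with a product of two gammas not containing its index, and anticommutes
  -- with one in which its index occurs exactly once.
  · have key : ∀ a b x : Fin n, x ≠ k → x ≠ l → (x = a ∧ x ≠ b ∨ x ≠ a ∧ x = b) →
        γ.clm x * (γ.clm a * γ.clm b * (γ.clm k * γ.clm l)) =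
          -(γ.clm a * γ.clm b * (γ.clm k * γ.clm l) * γ.clm x) := by
      intro a b x hk hl hab
      have e1 : γ.clm k * γ.clm l * γ.clm x = γ.clm x * (γ.clm k * γ.clm l) := by
        rw [mul_assoc, γ.clm_anticomm hl.symm, mul_neg, ← mul_assoc, γ.clm_anticomm hk.symm,
          neg_mul, neg_neg, mul_assoc]
      have e2 : γ.clm x * (γ.clm a * γ.clm b) = -(γ.clm a * γ.clm b * γ.clm x) := by
        rcases hab with ⟨rfl, hb⟩ | ⟨ha, rfl⟩
        · rw [mul_assoc (γ.clm x) (γ.clm b), γ.clm_anticomm hb.symm, mul_neg, neg_neg]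
        · rw [← mul_assoc, γ.clm_anticomm ha, neg_mul]
      rw [mul_assoc _ _ (γ.clm x), e1, ← mul_assoc, e2, neg_mul, mul_assoc _ (γ.clm x)]
    -- Two different ordered pairs always leave an index of the first outside the second: `m` if
    -- possible, and otherwise `j`, by the orderings `m < j` and `k < l`.
    by_cases hm : m = k ∨ m = l
    · have hj : j ≠ k ∧ j ≠ l := by
        refine ⟨?_, ?_⟩
        · rintro rfl
          rcases hm with rfl | rfl
          · exact lt_irrefl _ hmj
          · exact lt_asymm hmj hkl
        · rintro rfl
          rcases hm with rfl | rfl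
          · exact h ⟨rfl, rfl⟩
          · exact lt_irrefl _ hmj
      exact γ.diracFunctional_constBlock_eq_zero hn ω j
        (key j m j hj.1 hj.2 (Or.inl ⟨rfl, hmj.ne'⟩))
    · rw [not_or] at hm
      exact γ.diracFunctional_constBlock_eq_zero hn ω m
        (key j m m hm.1 hm.2 (Or.inr ⟨hmj.ne, rfl⟩))

variable {Θ : Matrix (Fin n) (Fin n) ℝ}

/-- The two-form `∑_{m<j} x_{mj} σ_m σ_j` as an operator. -/
def antisymForm (x : Fin n → Fin n → SmoothTorus Θ) : (γ.torusTriple Θ).piOmega2 :=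
  ∑ m, ∑ j, if m < j then (γ.torusTriple Θ).lmulPi2 (x m j) (γ.sigmaMul Θ m j) else 0

theorem coe_antisymForm (x : Fin n → Fin n → SmoothTorus Θ) :
    (γ.antisymForm x : TorusL2 n (Spinor n) →L[ℂ] TorusL2 n (Spinor n)) =
      ∑ m, ∑ j, if m < j then
        SmoothTorus.rep (Spinor n) (x m j) * constBlock (γ.clm m * γ.clm j) else 0 := by
  rw [antisymForm, Submodule.coe_sum]
  refine Finset.sum_congr rfl fun m _ => ?_
  rw [Submodule.coe_sum]
  refine Finset.sum_congr rfl fun j _ => ?_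
  split_ifs <;> rfl

theorem mkQ_antisymForm (x : Fin n → Fin n → SmoothTorus Θ) :
    (γ.torusTriple Θ).piDJ.mkQ (γ.antisymForm x) = ∑ m, ∑ j, if m < j then
      x m j • (γ.torusTriple Θ).mul11 (γ.sigma Θ m) (γ.sigma Θ j) else 0 := by
  rw [antisymForm, map_sum]
  refine Finset.sum_congr rfl fun m _ => ?_
  rw [map_sum]
  refine Finset.sum_congr rfl fun j _ => ?_
  split_ifs
  · rw [mul11_sigma, SpectralTriple.Omega2.smul_mk]
  · exact map_zero _

/-- As $\pi(dJ_0^1)$ consists of algebra elements, this is the orthogonality of antisymmetric forms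
to it. It holds because every $\gamma_m\gamma_j$ with $m\ne j$ has trace zero. -/
theorem dixmierTrace_star_rep_mul_antisymForm (hn : 0 < n) (a : SmoothTorus Θ)
    (x : Fin n → Fin n → SmoothTorus Θ) :
    dixmierTrace ω (star (SmoothTorus.rep (Spinor n) a) *
      (γ.antisymForm x : TorusL2 n (Spinor n) →L[ℂ] TorusL2 n (Spinor n)) *
        absDiracInvPow n n) = 0 := by
  rw [← diracFunctional_apply hn ω, coe_antisymForm, Finset.mul_sum, map_sum]
  refine Finset.sum_eq_zero fun m _ => ?_
  rw [Finset.mul_sum, map_sum]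
  refine Finset.sum_eq_zero fun j _ => ?_
  split_ifs with h
  · rw [← map_star, ← mul_assoc, ← map_mul, diracFunctional_rep_mul_constBlock,
      γ.diracFunctional_clm_mul hn ω h.ne, mul_zero]
  · rw [mul_zero, map_zero]

theorem dixmierTrace_star_antisymForm_mul_self (hn : 0 < n) (x : Fin n → Fin n → SmoothTorus Θ) :
    dixmierTrace ω (star (γ.antisymForm x : TorusL2 n (Spinor n) →L[ℂ] TorusL2 n (Spinor n)) *
      (γ.antisymForm x : TorusL2 n (Spinor n) →L[ℂ] TorusL2 n (Spinor n)) * absDiracInvPow n n) =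
      dixmierTrace ω (absDiracInvPow n n) *
        ∑ m, ∑ j, if m < j then (star (x m j) * x m j).trace else 0 := by
  rw [← diracFunctional_apply hn ω]
  have key : ∀ m j, m < j → diracFunctional hn ω
      (star (SmoothTorus.rep (Spinor n) (x m j) * constBlock (γ.clm m * γ.clm j)) *
        (γ.antisymForm x : TorusL2 n (Spinor n) →L[ℂ] TorusL2 n (Spinor n))) =
      dixmierTrace ω (absDiracInvPow n n) * (star (x m j) * x m j).trace := by
    intro m j hmj
    -- Orthonormality of the products $\gamma_k\gamma_l$ leaves only the diagonal term of the double
    -- sum, where the algebra factor contributes its trace.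
    have hterm : ∀ k l, diracFunctional hn ω
        (star (SmoothTorus.rep (Spinor n) (x m j) * constBlock (γ.clm m * γ.clm j)) *
          if k < l then
            SmoothTorus.rep (Spinor n) (x k l) * constBlock (γ.clm k * γ.clm l) else 0) =
        if m = k ∧ j = l then
          dixmierTrace ω (absDiracInvPow n n) * (star (x m j) * x m j).trace else 0 := by
      intro k l
      by_cases hkl : k < l
      · rw [if_pos hkl, star_rep_mul_constBlock, rep_mul_constBlock_mul,
          diracFunctional_rep_mul_constBlock, γ.diracFunctional_star_clm_mul hn ω hmj hkl]
        split_ifs with h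
        · obtain ⟨rfl, rfl⟩ := h
          rw [mul_comm]
        · rw [mul_zero]
      · rw [if_neg hkl, mul_zero, map_zero, if_neg]
        rintro ⟨rfl, rfl⟩
        exact hkl hmj
    rw [coe_antisymForm, Finset.mul_sum, map_sum, Finset.sum_eq_single m]
    · rw [Finset.mul_sum, map_sum, Finset.sum_eq_single j]
      · rw [hterm, if_pos ⟨rfl, rfl⟩]
      · intro l _ hl
        rw [hterm, if_neg fun h => hl h.2.symm]
      · simp
    · intro k _ hk
      rw [Finset.mul_sum, map_sum]
      refine Finset.sum_eq_zero fun l _ => ?_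
      rw [hterm, if_neg fun h => hk h.1.symm]
    · simp
  conv_lhs => rw [coe_antisymForm, star_sum, Finset.sum_mul, map_sum, ← coe_antisymForm]
  rw [Finset.mul_sum]
  refine Finset.sum_congr rfl fun m _ => ?_
  rw [star_sum, Finset.sum_mul, map_sum, Finset.mul_sum]
  refine Finset.sum_congr rfl fun j _ => ?_
  split_ifs with h
  · exact key m j h
  · rw [star_zero, zero_mul, map_zero, mul_zero]

/-- The antisymmetric representative is already orthogonal to $\pi(dJ_0^1)$, so the projection fixes
it and the norm of its class is its own norm. The result is the same for every completion. -/
theorem innerOmega2_antisymForm (hn : 0 < n)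
    (𝒦 : (γ.torusTriple Θ).Completion2 ω (absDiracInvPow n n))
    (x : Fin n → Fin n → SmoothTorus Θ) :
    𝒦.innerOmega2 ((γ.torusTriple Θ).piDJ.mkQ (γ.antisymForm x))
        ((γ.torusTriple Θ).piDJ.mkQ (γ.antisymForm x)) =
      dixmierTrace ω (absDiracInvPow n n) *
        ∑ m, ∑ j, if m < j then (star (x m j) * x m j).trace else 0 := by
  rw [SpectralTriple.Completion2.innerOmega2, 𝒦.proj_mkQ_of_orthogonal, 𝒦.inner_emb,
    γ.dixmierTrace_star_antisymForm_mul_self ω hn]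
  intro W hW
  obtain ⟨a, ha⟩ := γ.exists_eq_rep_of_mem_piDJ hW
  rw [ha, γ.dixmierTrace_star_rep_mul_antisymForm ω hn]

/-- The `s`-th coordinate of the curvature at $pe_k$ is the antisymmetric form with coefficients the
`(s, k)` entries of the commutator matrices $F_{mj}$. Summing $\tau(|F_{sk}|^2)$ over `s` and `k`
gives $\tau_q(F^*F)$. -/
theorem yangMills_eq (hn : 0 < n) {q : ℕ} {p : Matrix (Fin q) (Fin q) (SmoothTorus Θ)}
    (𝒦 : (γ.torusTriple Θ).Completion2 ω (absDiracInvPow n n))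
    {nabla : (γ.torusTriple Θ).CompatibleConnection p}
    {comp : Fin n → projModule p →ₗ[ℂ] projModule p} (hcomp : γ.IsComponents nabla comp) :
    𝒦.yangMills nabla = dixmierTrace ω (absDiracInvPow n n) *
      ∑ m, ∑ j, if m < j then SmoothTorus.matrixTrace
        ((endMatrix (hcomp.commutator m j)).conjTranspose * endMatrix (hcomp.commutator m j))
      else 0 := by
  have hterm : ∀ k s, 𝒦.innerOmega2
      ((γ.torusTriple Θ).coord p s (nabla.curvature (projBasis p k)))
      ((γ.torusTriple Θ).coord p s (nabla.curvature (projBasis p k))) =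
      dixmierTrace ω (absDiracInvPow n n) * ∑ m, ∑ j, if m < j then
        (star (endMatrix (hcomp.commutator m j) s k) *
          endMatrix (hcomp.commutator m j) s k).trace else 0 := by
    intro k s
    rw [hcomp.coord_curvature, ← γ.mkQ_antisymForm fun m j =>
      (hcomp.commutator m j (projBasis p k)).1 s, γ.innerOmega2_antisymForm ω hn]
    rfl
  rw [SpectralTriple.Completion2.yangMills, SpectralTriple.Completion2.innerHom]
  simp only [hterm, ← Finset.mul_sum]
  congr 1
  have hM : ∀ m j, SmoothTorus.matrixTrace
      ((endMatrix (hcomp.commutator m j)).conjTranspose * endMatrix (hcomp.commutator m j)) =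
      ∑ k, ∑ s, (star (endMatrix (hcomp.commutator m j) s k) *
          endMatrix (hcomp.commutator m j) s k).trace := by
    intro m j
    rw [SmoothTorus.matrixTrace]
    refine Finset.sum_congr rfl fun k _ => ?_
    rw [Matrix.mul_apply, map_sum]
    rfl
  calc ∑ k, ∑ s, ∑ m, ∑ j, (if m < j then
        (star (endMatrix (hcomp.commutator m j) s k) *
          endMatrix (hcomp.commutator m j) s k).trace else 0)
      = ∑ k, ∑ m, ∑ s, ∑ j, (if m < j then
        (star (endMatrix (hcomp.commutator m j) s k) *
          endMatrix (hcomp.commutator m j) s k).trace else 0) :=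
        Finset.sum_congr rfl fun k _ => Finset.sum_comm
    _ = ∑ k, ∑ m, ∑ j, ∑ s, (if m < j then
        (star (endMatrix (hcomp.commutator m j) s k) *
          endMatrix (hcomp.commutator m j) s k).trace else 0) :=
        Finset.sum_congr rfl fun k _ => Finset.sum_congr rfl fun m _ => Finset.sum_comm
    _ = ∑ m, ∑ k, ∑ j, ∑ s, (if m < j then
        (star (endMatrix (hcomp.commutator m j) s k) *
          endMatrix (hcomp.commutator m j) s k).trace else 0) := Finset.sum_comm
    _ = ∑ m, ∑ j, ∑ k, ∑ s, (if m < j then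
        (star (endMatrix (hcomp.commutator m j) s k) *
          endMatrix (hcomp.commutator m j) s k).trace else 0) :=
        Finset.sum_congr rfl fun m _ => Finset.sum_comm
    _ = _ := by
        refine Finset.sum_congr rfl fun m _ => Finset.sum_congr rfl fun j _ => ?_
        split_ifs
        · exact (hM m j).symm
        · simp

end GammaMatrices

end

theorem mainTheorem3 (n q : ℕ) (hn : 0 < n) (Θ : Matrix (Fin n) (Fin n) ℝ)
    (hΘ : Θ.transpose = -Θ) (γ : GammaMatrices n) (ω : DixmierLimit)
    (p : Matrix (Fin q) (Fin q) (SmoothTorus Θ)) (hp : IsStarProjection p)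
    (nabla : (γ.torusTriple Θ).CompatibleConnection p) :
    (∃! comp, γ.IsComponents nabla comp) ∧
    ∃ c : ℝ, 0 < c ∧ dixmierTrace ω (GammaMatrices.absDiracInvPow n n) = c ∧
      Nonempty ((γ.torusTriple Θ).Completion2 ω (GammaMatrices.absDiracInvPow n n)) ∧
      ∀ comp, γ.IsComponents nabla comp →
        ∃ F : Fin n → Fin n → Module.End (SmoothTorus Θ)ᵐᵒᵖ (projModule p),
          (∀ m j ξ, F m j ξ = comp m (comp j ξ) - comp j (comp m ξ)) ∧
          ∀ 𝒦 : (γ.torusTriple Θ).Completion2 ω (GammaMatrices.absDiracInvPow n n),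
            𝒦.yangMills nabla = (c : ℂ) *
              ∑ m, ∑ j, if m < j then
                SmoothTorus.matrixTrace ((endMatrix (F m j)).conjTranspose * endMatrix (F m j))
              else 0 := by
  obtain ⟨c, hc, h⟩ := GammaMatrices.dixmierTrace_absDiracInvPow hn ω
  refine ⟨γ.existsUnique_isComponents nabla, c, hc, h, γ.nonempty_completion2 hn ω,
    fun comp hcomp => ⟨hcomp.commutator, fun _ _ _ => rfl, fun 𝒦 => ?_⟩⟩
  rw [γ.yangMills_eq ω hn 𝒦 hcomp, h]
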